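/- For $N\ge 1$ let $\hat U(N)$ be the set of signatures, i.e. non-increasing $N$-tuples $\lambda=(\lambda_1\ge\cdots\ge\lambda_N)\in\mathbb Z^N$. For $\lambda\in\hat U(N)$ let $$\chi^{\lambda}(u_1,\dots,u_N)=\frac{\det\big(u_i^{\lambda_j+N-j}\big)_{1\le i,j\le N}}{\prod_{1\le i<j\le N}(u_i-u_j)}$$ be the rational Schur function (extended by continuity to points of $(\mathbb C\setminus\{0\})^N$ with coinciding coordinates), and for $q\in[-1,1]$ let $$m_{N,PP(q)}[\lambda]=\frac1N\sum_{i=1}^N\Big(\prod_{j\ne i}\frac{(\lambda_i-i)-(\lambda_j-j)-q}{(\lambda_i-i)-(\lambda_j-j)}\Big)\,\delta\Big(\frac{\lambda_i+N-i}{N}\Big)$$ be its $q$-deformed Perelomov–Popov measure, where $\delta(x)$ is the unit mass at $x$. Let $\varrho(N)$, $N\ge 1$, be probability measures on $\hat U(N)$ such that for each $N$ the series defining the Schur generating function $$S_{\varrho(N)}(u_1,\dots,u_N)=\sum_{\lambda\in\hat U(N)}\varrho(N)[\lambda]\,\frac{\chi^\lambda(u_1,\dots,u_N)}{\chi^\lambda(1,\dots,1)}$$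 converges uniformly in a neighborhood of $1^N=(1,\dots,1)$ in $\mathbb C^N$. Suppose that there are real numbers $a_0,a_1,a_2,\dots$ such that $$\lim_{N\to\infty}\partial_{i_0}^k\Big(\frac1N\log S_{\varrho(N)}\Big)(1^N)=a_k,\qquad \lim_{N\to\infty}\partial_{i_1}\cdots\partial_{i_m}\Big(\frac1N\log S_{\varrho(N)}\Big)(1^N)=0$$ for all fixed $k\ge1$ and all fixed indices $i_0,i_1,\dots,i_m\ge 1$ with $|\{i_1,\dots,i_m\}|\ge2$, and that the power series $\Psi(z)=\sum_{k\ge0}a_k\frac{(z-1)^k}{k!}$ converges in a neighborhood of $1$. Then for every $q\in[-1,1]$ there is a (deterministic) probability measure $\mu^{(q)}$ on $\mathbb R$, all of whose moments $\mu^{(q)}_k=\int t^k\,\mu^{(q)}(dt)$ are finite, with $$\mu_k^{(q)}=\sum_{m=0}^k\binom km\frac1{(m+1)!}\,\frac{d^m}{du^m}\Big(u^{k-q}\,(\Psi'(u))^{k-m}\Big)\Big|_{u=1}\qquad(k\ge 0),$$ such that the random measures $m_{N,PP(q)}[\lambda(N)]$, with $\lambda(N)$ distributed according to $\varrho(N)$,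 converge to $\mu^{(q)}$ in probability in the sense of moments: for every $k\ge0$, $\int t^k\,m_{N,PP(q)}[\lambda(N)](dt)\to\mu_k^{(q)}$ in probability as $N\to\infty$. Moreover, for all $q,q'\in[-1,1]$ and all $z\in\mathbb C$ in a neighborhood of $0$, the series $\sum_k\mu_k^{(q)}z^{k+1}$ and $\sum_k\mu_k^{(q')}z^{k+1}$ converge and $$\Big(1-q\sum_{k=0}^\infty\mu_k^{(q)}z^{k+1}\Big)^{1/q}=\Big(1-q'\sum_{k=0}^\infty\mu_k^{(q')}z^{k+1}\Big)^{1/q'}$$ (principal branches), where for $q=0$ the left-hand side is read as its limit $\exp\big(-\sum_{k}\mu_k^{(0)}z^{k+1}\big)$, and likewise for $q'=0$ on the right. -/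

import Mathlib

open Filter Topology MeasureTheory

noncomputable section

/-- The set `Û(N)` of signatures: non-increasing `N`-tuples of integers. With indices counted
from `0`, the number `lam i + N - i` of the literature (`i = 1, …, N`) reads
`lam i + N - 1 - i` (`i = 0, …, N - 1`). -/
abbrev Signature (N : ℕ) : Type := {lam : Fin N → ℤ // Antitone lam}

/-- The quotient `det (u_i ^ (lam_j + N - j)) / ∏_{i < j} (u_i - u_j)`. -/
def schurRatio {N : ℕ} (lam : Signature N) (u : Fin N → ℂ) : ℂ :=
  (Matrix.of fun i j : Fin N => u i ^ (lam.1 j + (N : ℤ) - 1 - ((j : ℕ) : ℤ))).det /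
    ∏ i : Fin N, ∏ j ∈ Finset.Ioi i, (u i - u j)

/-- The rational Schur function `χ^lam`, the character of the irreducible representation of
`U(N)` with signature `lam`: the quotient `schurRatio`, which makes sense at points with pairwise
distinct coordinates, extended by continuity to all points with non-zero coordinates. -/
def rationalSchur {N : ℕ} (lam : Signature N) : (Fin N → ℂ) → ℂ :=
  extendFrom {u : Fin N → ℂ | Function.Injective u} (schurRatio lam)

/-- The summand `ϱ[lam] χ^lam(u) / χ^lam(1^N)` of the Schur generating function. -/
def schurTerm {N : ℕ} (ϱ : PMF (Signature N)) (lam : Signature N) (u : Fin N → ℂ) : ℂ :=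
  ((ϱ lam).toReal : ℂ) * (rationalSchur lam u / rationalSchur lam 1)

/-- The Schur generating function `S_ϱ(u) = ∑ ϱ[lam] χ^lam(u) / χ^lam(1^N)`. -/
def schurGen {N : ℕ} (ϱ : PMF (Signature N)) (u : Fin N → ℂ) : ℂ :=
  ∑' lam : Signature N, schurTerm ϱ lam u

/-- The function `(1 / N) log S_ϱ`; near `1^N`, where `S_ϱ` is close to `1`, the principal
branch of the logarithm is the analytic one. -/
def logSchurGen {N : ℕ} (ϱ : PMF (Signature N)) (u : Fin N → ℂ) : ℂ :=
  (1 / (N : ℂ)) * Complex.log (schurGen ϱ u)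

/-- The complex partial derivative of a function of `N` variables with respect to the variable
with number `i` (counted from `0`). The value `0` for `i ≥ N` is a placeholder. -/
def partialD {N : ℕ} (i : ℕ) (f : (Fin N → ℂ) → ℂ) (u : Fin N → ℂ) : ℂ :=
  if h : i < N then deriv (fun t : ℂ => f (Function.update u ⟨i, h⟩ t)) (u ⟨i, h⟩) else 0

/-- The iterated partial derivative `∂_{i₁} ⋯ ∂_{i_m} f` along a list `[i₁, …, i_m]`. -/
def iterPartialD {N : ℕ} (is : List ℕ) (f : (Fin N → ℂ) → ℂ) : (Fin N → ℂ) → ℂ :=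
  is.foldr partialD f

/-- The `q`-deformed Perelomov–Popov measure of a signature
(for `q ∈ [-1, 1]` all the weights are non-negative). -/
def ppMeasure {N : ℕ} (q : ℝ) (lam : Signature N) : Measure ℝ :=
  ∑ i : Fin N,
    ENNReal.ofReal ((1 / (N : ℝ)) * ∏ j ∈ Finset.univ.erase i,
      ((((lam.1 i : ℝ) - (i : ℕ)) - ((lam.1 j : ℝ) - (j : ℕ)) - q) /
        (((lam.1 i : ℝ) - (i : ℕ)) - ((lam.1 j : ℝ) - (j : ℕ))))) •
    Measure.dirac (((lam.1 i : ℝ) + (N : ℝ) - 1 - (i : ℕ)) / (N : ℝ))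

/-- The power series `Ψ(z) = ∑ a_k (z - 1)^k / k!`. -/
def psiSeries (a : ℕ → ℝ) (z : ℝ) : ℝ :=
  ∑' k : ℕ, a k * (z - 1) ^ k / (k.factorial : ℝ)

/-- The number
`∑_{m=0}^k C(k, m) / (m + 1)! · (d/du)^m (u^{k - q} Ψ'(u)^{k - m})` at `u = 1`. -/
def limitMoment (Ψ : ℝ → ℝ) (q : ℝ) (k : ℕ) : ℝ :=
  ∑ m ∈ Finset.range (k + 1), ((k.choose m : ℝ) / ((m + 1).factorial : ℝ)) *
    iteratedDeriv m (fun u : ℝ => u ^ ((k : ℝ) - q) * (deriv Ψ u) ^ (k - m)) 1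

/-- Convergence in probability, in the sense of moments, of the random measures
`m N lam`, where `lam` has distribution `ϱ N`, to the deterministic measure `μ`:
every moment converges in probability to the corresponding moment of `μ`. -/
def ConvInProbMoments (ϱ : ∀ N : ℕ, PMF (Signature N))
    (m : ∀ N : ℕ, Signature N → Measure ℝ) (μ : Measure ℝ) : Prop :=
  ∀ k : ℕ, ∀ ε : ℝ, 0 < ε →
    Tendsto (fun N : ℕ => (ϱ N).toOuterMeasure
      {lam | ε ≤ |(∫ t, t ^ k ∂(m N lam)) - ∫ t, t ^ k ∂μ|}) atTop (𝓝 0)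

/-- The function `(1 - q ∑ c_k z^{k+1})^{1/q}` (principal branch; the base is close to `1` for
`z` close to `0`), read for `q = 0` as its limit `exp (-∑ c_k z^{k+1})`. -/
def qTransform (q : ℝ) (c : ℕ → ℝ) (z : ℂ) : ℂ :=
  if q = 0 then Complex.exp (-∑' k : ℕ, (c k : ℂ) * z ^ (k + 1))
  else (1 - (q : ℂ) * ∑' k : ℕ, (c k : ℂ) * z ^ (k + 1)) ^ (1 / (q : ℂ))

end

open scoped ContDiff

set_option linter.unusedSectionVars false

/-! The moments of the `q = 1` measure are read off a differential operator. Write `D_i = u_i ∂_i`,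
let `L` be the Lax matrix with entries `D_i δ_ij - u_i / (u_i - u_j)`, and let `H` be the matrix
Calogero Hamiltonian. Then `L` and `H` commute (`calogeroOp_laxOp`), and contraction with the row
`(u_i⁻¹)` intertwines `H` with the scalar Laplacian `∑ D_i ^ 2` up to `2 L - 1`
(`two_invContract_laxOp`). A constant vector whose entries are the alternant `det (u_i ^ l_j)` is an
eigenvector of `H`, hence so are all its images under powers of `L`; comparing eigenvalues gives
`∑_i u_i⁻¹ (L ^ k a_l)_i = ∑_p l_p ^ k a_{l - e_p}` (`invContract_iterate_laxOp`).

Dividing by the Vandermonde product turns `L` into the single operator `A = D_0 + ∑_j u_0 / (u_0 -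
u_j) (1 - s_{0j})` on power series at `1` (`lowOp`), and the identity becomes `∑_i u_i⁻¹ s_{0i} A ^
k s_l = ∑_p l_p ^ k s_{l - e_p}` (`shiftOp_schur`). By Weyl's dimension formula `s_{l - e_p}(1) /
s_l(1)` is the unnormalised Perelomov–Popov weight at `q = 1`. So `N ^ (-k) (A ^ k S)(1)` is the
expected `k`-th moment, where `S` is the Schur generating function, and applying `A ^ k'` after the
shift operator gives mixed second moments.

Conjugation of `A / N` by `S` gives an operator depending on `(1 / N) log S` only. The hypotheses
say that the derivative of this logarithm converges coefficientwise to a series in `u_0` alone, and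
the average of the divided differences converges by symmetry. The limit operator is `f ↦ u (Ψ' f +
(f - f(1)) / (u - 1))` (`limOp`), so the expected moments converge; in the mixed case an average
over swaps collapses to a constant, so the limit factorises. Lowering one coordinate changes the
moments by `O(N⁻²)`, hence the variances tend to zero and Chebyshev's inequality gives convergence
in probability for `q = 1`.

For other `q`, partial fractions give `1 - q t M_q(t) = ∏ (1 - (x_j + q / N) t) / ∏ (1 - x_j t)`,
where `M_q` is the moment series and `x_j` are the rescaled coordinates. Its logarithmic derivative
is a recursion between the `q`-moments and the power means of the `x_j`. Solving it at `q = 1` for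
the power means and then at general `q` for the moments transports the convergence. With `H_q(t) = t
M_q(t)`, in the limit `H_q' = (1 - q H_q) H_0'`, that is `(1 - q H_q) ^ (1 / q) = exp (-H_0)`, which
is the relation between different `q`.

For the closed formula, the recursion of the limit operator telescopes to `1 - H_1(τ) = 1 / u` with
`τ = (u - 1) / φ` and `φ = u (1 + (u - 1) Ψ')`. Hence `1 - q H_q(τ) = u ^ (-q)`, and Lagrange
inversion extracts the coefficients. The same coefficient formula bounds the moments geometrically.
The limit measure exists because its moments are limits of moments of honest probability measures,
which are tight. -/

lemma Derivation.map_prod_eq {R A κ : Type*} [CommRing R] [CommRing A] [Algebra R A] [DecidableEq κ]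
    (D : Derivation R A A) (s : Finset κ) (f : κ → A) :
    D (∏ i ∈ s, f i) = ∑ i ∈ s, (∏ j ∈ s.erase i, f j) * D (f i) := by
  induction s using Finset.induction_on with
  | empty => simp
  | insert a s ha ih =>
    rw [Finset.prod_insert ha, Derivation.leibniz, ih, Finset.sum_insert ha,
      Finset.erase_insert ha, smul_eq_mul, smul_eq_mul, Finset.mul_sum, add_comm]
    congr 1
    refine Finset.sum_congr rfl fun i hi => ?_
    have hne : a ≠ i := fun h => ha (h ▸ hi)
    rw [Finset.erase_insert_of_ne hne, Finset.prod_insert (fun h => ha (Finset.mem_of_mem_erase h)),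
      mul_assoc]

lemma Derivation.map_prod_field {R F κ : Type*} [CommRing R] [Field F] [Algebra R F]
    (D : Derivation R F F) (s : Finset κ) (f : κ → F) (hf : ∀ i ∈ s, f i ≠ 0) :
    D (∏ i ∈ s, f i) = (∏ i ∈ s, f i) * ∑ i ∈ s, D (f i) / f i := by
  classical
  rw [Derivation.map_prod_eq, Finset.mul_sum]
  refine Finset.sum_congr rfl fun i hi => ?_
  rw [← Finset.mul_prod_erase s f hi]
  have := hf i hi
  field_simp

/-! ### The Lax pair of the Calogero model and its action on alternants. -/

section LaxPair

variable {ι K : Type*} [Field K]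

/-- The kernel `u_i / (u_i - u_j)` (zero on the diagonal). -/
def laxKernel (u : ι → K) (i j : ι) : K := u i / (u i - u j)

/-- The kernel `u_i u_j / (u_i - u_j)^2` (zero on the diagonal). -/
def calogeroKernel (u : ι → K) (i j : ι) : K := u i * u j / (u i - u j) ^ 2

lemma laxKernel_self (u : ι → K) (i : ι) : laxKernel u i i = 0 := by simp [laxKernel]

lemma calogeroKernel_self (u : ι → K) (i : ι) : calogeroKernel u i i = 0 := by
  simp [calogeroKernel]

lemma calogeroKernel_symm (u : ι → K) (i j : ι) :
    calogeroKernel u i j = calogeroKernel u j i := by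
  unfold calogeroKernel
  rw [mul_comm (u i), ← neg_sub (u j) (u i), neg_sq]

variable [Fintype ι] [DecidableEq ι]

/-- The Lax operator `(d_i δ_ij - u_i / (u_i - u_j))_{ij}` of the Calogero model. -/
def laxOp (d : ι → Derivation ℤ K K) (u : ι → K) (g : ι → K) (i : ι) : K :=
  d i (g i) - ∑ j, laxKernel u i j * g j

/-- The sum of the squares of the derivations `d_l`. -/
def sqSum (d : ι → Derivation ℤ K K) (f : K) : K := ∑ l, d l (d l f)

/-- The matrix Calogero Hamiltonian. -/
def calogeroOp (d : ι → Derivation ℤ K K) (u : ι → K) (g : ι → K) (i : ι) : K :=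
  sqSum d (g i) - 2 * ∑ j, calogeroKernel u i j * (g i - g j)

/-- The contraction of a vector with `(u_i⁻¹)_i`. -/
def invContract (u : ι → K) (g : ι → K) : K := ∑ i, (u i)⁻¹ * g i

variable {d : ι → Derivation ℤ K K} {u : ι → K}
  (hu : Function.Injective u) (hu0 : ∀ i, u i ≠ 0)
  (hdu : ∀ i j, d i (u j) = if i = j then u i else 0)
  (hcomm : ∀ i j f, d i (d j f) = d j (d i f))

include hdu hu in
lemma deriv_laxKernel (l i j : ι) :
    d l (laxKernel u i j) =
      (if l = j then calogeroKernel u i j else 0) - if l = i then calogeroKernel u i j else 0 := by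
  rcases eq_or_ne i j with rfl | hij
  · simp [laxKernel_self]
  have h : u i - u j ≠ 0 := sub_ne_zero.2 (hu.ne hij)
  unfold laxKernel calogeroKernel
  rw [Derivation.leibniz_div, map_sub, hdu, hdu]
  by_cases h1 : l = i
  · subst h1
    simp [hij]
    field_simp
    ring
  · by_cases h2 : l = j
    · subst h2
      simp [h1]
      field_simp
    · simp [h1, h2]

include hdu hu in
lemma deriv_calogeroKernel (l i j : ι) :
    d l (calogeroKernel u i j) =
      (if l = i then calogeroKernel u i j * (laxKernel u j i - laxKernel u i j) else 0) -
      if l = j then calogeroKernel u i j * (laxKernel u j i - laxKernel u i j) else 0 := by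
  rcases eq_or_ne i j with rfl | hij
  · simp [calogeroKernel_self]
  have h : u i - u j ≠ 0 := sub_ne_zero.2 (hu.ne hij)
  have h' : u j - u i ≠ 0 := sub_ne_zero.2 (hu.ne hij.symm)
  unfold laxKernel calogeroKernel
  rw [Derivation.leibniz_div, Derivation.leibniz, Derivation.leibniz_pow, map_sub, hdu, hdu]
  have e : u j / (u j - u i) = - u j / (u i - u j) := by
    rw [← neg_sub (u i) (u j), div_neg, neg_div]
  rw [e]
  by_cases h1 : l = i
  · subst h1
    simp [hij]
    field_simp
    ring
  · by_cases h2 : l = j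
    · subst h2
      simp [h1]
      field_simp
      ring
    · simp [h1, h2]

include hdu hu in
lemma sqSum_laxKernel_mul (i j : ι) (f : K) :
    sqSum d (laxKernel u i j * f) = laxKernel u i j * sqSum d f
      + 2 * calogeroKernel u i j * (d j f - d i f)
      - 2 * (calogeroKernel u i j * (laxKernel u j i - laxKernel u i j)) * f := by
  have key : ∀ l, d l (d l (laxKernel u i j * f)) =
      laxKernel u i j * d l (d l f) +
      (if l = j then 2 * calogeroKernel u i j * d j f +
        (d j (calogeroKernel u i j)) * f else 0) -
      (if l = i then 2 * calogeroKernel u i j * d i f + (d i (calogeroKernel u i j)) * f else 0) := by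
    intro l
    rw [Derivation.leibniz, map_add, smul_eq_mul, smul_eq_mul, Derivation.leibniz,
      Derivation.leibniz, deriv_laxKernel hu hdu]
    simp only [smul_eq_mul, map_sub]
    by_cases h1 : l = i <;> by_cases h2 : l = j
    · subst h1; subst h2
      simp [calogeroKernel_self]
    · subst h1
      simp [h2]; ring
    · subst h2
      simp [h1]; ring
    · simp [h1, h2]
  unfold sqSum
  simp only [key, Finset.sum_sub_distrib, Finset.sum_add_distrib, ← Finset.mul_sum,
    Finset.sum_ite_eq', Finset.mem_univ, if_true]
  rw [deriv_calogeroKernel hu hdu, deriv_calogeroKernel hu hdu]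
  rcases eq_or_ne i j with rfl | hij
  · simp [calogeroKernel_self]
  · simp [hij, hij.symm]
    ring

include hu in
-- For distinct indices this is the rational identity behind integrability: the left-hand side
-- vanishes. The terms on the right are the degenerate cases in which two indices coincide and a
-- kernel is zero by the convention on the diagonal.
lemma laxKernel_triple (i j k : ι) :
    calogeroKernel u i j * (laxKernel u i k - laxKernel u j k)
      - laxKernel u i k * calogeroKernel u k j + laxKernel u i j * calogeroKernel u j k =
    (if k = j then calogeroKernel u i j * laxKernel u i j else 0)
      - (if j = i then laxKernel u i k * calogeroKernel u i k else 0)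
      - (if k = i then calogeroKernel u i j * (laxKernel u j i - laxKernel u i j) else 0) := by
  have hs := calogeroKernel_symm u
  rcases eq_or_ne k j with rfl | hkj
  · by_cases h : k = i
    · subst h; simp [calogeroKernel_self]
    · simp [h, calogeroKernel_self, laxKernel_self]
  rcases eq_or_ne j i with rfl | hji
  · simp [calogeroKernel_self, hkj, laxKernel_self]
    exact Or.inl (hs k j ▸ rfl)
  rcases eq_or_ne k i with rfl | hki
  · simp [laxKernel_self, hkj, hji]
    rw [hs j k]; ring
  simp only [hkj, hji, hki, if_false]
  have h1 : u k - u j ≠ 0 := sub_ne_zero.2 (hu.ne hkj)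
  have h1' : u j - u k ≠ 0 := sub_ne_zero.2 (hu.ne hkj.symm)
  have h2 : u i - u j ≠ 0 := sub_ne_zero.2 (hu.ne hji.symm)
  have h3 : u i - u k ≠ 0 := sub_ne_zero.2 (hu.ne hki.symm)
  rw [hs k j]
  unfold laxKernel calogeroKernel
  field_simp
  ring

include hu hdu hcomm in
/-- The Lax operator commutes with the matrix Calogero Hamiltonian. -/
lemma calogeroOp_laxOp (g : ι → K) :
    calogeroOp d u (laxOp d u g) = laxOp d u (calogeroOp d u g) := by
  funext i
  have hsq : ∀ f, sqSum d (d i f) = d i (sqSum d f) := by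
    intro f
    simp only [sqSum, map_sum]
    refine Finset.sum_congr rfl fun l _ => ?_
    rw [hcomm l i f, hcomm l i]
  have hsub : ∀ f f', sqSum d (f - f') = sqSum d f - sqSum d f' := by
    intro f f'; simp [sqSum, Finset.sum_sub_distrib]
  have hsum : ∀ F : ι → K, sqSum d (∑ j, F j) = ∑ j, sqSum d (F j) := by
    intro F
    simp only [sqSum, map_sum]
    exact Finset.sum_comm
  have hd : ∀ j, d i (calogeroKernel u i j * (g i - g j)) =
      calogeroKernel u i j * (d i (g i) - d i (g j)) +
      calogeroKernel u i j * (laxKernel u j i - laxKernel u i j) * (g i - g j) := by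
    intro j
    rw [Derivation.leibniz, deriv_calogeroKernel hu hdu, map_sub]
    simp only [smul_eq_mul, if_true]
    rcases eq_or_ne i j with rfl | hij
    · simp
    · simp [hij]; ring
  simp only [calogeroOp, laxOp, hsub, hsum, hsq, sqSum_laxKernel_mul hu hdu, map_sub,
    map_sum, two_mul, map_add, hd]
  simp only [Finset.mul_sum, mul_sub, mul_add, sub_mul, add_mul,
    Finset.sum_sub_distrib, Finset.sum_add_distrib]
  -- After summation the contributions of `k = j` and `j = i` cancel each other; the one of `k = i`
  -- survives and matches the derivative of the exchange kernel.
  have tri : ∑ j, ∑ k, (calogeroKernel u i j * (laxKernel u i k - laxKernel u j k)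
      - laxKernel u i k * calogeroKernel u k j + laxKernel u i j * calogeroKernel u j k) * g k =
      - ∑ j, calogeroKernel u i j * (laxKernel u j i - laxKernel u i j) * g i := by
    simp only [laxKernel_triple hu, sub_mul, ite_mul, zero_mul, Finset.sum_sub_distrib,
      Finset.sum_ite_eq', Finset.mem_univ, if_true]
    rw [Finset.sum_comm (f := fun j k => if j = i then laxKernel u i k * calogeroKernel u i k * g k else 0)]
    simp only [Finset.sum_ite_eq', Finset.mem_univ, if_true]
    simp only [mul_comm (laxKernel u i _), sub_self, zero_sub, mul_sub, sub_mul, Finset.sum_sub_distrib]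
  have sw : ∑ j, ∑ k, laxKernel u i j * (calogeroKernel u j k * g j) =
      ∑ j, ∑ k, laxKernel u i k * (calogeroKernel u k j * g k) := Finset.sum_comm
  rw [sw]
  simp only [mul_sub, sub_mul, add_mul, Finset.sum_sub_distrib, Finset.sum_add_distrib] at tri
  simp only [mul_assoc] at tri ⊢
  linear_combination 2 * tri

include hu hu0 hdu in
-- This makes the commuting pair useful: up to the last term, the Lax operator is half the failure
-- of the row `(u_i⁻¹)` to intertwine the matrix Hamiltonian with the scalar one, so powers of the
-- Lax operator can be computed from eigenvalues alone.
lemma two_invContract_laxOp (g : ι → K) :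
    2 * invContract u (laxOp d u g) =
      invContract u (calogeroOp d u g) - sqSum d (invContract u g) + invContract u g := by
  have hinv : ∀ l i, d l ((u i)⁻¹) = if l = i then -(u i)⁻¹ else 0 := by
    intro l i
    rw [Derivation.leibniz_inv, hdu]
    by_cases h : l = i
    · subst h; simp; field_simp [hu0 l]
    · simp [h]
  have h1 : ∀ i, sqSum d ((u i)⁻¹ * g i) =
      (u i)⁻¹ * sqSum d (g i) - 2 * ((u i)⁻¹ * d i (g i)) + (u i)⁻¹ * g i := by
    intro i
    have key : ∀ l, d l (d l ((u i)⁻¹ * g i)) = (u i)⁻¹ * d l (d l (g i)) +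
        if l = i then - 2 * ((u i)⁻¹ * d i (g i)) + (u i)⁻¹ * g i else 0 := by
      intro l
      rw [Derivation.leibniz, map_add, smul_eq_mul, smul_eq_mul, Derivation.leibniz,
        Derivation.leibniz, hinv]
      by_cases h : l = i
      · subst h; simp [hinv]; ring
      · simp [h]
    unfold sqSum
    simp only [key, Finset.sum_add_distrib, ← Finset.mul_sum, Finset.sum_ite_eq', Finset.mem_univ,
      if_true]
    ring
  have hsum : ∀ F : ι → K, sqSum d (∑ j, F j) = ∑ j, sqSum d (F j) := by
    intro F
    simp only [sqSum, map_sum]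
    exact Finset.sum_comm
  -- Symmetrise in `i, j` and use `(u_j⁻¹ - u_i⁻¹) u_i u_j / (u_i - u_j) ^ 2 = 1 / (u_i - u_j)`.
  have h3 : ∑ i, ∑ j, (u i)⁻¹ * (calogeroKernel u i j * (g i - g j)) =
      ∑ i, ∑ j, (u i)⁻¹ * (laxKernel u i j * g j) := by
    have e1 : ∑ i, ∑ j, (u i)⁻¹ * (calogeroKernel u i j * g i) =
      ∑ i, ∑ j, (u j)⁻¹ * (calogeroKernel u i j * g j) := by
      rw [Finset.sum_comm]
      simp only [calogeroKernel_symm u]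
    simp only [mul_sub, Finset.sum_sub_distrib]
    rw [e1, ← Finset.sum_sub_distrib]
    refine Finset.sum_congr rfl fun i _ => ?_
    rw [← Finset.sum_sub_distrib]
    refine Finset.sum_congr rfl fun j _ => ?_
    rcases eq_or_ne i j with rfl | hij
    · simp [calogeroKernel_self, laxKernel_self]
    have h : u i - u j ≠ 0 := sub_ne_zero.2 (hu.ne hij)
    have a := hu0 i
    have b := hu0 j
    unfold laxKernel calogeroKernel
    field_simp
  simp only [invContract, laxOp, calogeroOp, hsum, h1, mul_sub, Finset.mul_sum, mul_left_comm _ (2 : K),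
    Finset.sum_sub_distrib, Finset.sum_add_distrib]
  simp only [mul_sub, Finset.sum_sub_distrib] at h3
  simp only [← Finset.mul_sum] at h3 ⊢
  linear_combination 2 * h3

/-- The alternant `det (u_i ^ l_j)`. -/
def fieldAlternant (u : ι → K) (l : ι → ℤ) : K := (Matrix.of fun i j => u i ^ l j).det

include hdu in
lemma deriv_zpow_var (hu0 : ∀ i, u i ≠ 0) (i j : ι) (n : ℤ) :
    d i (u j ^ n) = if i = j then (n : K) * u j ^ n else 0 := by
  rw [Derivation.leibniz_zpow, hdu]
  by_cases h : i = j
  · subst h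
    have : u i ^ n = u i ^ (n - 1) * u i := by rw [← zpow_add_one₀ (hu0 i)]; simp
    simp [this]
  · simp [h]

include hu0 hdu in
-- All monomials in the Leibniz expansion have the same exponents up to a permutation, hence the
-- same eigenvalue.
lemma sqSum_fieldAlternant (l : ι → ℤ) :
    sqSum d (fieldAlternant u l) = (∑ j, (l j : K) ^ 2) * fieldAlternant u l := by
  have hprod : ∀ (σ : Equiv.Perm ι) (i : ι),
      d i (∏ j, u (σ j) ^ l j) = (l (σ.symm i) : K) * ∏ j, u (σ j) ^ l j := by
    intro σ i
    rw [Derivation.map_prod_eq]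
    simp only [deriv_zpow_var hdu hu0, mul_ite, mul_zero]
    have : ∀ j, (i = σ j) ↔ (σ.symm i = j) := fun j => by rw [Equiv.symm_apply_eq]
    simp only [this, Finset.sum_ite_eq, Finset.mem_univ, if_true]
    rw [← Finset.mul_prod_erase Finset.univ _ (Finset.mem_univ (σ.symm i))]
    ring
  have hint : ∀ (n : ℤ) (i : ι) (f : K), d i ((n : K) * f) = (n : K) * d i f := by
    intro n i f
    rw [← zsmul_eq_mul, map_zsmul, zsmul_eq_mul]
  unfold fieldAlternant
  simp only [Matrix.det_apply, Matrix.of_apply, sqSum, map_sum, Units.smul_def, map_zsmul, hprod, hint]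
  rw [Finset.sum_comm, Finset.mul_sum]
  refine Finset.sum_congr rfl fun σ _ => ?_
  rw [← Finset.smul_sum, mul_smul_comm, ← Finset.sum_equiv σ (s := Finset.univ) (t := Finset.univ)
    (f := fun j => (l j : K) * ((l j : K) * ∏ x, u (σ x) ^ l x)) (by simp) (by simp)]
  congr 1
  rw [Finset.sum_mul]
  exact Finset.sum_congr rfl fun j _ => by ring

include hu0 in
-- The Pieri rule: multiplying the monomial of a permutation by `∑ u_i⁻¹` lowers each of its
-- exponents once.
lemma sum_inv_mul_fieldAlternant (l : ι → ℤ) :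
    (∑ i, (u i)⁻¹) * fieldAlternant u l = ∑ p, fieldAlternant u (l - Pi.single p 1) := by
  unfold fieldAlternant
  simp only [Matrix.det_apply, Matrix.of_apply]
  rw [Finset.sum_comm, Finset.mul_sum]
  refine Finset.sum_congr rfl fun σ _ => ?_
  rw [← Finset.smul_sum, mul_smul_comm, Finset.sum_mul]
  congr 1
  rw [← Equiv.sum_comp σ]
  refine Finset.sum_congr rfl fun p _ => ?_
  simp only [Pi.sub_apply]
  rw [← Finset.mul_prod_erase Finset.univ (fun i => u (σ i) ^ l i) (Finset.mem_univ p),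
    ← Finset.mul_prod_erase Finset.univ (fun i => u (σ i) ^ (l i - (Pi.single p 1 : ι → ℤ) i))
      (Finset.mem_univ p), ← mul_assoc]
  congr 1
  · simp [zpow_sub₀ (hu0 (σ p)), div_eq_inv_mul]
  · refine Finset.prod_congr rfl fun j hj => ?_
    simp [Pi.single_eq_of_ne (Finset.ne_of_mem_erase hj)]

include hu hu0 hdu hcomm in
/-- Powers of the Lax operator on an alternant, contracted with `(u_i⁻¹)_i`. -/
theorem invContract_iterate_laxOp [CharZero K] (l : ι → ℤ) (k : ℕ) :
    invContract u ((laxOp d u)^[k] fun _ => fieldAlternant u l) =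
      ∑ p, (l p : K) ^ k * fieldAlternant u (l - Pi.single p 1) := by
  -- Every iterate is an eigenvector of the Hamiltonian: on a constant vector the exchange terms
  -- vanish and the scalar eigenvalue remains, and commutation with the Lax operator propagates it.
  have hH : ∀ k, calogeroOp d u ((laxOp d u)^[k] fun _ => fieldAlternant u l) =
      fun i => (∑ j, (l j : K) ^ 2) * ((laxOp d u)^[k] fun _ => fieldAlternant u l) i := by
    intro k
    induction k with
    | zero =>
      funext i
      simp [calogeroOp, sqSum_fieldAlternant hu0 hdu]
    | succ k ih =>
      rw [Function.iterate_succ_apply', calogeroOp_laxOp hu hdu hcomm, ih]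
      have hint : ∀ (i : ι) (f : K), d i ((∑ j, (l j : K) ^ 2) * f) = (∑ j, (l j : K) ^ 2) * d i f := by
        intro i f
        have : (∑ j, (l j : K) ^ 2) = ((∑ j, (l j) ^ 2 : ℤ) : K) := by push_cast; rfl
        rw [this, ← zsmul_eq_mul, map_zsmul, zsmul_eq_mul]
      funext i
      simp only [laxOp, hint, mul_sub, Finset.mul_sum]
      congr 1
      exact Finset.sum_congr rfl fun j _ => by ring
  induction k with
  | zero =>
    simp only [Function.iterate_zero, id, pow_zero, one_mul, invContract]
    rw [← Finset.sum_mul, sum_inv_mul_fieldAlternant hu0]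
  | succ k ih =>
    have h2 := two_invContract_laxOp hu hu0 hdu ((laxOp d u)^[k] fun _ => fieldAlternant u l)
    rw [← Function.iterate_succ_apply' (laxOp d u), hH, ih] at h2
    have h3 : invContract u (fun i => (∑ j, (l j : K) ^ 2) *
        ((laxOp d u)^[k] fun _ => fieldAlternant u l) i) =
        (∑ j, (l j : K) ^ 2) * invContract u ((laxOp d u)^[k] fun _ => fieldAlternant u l) := by
      simp only [invContract, Finset.mul_sum]
      exact Finset.sum_congr rfl fun j _ => by ring
    -- Lowering `l_p` by one changes the eigenvalue by `-2 l_p + 1`; together with the last term of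
    -- `two_invContract_laxOp` this leaves exactly `2 l_p`, the new factor in the induction.
    have h4 : sqSum d (∑ p, (l p : K) ^ k * fieldAlternant u (l - Pi.single p 1)) =
        ∑ p, (l p : K) ^ k * ((∑ j, (l j : K) ^ 2 - 2 * l p + 1) *
          fieldAlternant u (l - Pi.single p 1)) := by
      have e : ∀ p : ι, ∑ j, (((l - Pi.single p 1 : ι → ℤ) j : ℤ) : K) ^ 2 =
          ∑ j, (l j : K) ^ 2 - 2 * l p + 1 := by
        intro p
        rw [← Finset.add_sum_erase Finset.univ _ (Finset.mem_univ p),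
          ← Finset.add_sum_erase Finset.univ (fun j => (l j : K) ^ 2) (Finset.mem_univ p)]
        rw [Finset.sum_congr rfl (g := fun j => (l j : K) ^ 2) fun j hj => by
          simp [Pi.single_eq_of_ne (Finset.ne_of_mem_erase hj)]]
        simp
        ring
      have hsum : ∀ F : ι → K, sqSum d (∑ j, F j) = ∑ j, sqSum d (F j) := by
        intro F
        simp only [sqSum, map_sum]
        exact Finset.sum_comm
      have hc : ∀ (n : ℤ) (f : K), sqSum d ((n : K) ^ k * f) = (n : K) ^ k * sqSum d f := by
        intro n f
        have : (n : K) ^ k = ((n ^ k : ℤ) : K) := by push_cast; rfl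
        simp only [sqSum, this, ← zsmul_eq_mul, map_zsmul, Finset.smul_sum]
      rw [hsum]
      refine Finset.sum_congr rfl fun p _ => ?_
      rw [hc, sqSum_fieldAlternant hu0 hdu, e]
    rw [h3, ih, h4, Finset.mul_sum, ← Finset.sum_sub_distrib, ← Finset.sum_add_distrib] at h2
    have h5 : (2 : K) ≠ 0 := two_ne_zero
    apply mul_left_cancel₀ h5
    rw [h2, Finset.mul_sum]
    exact Finset.sum_congr rfl fun p _ => by ring

end LaxPair

/-! ### Extension of derivations to the fraction field through dual numbers. -/

section FractionDerivation

variable {P : Type*} [CommRing P] (F : Type*) [Field F] [Algebra P F]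

/-- The homomorphism `f ↦ f + D f ε` into the dual numbers over the fraction field. -/
noncomputable def dualHom (D : Derivation ℤ P P) : P →+* DualNumber F where
  toFun f := TrivSqZeroExt.inl (algebraMap P F f) + TrivSqZeroExt.inr (algebraMap P F (D f))
  map_one' := by ext <;> simp
  map_mul' f g := by
    ext
    · simp
    · simp
      rw [Algebra.smul_def, Algebra.smul_def]
      ring
  map_zero' := by ext <;> simp
  map_add' f g := by ext <;> simp [← Algebra.algebraMap_eq_smul_one]

variable [IsFractionRing P F]

lemma isUnit_dualHom (D : Derivation ℤ P P) (y : nonZeroDivisors P) : IsUnit (dualHom F D y) := by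
  rw [TrivSqZeroExt.isUnit_iff_isUnit_fst]
  simpa [dualHom] using IsLocalization.map_units F y

/-- The extension of `dualHom` to the fraction field. -/
noncomputable def dualLift (D : Derivation ℤ P P) : F →+* DualNumber F :=
  IsLocalization.lift (M := nonZeroDivisors P) (isUnit_dualHom F D)

lemma fst_dualLift (D : Derivation ℤ P P) (x : F) : (dualLift F D x).fst = x := by
  have : (TrivSqZeroExt.fstHom ℤ F F).toRingHom.comp (dualLift F D) = RingHom.id _ := by
    apply IsLocalization.ringHom_ext (nonZeroDivisors P)
    ext x
    simp [dualLift, dualHom]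
  exact congrArg (fun f : F →+* F => f x) this

/-- The extension of a derivation to the fraction field. -/
noncomputable def fracDeriv (D : Derivation ℤ P P) : Derivation ℤ F F :=
  Derivation.mk' (((TrivSqZeroExt.sndHom F F).toAddMonoidHom.comp
    (dualLift F D).toAddMonoidHom).toIntLinearMap) (by
      intro a b
      simp [fst_dualLift, TrivSqZeroExt.snd_mul, mul_comm])

lemma fracDeriv_algebraMap (D : Derivation ℤ P P) (f : P) :
    fracDeriv F D (algebraMap P F f) = algebraMap P F (D f) := by
  simp [fracDeriv, dualLift, dualHom, ← Algebra.algebraMap_eq_smul_one]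

variable {F} in
lemma derivation_fractionRing_ext [IsDomain P] {D D' : Derivation ℤ F F}
    (h : ∀ f : P, D (algebraMap P F f) = D' (algebraMap P F f)) : D = D' := by
  ext x
  obtain ⟨a, b, _, rfl⟩ := IsFractionRing.div_surjective (A := P) x
  rw [Derivation.leibniz_div, Derivation.leibniz_div, h, h]

/-- The commutator of the extensions is again a derivation, and a derivation of the fraction field
is determined on `P` by the quotient rule. -/
lemma fracDeriv_comm [IsDomain P] (D D' : Derivation ℤ P P) (h : ∀ f, D (D' f) = D' (D f))
    (x : F) : fracDeriv F D (fracDeriv F D' x) = fracDeriv F D' (fracDeriv F D x) := by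
  have : ⁅fracDeriv F D, fracDeriv F D'⁆ = 0 := by
    apply derivation_fractionRing_ext (P := P)
    intro f
    simp [Derivation.commutator_apply, fracDeriv_algebraMap, h]
  have h2 := congrArg (fun E : Derivation ℤ F F => E x) this
  simpa [Derivation.commutator_apply, sub_eq_zero] using h2

end FractionDerivation

/-- A derivation, regarded as a derivation over the integers. -/
def Derivation.toInt {R A : Type*} [CommRing R] [CommRing A] [Algebra R A] (D : Derivation R A A) :
    Derivation ℤ A A := D.restrictScalars ℤ

lemma Derivation.toInt_apply {R A : Type*} [CommRing R] [CommRing A] [Algebra R A]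
    (D : Derivation R A A) (a : A) : D.toInt a = D a := rfl

/-- Power series in countably many variables: Taylor expansions at `(1, 1, …)` in the variables
`X i = u_i - 1`. -/
abbrev PSeries : Type := MvPowerSeries ℕ ℂ

instance : IsDomain PSeries := NoZeroDivisors.to_isDomain _

/-! ### Power series at `(1, 1, …)`: Euler derivations, exchanges, divided differences. -/

namespace PSeries

open MvPowerSeries

/-- The coordinate function `u_i = 1 + X i`. -/
noncomputable def uvar (i : ℕ) : PSeries := 1 + X i

lemma isUnit_uvar (i : ℕ) : IsUnit (uvar i) := by
  rw [MvPowerSeries.isUnit_iff_constantCoeff]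
  simp [uvar]

/-- The coordinate function `u_i` as a unit. -/
noncomputable def uunit (i : ℕ) : PSeriesˣ := (isUnit_uvar i).unit

@[simp] lemma coe_uunit (i : ℕ) : (uunit i : PSeries) = uvar i := rfl

/-- The derivation `u_i ∂_i`. -/
noncomputable def eulerD (i : ℕ) : Derivation ℂ PSeries PSeries := uvar i • pderiv ℂ i

lemma eulerD_apply (i : ℕ) (f : PSeries) : eulerD i f = uvar i * pderiv ℂ i f := rfl

lemma eulerD_uvar (i j : ℕ) : eulerD i (uvar j) = if i = j then uvar i else 0 := by
  classical
  rw [eulerD_apply]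
  simp only [uvar, map_add, Derivation.map_one_eq_zero, zero_add, pderiv_X]
  by_cases h : i = j
  · subst h; simp
  · simp [h, Ne.symm h]

lemma pderiv_comm (i j : ℕ) (f : PSeries) :
    pderiv ℂ i (pderiv ℂ j f) = pderiv ℂ j (pderiv ℂ i f) := by
  ext α
  simp only [coeff_pderiv]
  rcases eq_or_ne i j with rfl | h
  · rfl
  · rw [add_right_comm]
    simp [h, h.symm]
    ring

lemma eulerD_comm (i j : ℕ) (f : PSeries) : eulerD i (eulerD j f) = eulerD j (eulerD i f) := by
  rcases eq_or_ne i j with rfl | h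
  · rfl
  · have h1 : pderiv ℂ i (uvar j) = 0 := by
      simp [uvar, h.symm]
    have h2 : pderiv ℂ j (uvar i) = 0 := by
      simp [uvar, h]
    simp only [eulerD_apply, Derivation.leibniz, h1, h2, pderiv_comm i j f, smul_eq_mul]
    ring

lemma uvar_sub (i j : ℕ) : uvar i - uvar j = X i - X j := by
  simp [uvar]

lemma X_injective : Function.Injective (X : ℕ → PSeries) := by
  intro i j h
  by_contra hne
  have := congrArg (coeff (Finsupp.single i 1)) h
  rw [coeff_index_single_self_X, coeff_index_single_X] at this
  simp [hne] at this

lemma X_sub_ne_zero {i j : ℕ} (h : i ≠ j) : (X i - X j : PSeries) ≠ 0 :=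
  sub_ne_zero.2 (X_injective.ne h)

lemma uvar_injective : Function.Injective uvar := by
  intro i j h
  exact X_injective (add_left_cancel h)

/-- The exchange of two variables. -/
noncomputable def swapV (i j : ℕ) : PSeries →ₐ[ℂ] PSeries := rename (Equiv.swap i j)

/-- The exchange of two variables on exponents. -/
def swapE (i j : ℕ) (α : ℕ →₀ ℕ) : ℕ →₀ ℕ := α.equivMapDomain (Equiv.swap i j)

lemma swapE_apply (i j : ℕ) (α : ℕ →₀ ℕ) (k : ℕ) : swapE i j α k = α (Equiv.swap i j k) := by
  simp [swapE, Finsupp.equivMapDomain_apply]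

lemma swapE_swapE (i j : ℕ) (α : ℕ →₀ ℕ) : swapE i j (swapE i j α) = α := by
  ext k; simp [swapE_apply]

lemma coeff_swapV (i j : ℕ) (α : ℕ →₀ ℕ) (f : PSeries) :
    coeff α (swapV i j f) = coeff (swapE i j α) f := by
  have h := coeff_embDomain_rename (R := ℂ) (Equiv.swap i j).toEmbedding f (swapE i j α)
  rw [← h]
  congr 1
  have : (swapE i j α).embDomain (Equiv.swap i j).toEmbedding = α := by
    conv_rhs => rw [← swapE_swapE i j α]
    conv_rhs => rw [swapE]
    rw [Finsupp.embDomain_eq_mapDomain, Finsupp.equivMapDomain_eq_mapDomain]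
    rfl
  rw [this]

@[simp] lemma swapV_X (i j k : ℕ) : swapV i j (X k) = X (Equiv.swap i j k) := by
  simp [swapV]

@[simp] lemma swapV_uvar (i j k : ℕ) : swapV i j (uvar k) = uvar (Equiv.swap i j k) := by
  simp [uvar]

@[simp] lemma swapV_swapV (i j : ℕ) (f : PSeries) : swapV i j (swapV i j f) = f := by
  ext α; simp [coeff_swapV, swapE_swapE]

@[simp] lemma swapV_self (i : ℕ) (f : PSeries) : swapV i i f = f := by
  ext α
  rw [coeff_swapV]
  congr 2
  ext k; simp [swapE_apply]

lemma swapV_conj (a b i j : ℕ) (f : PSeries) :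
    swapV a b (swapV i j f) =
      swapV (Equiv.swap a b i) (Equiv.swap a b j) (swapV a b f) := by
  ext α
  simp only [coeff_swapV]
  congr 2
  ext k
  simp only [swapE_apply]
  congr 1
  have := Equiv.swap_apply_apply (Equiv.swap a b) i j
  rw [this]
  simp

lemma swapV_pderiv (i j k : ℕ) (f : PSeries) :
    swapV i j (pderiv ℂ k f) = pderiv ℂ (Equiv.swap i j k) (swapV i j f) := by
  ext α
  simp only [coeff_swapV, coeff_pderiv]
  rw [swapE_apply]
  congr 3
  ext m
  simp only [swapE_apply, Finsupp.add_apply, Finsupp.single_apply]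
  congr 2
  rw [eq_iff_iff, ← (Equiv.swap i j).injective.eq_iff]

lemma swapV_eulerD (i j k : ℕ) (f : PSeries) :
    swapV i j (eulerD k f) = eulerD (Equiv.swap i j k) (swapV i j f) := by
  simp [eulerD_apply, swapV_pderiv]

lemma coeff_X_mul' (i : ℕ) (f : PSeries) (α : ℕ →₀ ℕ) :
    coeff α (X i * f) = if α i = 0 then 0 else coeff (α - Finsupp.single i 1) f := by
  classical
  rw [X, coeff_monomial_mul]
  simp only [Finsupp.single_le_iff, one_mul]
  by_cases h : α i = 0
  · simp [h]
  · rw [if_pos (Nat.one_le_iff_ne_zero.2 h), if_neg h]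

/-- The coefficients of the divided difference `(g - s_{0j} g) / (X 0 - X j)`. -/
noncomputable def divDiff (j : ℕ) (g : PSeries) : PSeries := fun α =>
  ∑ t ∈ Finset.range (α j + 1),
    coeff (α - Finsupp.single j t + Finsupp.single 0 (t + 1)) (g - swapV 0 j g)

lemma coeff_divDiff (j : ℕ) (g : PSeries) (α : ℕ →₀ ℕ) : coeff α (divDiff j g) =
    ∑ t ∈ Finset.range (α j + 1),
      coeff (α - Finsupp.single j t + Finsupp.single 0 (t + 1)) (g - swapV 0 j g) := rfl

/-- The coefficients of `divDiff` come from expanding `1 / (X 0 - X j)` in powers of `X j / X 0`, so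
the product telescopes. That no negative power of `X 0` is left over is the antisymmetry of `g -
s_{0j} g`. -/
lemma divDiff_spec {j : ℕ} (hj : j ≠ 0) (g : PSeries) :
    (X 0 - X j) * divDiff j g = g - swapV 0 j g := by
  set k := g - swapV 0 j g with hk
  have hanti : ∀ α, coeff (swapE 0 j α) k = - coeff α k := by
    intro α
    rw [← coeff_swapV, hk, map_sub, swapV_swapV, ← neg_sub, map_neg]
  ext α
  set F : ℕ → ℂ := fun t => coeff (α - Finsupp.single j t + Finsupp.single 0 t) k with hF
  have h1 : (if α 0 = 0 then 0 else coeff (α - Finsupp.single 0 1) (divDiff j g)) =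
      ∑ t ∈ Finset.range (α j + 1), F t := by
    -- For `α 0 = 0` the reflection `t ↦ α j - t` is the exchange of the two variables on exponents,
    -- so the sum equals its own negative.
    split_ifs with h0
    · have hr := Finset.sum_range_reflect F (α j + 1)
      have hs : ∑ t ∈ Finset.range (α j + 1), F (α j + 1 - 1 - t) =
          - ∑ t ∈ Finset.range (α j + 1), F t := by
        rw [← Finset.sum_neg_distrib]
        refine Finset.sum_congr rfl fun t ht => ?_
        have ht' : t ≤ α j := Nat.lt_succ_iff.1 (Finset.mem_range.1 ht)
        rw [hF]
        simp only
        rw [← hanti]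
        congr 2
        ext m
        simp only [swapE_apply, Finsupp.add_apply, Finsupp.tsub_apply, Finsupp.single_apply]
        rcases eq_or_ne m 0 with rfl | hm
        · simp [hj, hj.symm, h0]
        · rcases eq_or_ne m j with rfl | hmj
          · simp [hj, hj.symm, h0]; omega
          · simp [Equiv.swap_apply_of_ne_of_ne hm hmj, hm.symm, hmj.symm]
      rw [hs] at hr
      linear_combination (1 / 2 : ℂ) * hr
    · rw [coeff_divDiff, ← hk]
      refine Finset.sum_congr (by simp [hj.symm]) fun t _ => ?_
      congr 2
      ext m
      simp only [Finsupp.add_apply, Finsupp.tsub_apply, Finsupp.single_apply]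
      rcases eq_or_ne m 0 with rfl | hm
      · simp [hj]; omega
      · simp [hm.symm]
  have h2 : (if α j = 0 then 0 else coeff (α - Finsupp.single j 1) (divDiff j g)) =
      ∑ t ∈ Finset.range (α j), F (t + 1) := by
    split_ifs with h0
    · simp [h0]
    · rw [coeff_divDiff, ← hk]
      refine Finset.sum_congr (congrArg _ (by simp; omega)) fun t _ => ?_
      rw [hF]
      congr 2
      ext m
      simp only [Finsupp.add_apply, Finsupp.tsub_apply, Finsupp.single_apply]
      split_ifs <;> omega
  rw [sub_mul, map_sub, coeff_X_mul', coeff_X_mul', h1, h2, Finset.sum_range_succ']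
  simp [hF]

end PSeries

/-- The logarithmic derivative of the Vandermonde product is a row sum of the Lax kernel;
conjugation by the product therefore replaces `-g_j` in the Lax operator by the differences `g_i -
g_j`. -/
lemma deriv_vandermonde {K : Type*} [Field K] {N : ℕ} {d : Fin N → Derivation ℤ K K}
    {u : Fin N → K} (hu : Function.Injective u)
    (hdu : ∀ i j, d i (u j) = if i = j then u i else 0) (i : Fin N) :
    d i (∏ a, ∏ b ∈ Finset.Ioi a, (u a - u b)) =
      (∑ j, laxKernel u i j) * ∏ a, ∏ b ∈ Finset.Ioi a, (u a - u b) := by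
  have hne : ∀ a, ∀ b ∈ Finset.Ioi a, u a - u b ≠ 0 := fun a b hb =>
    sub_ne_zero.2 (hu.ne (Finset.mem_Ioi.1 hb).ne)
  rw [Derivation.map_prod_field _ _ _ fun a _ => Finset.prod_ne_zero_iff.2 (hne a), mul_comm]
  congr 1
  have h1 : ∀ a, d i (∏ b ∈ Finset.Ioi a, (u a - u b)) / (∏ b ∈ Finset.Ioi a, (u a - u b)) =
      ∑ b ∈ Finset.Ioi a, ((if i = a then laxKernel u i b else 0) +
        if i = b then laxKernel u i a else 0) := by
    intro a
    rw [Derivation.map_prod_field _ _ _ (hne a),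
      mul_div_cancel_left₀ _ (Finset.prod_ne_zero_iff.2 (hne a))]
    refine Finset.sum_congr rfl fun b hb => ?_
    have hab : a ≠ b := (Finset.mem_Ioi.1 hb).ne
    rw [map_sub, hdu, hdu]
    by_cases ha : i = a
    · subst ha
      simp [hab, laxKernel]
    · by_cases hb : i = b
      · subst hb
        simp only [ha, if_false, if_true, zero_sub, zero_add, laxKernel]
        rw [← neg_sub (u i) (u a), neg_div_neg_eq]
      · simp [ha, hb]
  simp only [h1, Finset.sum_add_distrib]
  have h2 : ∑ a, ∑ b ∈ Finset.Ioi a, (if i = a then laxKernel u i b else 0) =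
      ∑ b ∈ Finset.Ioi i, laxKernel u i b := by
    rw [Finset.sum_eq_single i]
    · simp
    · intro a _ ha; simp [ha.symm]
    · simp
  have h3 : ∑ a, ∑ b ∈ Finset.Ioi a, (if i = b then laxKernel u i a else 0) =
      ∑ a ∈ Finset.Iio i, laxKernel u i a := by
    simp only [Finset.sum_ite_eq, Finset.mem_Ioi]
    rw [← Finset.sum_filter]
    congr 1
    ext a; simp
  rw [h2, h3, add_comm, ← Finset.sum_union]
  · rw [← Finset.sum_erase Finset.univ (laxKernel_self u i)]
    congr 1
    ext a; simp
  · rw [Finset.disjoint_left]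
    intro a ha hb
    simp at ha hb
    exact absurd ha hb.not_gt

set_option linter.unusedSectionVars false

/-! ### The Lax operator as a single operator on power series. -/

namespace PSeries

open MvPowerSeries

lemma divDiff_add (j : ℕ) (f g : PSeries) : divDiff j (f + g) = divDiff j f + divDiff j g := by
  ext α
  rw [map_add, coeff_divDiff, coeff_divDiff, coeff_divDiff, ← Finset.sum_add_distrib]
  refine Finset.sum_congr rfl fun t _ => ?_
  simp only [map_add, map_sub]
  ring

lemma divDiff_smul (j : ℕ) (c : ℂ) (f : PSeries) : divDiff j (c • f) = c • divDiff j f := by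
  ext α
  rw [map_smul, coeff_divDiff, coeff_divDiff, Finset.smul_sum]
  refine Finset.sum_congr rfl fun t _ => ?_
  simp only [map_sub, map_smul, smul_sub]

/-- `g` is symmetric in the variables with numbers `1, …, N - 1`. -/
def IsSymRest (N : ℕ) (g : PSeries) : Prop :=
  ∀ i j, 1 ≤ i → i < N → 1 ≤ j → j < N → swapV i j g = g

/-- `g` is symmetric in the variables with numbers `0, …, N - 1`. -/
def IsSym (N : ℕ) (g : PSeries) : Prop := ∀ i j, i < N → j < N → swapV i j g = g

lemma IsSym.isSymRest {N : ℕ} {g : PSeries} (h : IsSym N g) : IsSymRest N g :=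
  fun i j _ hi _ hj => h i j hi hj

/-- The operator `u_0 ∂_0 + ∑_{1 ≤ j < N} u_0 / (u_0 - u_j) (1 - s_{0j})`. -/
noncomputable def lowOp (N : ℕ) : PSeries →ₗ[ℂ] PSeries where
  toFun g := eulerD 0 g + uvar 0 * ∑ j ∈ Finset.Ico 1 N, divDiff j g
  map_add' f g := by
    simp only [map_add, divDiff_add, Finset.sum_add_distrib]; ring
  map_smul' c f := by
    simp only [Derivation.map_smul, divDiff_smul, ← Finset.smul_sum, RingHom.id_apply, smul_add,
      mul_smul_comm]

lemma lowOp_apply (N : ℕ) (g : PSeries) :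
    lowOp N g = eulerD 0 g + uvar 0 * ∑ j ∈ Finset.Ico 1 N, divDiff j g := rfl

lemma swapV_divDiff {a b j : ℕ} (ha : 1 ≤ a) (hb : 1 ≤ b) (hj : 1 ≤ j) (g : PSeries) :
    swapV a b (divDiff j g) = divDiff (Equiv.swap a b j) (swapV a b g) := by
  have h0 : Equiv.swap a b 0 = 0 := Equiv.swap_apply_of_ne_of_ne (by omega) (by omega)
  have hj' : Equiv.swap a b j ≠ 0 := by
    rw [Equiv.swap_apply_def]; split_ifs <;> omega
  apply mul_left_cancel₀ (X_sub_ne_zero hj'.symm)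
  rw [divDiff_spec hj']
  have := congrArg (swapV a b) (divDiff_spec (show j ≠ 0 by omega) g)
  simpa [swapV_conj a b 0 j, h0] using this

lemma IsSymRest.lowOp {N : ℕ} {g : PSeries} (hg : IsSymRest N g) : IsSymRest N (lowOp N g) := by
  intro a b ha haN hb hbN
  have h0 : Equiv.swap a b 0 = 0 := Equiv.swap_apply_of_ne_of_ne (by omega) (by omega)
  rw [lowOp_apply, map_add, map_mul, swapV_eulerD, h0, swapV_uvar, h0, hg a b ha haN hb hbN, map_sum]
  congr 2
  rw [Finset.sum_congr rfl (g := fun j => divDiff (Equiv.swap a b j) g) fun j hj => by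
    rw [swapV_divDiff ha hb (Finset.mem_Ico.1 hj).1, hg a b ha haN hb hbN]]
  refine Equiv.Perm.sum_comp (Equiv.swap a b) (Finset.Ico 1 N) (fun j => divDiff j g) ?_
  intro j hj
  have := Equiv.swap_apply_ne_self_iff.1 hj
  simp only [Finset.coe_Ico, Set.mem_Ico]
  rcases this.2 with rfl | rfl <;> omega

lemma IsSymRest.iterate_lowOp {N : ℕ} {g : PSeries} (hg : IsSymRest N g) (k : ℕ) :
    IsSymRest N ((PSeries.lowOp N)^[k] g) := by
  induction k with
  | zero => exact hg
  | succ k ih => rw [Function.iterate_succ_apply']; exact ih.lowOp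

/-- For series symmetric in the variables other than `0`, a permutation acts only through the image
of `0`. -/
lemma IsSymRest.swapV_swapV {N : ℕ} {g : PSeries} (hg : IsSymRest N g) {i j : ℕ} (hi : i < N)
    (hj : j < N) (hj0 : 1 ≤ j) : swapV 0 i (swapV 0 j g) = swapV 0 (Equiv.swap 0 i j) g := by
  rcases eq_or_ne i 0 with rfl | hi0
  · simp
  rcases eq_or_ne j i with rfl | hji
  · simp
  have h1 : Equiv.swap 0 i j = j := Equiv.swap_apply_of_ne_of_ne (by omega) hji
  have h2 : Equiv.swap 0 j 0 = j := Equiv.swap_apply_left _ _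
  have h3 : Equiv.swap 0 j i = i := Equiv.swap_apply_of_ne_of_ne hi0 hji.symm
  rw [h1]
  conv_rhs => rw [← hg j i hj0 hj (by omega) hi]
  rw [swapV_conj 0 j j i, h3, Equiv.swap_apply_right]

/-- The alternant `det (u_i ^ l_j)` in the ring of power series. -/
noncomputable def alternant {N : ℕ} (l : Fin N → ℤ) : PSeries :=
  (Matrix.of fun i j : Fin N => ((uunit i ^ l j : PSeriesˣ) : PSeries)).det

/-- The Vandermonde product `∏_{i < j} (u_i - u_j)`. -/
noncomputable def vdm (N : ℕ) : PSeries := ∏ i : Fin N, ∏ j ∈ Finset.Ioi i, (X (i : ℕ) - X (j : ℕ))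

lemma vdm_ne_zero (N : ℕ) : vdm N ≠ 0 :=
  Finset.prod_ne_zero_iff.2 fun _ _ => Finset.prod_ne_zero_iff.2 fun _ hj =>
    X_sub_ne_zero (Fin.val_injective.ne (Finset.mem_Ioi.1 hj).ne)

section Field

variable (F : Type*) [Field F] [Algebra PSeries F] [IsFractionRing PSeries F]

lemma algebraMap_alternant {N : ℕ} (l : Fin N → ℤ) :
    algebraMap PSeries F (alternant l) =
      fieldAlternant (fun i : Fin N => algebraMap PSeries F (uvar i)) l := by
  rw [alternant, fieldAlternant, RingHom.map_det]
  congr 1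
  ext i j
  simp only [RingHom.mapMatrix_apply, Matrix.map_apply, Matrix.of_apply]
  have := map_zpow (Units.map (algebraMap PSeries F).toMonoidHom) (uunit i) (l j)
  have h2 := congrArg Units.val this
  rw [Units.val_zpow_eq_zpow_val] at h2
  exact h2

/-- The vectors `(V s_{0i} y)_i`, with `V` the Vandermonde product, are stable under the Lax
operator, so a vector is encoded by its entry `y` at index `0`. The derivative of `V` supplies the
diagonal part of the divided differences. -/
lemma algebraMap_lowOp {N : ℕ} {y : PSeries} (hy : IsSymRest N y) (i : Fin N) :
    algebraMap PSeries F (vdm N * swapV 0 i (lowOp N y)) =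
      laxOp (fun i : Fin N => fracDeriv F (eulerD i).toInt)
        (fun i : Fin N => algebraMap PSeries F (uvar i))
        (fun i => algebraMap PSeries F (vdm N * swapV 0 i y)) i := by
  set u : Fin N → F := fun i => algebraMap PSeries F (uvar i) with hu_def
  have hinj : Function.Injective (algebraMap PSeries F) := IsFractionRing.injective _ _
  have hu : Function.Injective u := fun a b h => Fin.val_injective (uvar_injective (hinj h))
  have hdu : ∀ i j : Fin N, fracDeriv F (eulerD i).toInt (u j) =
      if i = j then u i else 0 := by
    intro i j
    rw [hu_def, fracDeriv_algebraMap]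
    simp only [Derivation.toInt_apply, eulerD_uvar, Fin.val_inj]
    split_ifs <;> simp
  have hV : algebraMap PSeries F (vdm N) = ∏ a, ∏ b ∈ Finset.Ioi a, (u a - u b) := by
    simp [vdm, hu_def, ← map_sub, uvar_sub]
  have hN : 0 < N := Fin.pos i
  set R : ℕ → F := fun j => algebraMap PSeries F (uvar i) /
    (algebraMap PSeries F (uvar i) - algebraMap PSeries F (uvar j)) *
    (algebraMap PSeries F (swapV 0 i y) - algebraMap PSeries F (swapV 0 j y)) with hR
  have hsum : algebraMap PSeries F (swapV 0 i (uvar 0 * ∑ j ∈ Finset.Ico 1 N, divDiff j y)) =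
      ∑ j : Fin N, R j := by
    have h1 : ∀ j ∈ Finset.Ico 1 N, algebraMap PSeries F (swapV 0 i (uvar 0 * divDiff j y)) =
        R (Equiv.swap 0 (i : ℕ) j) := by
      intro j hj
      have hj0 : j ≠ 0 := by have := (Finset.mem_Ico.1 hj).1; omega
      have hjN := (Finset.mem_Ico.1 hj).2
      have hne : (i : ℕ) ≠ Equiv.swap 0 (i : ℕ) j := by
        intro h
        have : Equiv.swap 0 (i : ℕ) 0 = Equiv.swap 0 (i : ℕ) j := by
          rw [Equiv.swap_apply_left]; exact h
        exact hj0 ((Equiv.swap 0 (i : ℕ)).injective this).symm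
      have h2 := congrArg (swapV 0 i) (divDiff_spec hj0 y)
      rw [map_mul, map_sub, map_sub, swapV_X, swapV_X, Equiv.swap_apply_left,
        hy.swapV_swapV i.2 hjN (by omega), ← uvar_sub] at h2
      have h3 := congrArg (algebraMap PSeries F) h2
      simp only [map_mul, map_sub] at h3
      have hne' : algebraMap PSeries F (uvar i) - algebraMap PSeries F (uvar (Equiv.swap 0 (i : ℕ) j)) ≠ 0 :=
        sub_ne_zero.2 (hinj.ne (uvar_injective.ne hne))
      rw [hR]
      simp only
      rw [← h3, map_mul, swapV_uvar, Equiv.swap_apply_left, map_mul]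
      field_simp
    rw [Finset.mul_sum, map_sum, map_sum, Finset.sum_congr rfl h1]
    have h0 : R (Equiv.swap 0 (i : ℕ) 0) = 0 := by simp [hR]
    have h2 : ∑ j ∈ Finset.Ico 1 N, R (Equiv.swap 0 (i : ℕ) j) =
        ∑ j ∈ Finset.range N, R (Equiv.swap 0 (i : ℕ) j) := by
      rw [Finset.range_eq_Ico, Finset.sum_eq_sum_Ico_succ_bot hN, h0, zero_add]
    rw [h2, Equiv.Perm.sum_comp (Equiv.swap 0 (i : ℕ)) (Finset.range N) R, Fin.sum_univ_eq_sum_range]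
    intro j hj
    have := Equiv.swap_apply_ne_self_iff.1 hj
    simp only [Finset.coe_range, Set.mem_Iio]
    rcases this.2 with rfl | rfl
    · exact hN
    · exact i.2
  rw [lowOp_apply, map_add, mul_add, map_add, map_mul (algebraMap PSeries F) (vdm N) (swapV 0 i (uvar 0 * _)),
    hsum]
  simp only [laxOp, map_mul]
  rw [Derivation.leibniz, fracDeriv_algebraMap, hV, deriv_vandermonde hu hdu]
  simp only [swapV_eulerD, Equiv.swap_apply_left, Derivation.toInt_apply, smul_eq_mul]
  have h4 : ∀ j : Fin N, R j = laxKernel u i j * (algebraMap PSeries F (swapV 0 i y)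
    - algebraMap PSeries F (swapV 0 j y)) := fun j => rfl
  simp only [h4, mul_sub, Finset.sum_sub_distrib, ← Finset.sum_mul]
  rw [Finset.mul_sum]
  have h5 : ∀ j, laxKernel u i j * ((∏ a, ∏ b ∈ Finset.Ioi a, (u a - u b)) *
      algebraMap PSeries F (swapV 0 j y)) = (∏ a, ∏ b ∈ Finset.Ioi a, (u a - u b)) *
      (laxKernel u i j * algebraMap PSeries F (swapV 0 j y)) := fun j => by ring
  simp only [h5]
  ring

end Field

/-- The operator `f ↦ ∑_i u_i⁻¹ s_{0i} A^k f`, where `A = lowOp N`. -/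
noncomputable def shiftOp (N k : ℕ) : PSeries →ₗ[ℂ] PSeries :=
  ∑ i ∈ Finset.range N, (swapV 0 i).toLinearMap ∘ₗ
    LinearMap.mulLeft ℂ ((uunit 0)⁻¹ : PSeriesˣ).1 ∘ₗ (lowOp N ^ k)

lemma shiftOp_apply (N k : ℕ) (f : PSeries) : shiftOp N k f =
    ∑ i ∈ Finset.range N, swapV 0 i (((uunit 0)⁻¹ : PSeriesˣ) * (lowOp N)^[k] f) := by
  simp [shiftOp, LinearMap.sum_apply, Module.End.pow_apply]

/-- The operator `shiftOp` acts on Schur functions by lowering the signature. -/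
theorem shiftOp_schur {N : ℕ} (l : Fin N → ℤ) {s : PSeries} {t : Fin N → PSeries}
    (hsym : IsSymRest N s) (hsym0 : ∀ i < N, swapV 0 i s = s)
    (hs : vdm N * s = alternant l)
    (ht : ∀ p, vdm N * t p = alternant (l - Pi.single p 1)) (k : ℕ) :
    shiftOp N k s = ∑ p, (l p : ℂ) ^ k • t p := by
  set F := FractionRing PSeries
  have hinj : Function.Injective (algebraMap PSeries F) := IsFractionRing.injective _ _
  set u : Fin N → F := fun i => algebraMap PSeries F (uvar i) with hu_def
  have hu : Function.Injective u := fun a b h => Fin.val_injective (uvar_injective (hinj h))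
  have hu0 : ∀ i, u i ≠ 0 := fun i => ((isUnit_uvar i).map (algebraMap PSeries F)).ne_zero
  have hchar0 : CharZero PSeries := charZero_of_injective_algebraMap (R := ℂ)
    (FaithfulSMul.algebraMap_injective ℂ PSeries)
  have hchar : CharZero F := charZero_of_injective_algebraMap hinj
  have hdu : ∀ i j : Fin N, fracDeriv F (eulerD i).toInt (u j) = if i = j then u i else 0 := by
    intro i j
    rw [hu_def, fracDeriv_algebraMap]
    simp only [Derivation.toInt_apply, eulerD_uvar, Fin.val_inj]
    split_ifs <;> simp
  have hcomm : ∀ (i j : Fin N) (f : F), fracDeriv F (eulerD i).toInt (fracDeriv F (eulerD j).toInt f)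
      = fracDeriv F (eulerD j).toInt (fracDeriv F (eulerD i).toInt f) := fun i j f =>
    fracDeriv_comm F _ _ (fun f => eulerD_comm i j f) f
  -- The constant vector of alternants has the form `(V s_{0i} y)_i` with `y = s`, because `s` is
  -- symmetric; the form persists under iteration.
  have hU : ∀ k, (laxOp (fun i : Fin N => fracDeriv F (eulerD i).toInt) u)^[k]
      (fun _ => fieldAlternant u l) =
      fun i : Fin N => algebraMap PSeries F (vdm N * swapV 0 i ((lowOp N)^[k] s)) := by
    intro k
    induction k with
    | zero =>
      funext i
      simp only [Function.iterate_zero, id, hsym0 i i.2, hs]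
      exact (algebraMap_alternant F l).symm
    | succ k ih =>
      rw [Function.iterate_succ_apply', ih, Function.iterate_succ_apply']
      funext i
      exact (algebraMap_lowOp F (hsym.iterate_lowOp k) i).symm
  have main := invContract_iterate_laxOp hu hu0 hdu hcomm l k
  rw [hU] at main
  apply mul_left_cancel₀ (vdm_ne_zero N)
  apply hinj
  have e1 : algebraMap PSeries F (vdm N * ∑ p, (l p : ℂ) ^ k • t p) =
      ∑ p, (l p : F) ^ k * fieldAlternant u (l - Pi.single p 1) := by
    rw [Finset.mul_sum, map_sum]
    refine Finset.sum_congr rfl fun p _ => ?_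
    rw [mul_smul_comm, ht, ← algebraMap_alternant, Algebra.smul_def, map_mul]
    simp
  rw [e1, ← main, shiftOp_apply, Finset.mul_sum, map_sum, invContract, ← Fin.sum_univ_eq_sum_range
    (fun i => algebraMap PSeries F (vdm N * swapV 0 i (((uunit 0)⁻¹ : PSeriesˣ) * (lowOp N)^[k] s)))]
  refine Finset.sum_congr rfl fun i _ => ?_
  have e2 : algebraMap PSeries F (swapV 0 i (((uunit 0)⁻¹ : PSeriesˣ) : PSeries)) = (u i)⁻¹ := by
    apply eq_inv_of_mul_eq_one_left
    have h := congrArg (swapV 0 i) (Units.inv_mul (uunit 0))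
    rw [map_mul, coe_uunit, swapV_uvar, Equiv.swap_apply_left, map_one] at h
    rw [hu_def]
    simp only
    rw [← map_mul, h, map_one]
  rw [map_mul, map_mul, map_mul, map_mul, e2]
  ring

end PSeries

/-- The Vandermonde product divides every determinant `det (f_j (x_i))` with polynomials `f_j`. -/
theorem vandermonde_dvd_det {A : Type*} [CommRing A] {N : ℕ} (x : Fin N → A)
    (f : Fin N → Polynomial A) :
    (∏ i : Fin N, ∏ j ∈ Finset.Ioi i, (x i - x j)) ∣
      (Matrix.of fun i j : Fin N => (f j).eval (x i)).det := by
  induction N with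
  | zero => simp
  | succ N ih =>
    -- Subtracting the row of `x 0` makes row `i` divisible by `x i - x 0`. With these factors taken
    -- out, expansion along the top row leaves minors of the same kind in the quotient polynomials.
    choose g hg using fun j => Polynomial.X_sub_C_dvd_sub_C_eval (a := x 0) (p := f j)
    have hg' : ∀ i j, (f j).eval (x i) = (f j).eval (x 0) + (x i - x 0) * (g j).eval (x i) := by
      intro i j
      have := congrArg (Polynomial.eval (x i)) (hg j)
      simp at this
      linear_combination this
    have hdet : (Matrix.of fun i j : Fin (N + 1) => (f j).eval (x i)).det =
        (Matrix.of fun i j : Fin (N + 1) => (Fin.cons 1 (fun i => x i.succ - x 0) : Fin (N + 1) → A) i *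
          (Fin.cons (fun j => (f j).eval (x 0)) (fun i j => (g j).eval (x (Fin.succ i))) :
            Fin (N + 1) → Fin (N + 1) → A) i j).det := by
      refine Matrix.det_eq_of_forall_row_eq_smul_add_const (Fin.cons 0 fun _ => 1) 0 (by simp) ?_
      intro i j
      refine Fin.cases ?_ (fun i => ?_) i
      · simp
      · simp [hg' i.succ j]; ring
    rw [hdet.trans (Matrix.det_mul_column (Fin.cons 1 (fun i => x i.succ - x 0))
      (Matrix.of (Fin.cons (fun j => (f j).eval (x 0)) (fun i j => (g j).eval (x (Fin.succ i))) :
        Fin (N + 1) → Fin (N + 1) → A))), Fin.prod_univ_succ, Fin.prod_univ_succ]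
    simp only [Fin.cons_zero, Fin.cons_succ, one_mul]
    apply mul_dvd_mul
    · rw [Fin.Ioi_zero_eq_map, Finset.prod_map]
      simp only [Fin.coe_succEmb]
      rw [show (∏ i : Fin N, (x i.succ - x 0)) = (∏ i : Fin N, (-1 : A)) * ∏ i : Fin N, (x 0 - x i.succ) by
        rw [← Finset.prod_mul_distrib]; exact Finset.prod_congr rfl fun i _ => by ring]
      exact dvd_mul_left _ _
    · rw [Matrix.det_succ_row_zero]
      refine Finset.dvd_sum fun j _ => Dvd.dvd.mul_left ?_ _
      have := ih (fun i => x i.succ) (fun k => g (j.succAbove k))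
      convert this using 1
      · refine Finset.prod_congr rfl fun i _ => ?_
        rw [Fin.Ioi_succ, Finset.prod_map]
        rfl
      · rfl

/-! ### Schur functions as power series; Weyl's dimension formula. -/

namespace PSeries

open MvPowerSeries

lemma swapV_det {N : ℕ} {a b : ℕ} (ha : a < N) (hb : b < N) (hab : a ≠ b) (f : Fin N → ℕ → PSeries)
    (hf : ∀ j i, swapV a b (f j i) = f j (Equiv.swap a b i)) :
    swapV a b (Matrix.of fun i j : Fin N => f j i).det =
      - (Matrix.of fun i j : Fin N => f j i).det := by
  have h := Matrix.det_permute (Equiv.swap (⟨a, ha⟩ : Fin N) ⟨b, hb⟩)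
    (Matrix.of fun i j : Fin N => f j i)
  rw [Equiv.Perm.sign_swap (by simpa using hab)] at h
  rw [AlgHom.map_det]
  simp only [Units.val_neg, Units.val_one, Int.cast_neg, Int.cast_one, neg_mul, one_mul] at h
  rw [← h]
  congr 1
  ext1 i j
  simp only [AlgHom.mapMatrix_apply, Matrix.map_apply, Matrix.of_apply, Matrix.submatrix_apply, hf, id]
  congr 1
  simp only [Equiv.swap_apply_def, Fin.ext_iff]
  split_ifs <;> rfl

lemma vdm_eq_det (N : ℕ) :
    vdm N = (Matrix.of fun i j : Fin N => (X (i : ℕ) : PSeries) ^ (j.rev : ℕ)).det := by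
  have h := Matrix.det_projVandermonde (fun _ : Fin N => (1 : PSeries)) (fun i => X (i : ℕ))
  simp only [one_mul] at h
  rw [vdm, ← h]
  congr 1
  ext1 i j
  simp [Matrix.projVandermonde_apply]

lemma swapV_uunit_zpow (a b i : ℕ) (n : ℤ) : swapV a b ((uunit i ^ n : PSeriesˣ) : PSeries) =
    ((uunit (Equiv.swap a b i) ^ n : PSeriesˣ) : PSeries) := by
  have h1 : Units.map (swapV a b : PSeries →* PSeries) (uunit i) = uunit (Equiv.swap a b i) := by
    ext1
    simp
  have := map_zpow (Units.map (swapV a b : PSeries →* PSeries)) (uunit i) n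
  rw [h1] at this
  rw [← this]
  rfl

lemma swapV_alternant {N : ℕ} {a b : ℕ} (ha : a < N) (hb : b < N) (hab : a ≠ b) (l : Fin N → ℤ) :
    swapV a b (alternant l) = - alternant l :=
  swapV_det ha hb hab (fun j i => ((uunit i ^ l j : PSeriesˣ) : PSeries))
    fun j i => swapV_uunit_zpow a b i (l j)

lemma swapV_vdm {N : ℕ} {a b : ℕ} (ha : a < N) (hb : b < N) (hab : a ≠ b) :
    swapV a b (vdm N) = - vdm N := by
  rw [vdm_eq_det]
  exact swapV_det ha hb hab (fun j i => X i ^ (j.rev : ℕ)) fun j i => by simp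

lemma isSym_of_vdm_mul {N : ℕ} {l : Fin N → ℤ} {s : PSeries} (hs : vdm N * s = alternant l) :
    IsSym N s := by
  intro a b ha hb
  rcases eq_or_ne a b with rfl | hab
  · simp
  apply mul_left_cancel₀ (vdm_ne_zero N)
  have := congrArg (swapV a b) hs
  rw [map_mul, swapV_vdm ha hb hab, swapV_alternant ha hb hab, neg_mul, neg_inj] at this
  rw [this, hs]

lemma exists_vdm_mul_eq {N : ℕ} (l : Fin N → ℤ) : ∃ s, vdm N * s = alternant l := by
  -- A common shift makes all exponents non-negative, so that polynomial divisibility applies; the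
  -- factors `u_i ^ (-M)` then restore the original exponents.
  obtain ⟨M, hM⟩ : ∃ M : ℕ, ∀ j, 0 ≤ l j + M := by
    refine ⟨∑ j, (l j).natAbs, fun j => ?_⟩
    have := Finset.single_le_sum (f := fun j => (l j).natAbs) (fun _ _ => Nat.zero_le _) (Finset.mem_univ j)
    have h2 : (((l j).natAbs : ℕ) : ℤ) ≤ ((∑ j, (l j).natAbs : ℕ) : ℤ) := by exact_mod_cast this
    omega
  obtain ⟨c, hc⟩ := vandermonde_dvd_det (fun i : Fin N => uvar i)
    (fun j : Fin N => Polynomial.X ^ (l j + M).toNat)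
  refine ⟨(∏ i : Fin N, ((uunit i ^ (-(M : ℤ)) : PSeriesˣ) : PSeries)) * c, ?_⟩
  have h1 : (∏ i : Fin N, ∏ j ∈ Finset.Ioi i, (uvar i - uvar j)) = vdm N := by
    simp only [uvar_sub]; rfl
  rw [h1] at hc
  rw [mul_left_comm, ← hc, alternant, ← Matrix.det_mul_column]
  congr 1
  ext1 i j
  simp only [Matrix.of_apply, Polynomial.eval_pow, Polynomial.eval_X]
  rw [← coe_uunit, ← Units.val_pow_eq_pow_val, ← Units.val_mul, ← zpow_natCast, ← zpow_add,
    Int.toNat_of_nonneg (hM j)]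
  congr 2
  ring

/-- The Taylor expansion of the Schur function `det (u_i ^ l_j) / ∏_{i < j} (u_i - u_j)`. -/
noncomputable def schurSeries {N : ℕ} (l : Fin N → ℤ) : PSeries := (exists_vdm_mul_eq l).choose

lemma vdm_mul_schurSeries {N : ℕ} (l : Fin N → ℤ) : vdm N * schurSeries l = alternant l :=
  (exists_vdm_mul_eq l).choose_spec

lemma isSym_schurSeries {N : ℕ} (l : Fin N → ℤ) : IsSym N (schurSeries l) :=
  isSym_of_vdm_mul (vdm_mul_schurSeries l)

lemma shiftOp_schurSeries {N : ℕ} (l : Fin N → ℤ) (k : ℕ) :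
    shiftOp N k (schurSeries l) = ∑ p, (l p : ℂ) ^ k • schurSeries (l - Pi.single p 1) := by
  rcases Nat.eq_zero_or_pos N with rfl | hN
  · simp [shiftOp_apply]
  · exact shiftOp_schur l (isSym_schurSeries l).isSymRest
      (fun i hi => isSym_schurSeries l 0 i hN hi) (vdm_mul_schurSeries l)
      (fun p => vdm_mul_schurSeries _) k

/-- The power `(1 + X) ^ n` of the power series `1 + X`, for an integer `n`. -/
noncomputable def oneAddXUnit : (PowerSeries ℂ)ˣ :=
  (PowerSeries.isUnit_iff_constantCoeff.2 (by simp) : IsUnit (1 + PowerSeries.X : PowerSeries ℂ)).unit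

lemma oneAddXUnit_coe : (oneAddXUnit : PowerSeries ℂ) = 1 + PowerSeries.X := rfl

lemma constantCoeff_oneAddX_zpow (n : ℤ) :
    PowerSeries.constantCoeff ((oneAddXUnit ^ n : (PowerSeries ℂ)ˣ) : PowerSeries ℂ) = 1 := by
  have h1 : Units.map (PowerSeries.constantCoeff (R := ℂ)).toMonoidHom oneAddXUnit = 1 := by
    ext1; simp [oneAddXUnit_coe]
  have := congrArg Units.val
    (map_zpow (Units.map (PowerSeries.constantCoeff (R := ℂ)).toMonoidHom) oneAddXUnit n)
  rw [h1, one_zpow] at this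
  exact this

lemma coeff_one_oneAddX_zpow (n : ℤ) :
    PowerSeries.coeff 1 ((oneAddXUnit ^ n : (PowerSeries ℂ)ˣ) : PowerSeries ℂ) = n := by
  have hmul : ∀ a b : ℤ, PowerSeries.coeff 1 ((oneAddXUnit ^ (a + b) : (PowerSeries ℂ)ˣ) : PowerSeries ℂ) =
      PowerSeries.coeff 1 ((oneAddXUnit ^ a : (PowerSeries ℂ)ˣ) : PowerSeries ℂ) +
      PowerSeries.coeff 1 ((oneAddXUnit ^ b : (PowerSeries ℂ)ˣ) : PowerSeries ℂ) := by
    intro a b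
    rw [zpow_add, Units.val_mul, PowerSeries.coeff_one_mul, constantCoeff_oneAddX_zpow,
      constantCoeff_oneAddX_zpow]
    ring
  let φ : ℤ →+ ℂ := AddMonoidHom.mk' (fun n : ℤ =>
    PowerSeries.coeff 1 ((oneAddXUnit ^ n : (PowerSeries ℂ)ˣ) : PowerSeries ℂ)) hmul
  have h1 : φ 1 = 1 := by
    change PowerSeries.coeff 1 ((oneAddXUnit ^ (1 : ℤ) : (PowerSeries ℂ)ˣ) : PowerSeries ℂ) = 1
    simp [oneAddXUnit_coe, PowerSeries.coeff_one]
  have := map_zsmul φ n 1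
  rw [h1, zsmul_one, zsmul_one] at this
  exact this

/-- To first order `(1 + X) ^ a - (1 + X) ^ b` is `(a - b) X`, so the leading coefficient of the
product is the Vandermonde product of the exponents. -/
lemma exists_prod_sub_oneAddX_zpow {N : ℕ} (l : Fin N → ℤ) : ∃ E : PowerSeries ℂ,
    (∏ i : Fin N, ∏ j ∈ Finset.Ioi i, (((oneAddXUnit ^ l i : (PowerSeries ℂ)ˣ) : PowerSeries ℂ) -
      ((oneAddXUnit ^ l j : (PowerSeries ℂ)ˣ) : PowerSeries ℂ))) =
      (∏ i : Fin N, ∏ _j ∈ Finset.Ioi i, PowerSeries.X) * E ∧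
    PowerSeries.constantCoeff E = ∏ i : Fin N, ∏ j ∈ Finset.Ioi i, ((l i : ℂ) - l j) := by
  have h : ∀ i j, ∃ e : PowerSeries ℂ, ((oneAddXUnit ^ l i : (PowerSeries ℂ)ˣ) : PowerSeries ℂ) -
      ((oneAddXUnit ^ l j : (PowerSeries ℂ)ˣ) : PowerSeries ℂ) = PowerSeries.X * e ∧
      PowerSeries.constantCoeff e = (l i : ℂ) - l j := by
    intro i j
    obtain ⟨e, he⟩ := PowerSeries.X_dvd_iff.2 (show PowerSeries.constantCoeff
      (((oneAddXUnit ^ l i : (PowerSeries ℂ)ˣ) : PowerSeries ℂ) -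
      ((oneAddXUnit ^ l j : (PowerSeries ℂ)ˣ) : PowerSeries ℂ)) = 0 by
        rw [map_sub, constantCoeff_oneAddX_zpow, constantCoeff_oneAddX_zpow, sub_self])
    refine ⟨e, he, ?_⟩
    have := congrArg (PowerSeries.coeff 1) he
    rw [map_sub, coeff_one_oneAddX_zpow, coeff_one_oneAddX_zpow, PowerSeries.coeff_one_mul] at this
    simpa [PowerSeries.coeff_one_X] using this.symm
  choose e he he' using h
  refine ⟨∏ i, ∏ j ∈ Finset.Ioi i, e i j, ?_, ?_⟩
  · simp only [he, Finset.prod_mul_distrib]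
  · simp only [map_prod, he']

/-- The images of the variables under `u_i ↦ (1 + X) ^ (N - 1 - i)`. -/
noncomputable def principalSpec (N i : ℕ) : PowerSeries ℂ :=
  if i < N then ((oneAddXUnit ^ ((N : ℤ) - 1 - i) : (PowerSeries ℂ)ˣ) : PowerSeries ℂ) - 1 else 0

lemma hasSubst_principalSpec (N : ℕ) : HasSubst (principalSpec N) where
  const_coeff i := by
    have h : MvPowerSeries.constantCoeff (principalSpec N i) = 0 := by
      change PowerSeries.constantCoeff (principalSpec N i) = 0
      unfold principalSpec
      split_ifs
      · rw [map_sub, constantCoeff_oneAddX_zpow]; simp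
      · simp
    rw [h]; exact IsNilpotent.zero
  coeff_zero d := by
    refine (Set.finite_lt_nat N).subset fun i hi => ?_
    by_contra h
    exact hi (by simp [principalSpec, show ¬ i < N from h])

/-- Weyl's dimension formula. -/
theorem constantCoeff_schurSeries {N : ℕ} (l : Fin N → ℤ) :
    constantCoeff (schurSeries l) * ∏ i : Fin N, ∏ j ∈ Finset.Ioi i, (((j : ℕ) : ℂ) - (i : ℕ)) =
      ∏ i : Fin N, ∏ j ∈ Finset.Ioi i, ((l i : ℂ) - l j) := by
  -- Principal specialisation `u_i = (1 + X) ^ (N - 1 - i)`: the alternant becomes a Vandermonde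
  -- determinant in the `(1 + X) ^ l_j`. The same power of `X` divides both sides, and cancelling it
  -- leaves the value at `1`.
  let Θ : PSeries →ₐ[ℂ] PowerSeries ℂ := substAlgHom (hasSubst_principalSpec N)
  have hΘ : ∀ i < N, Θ (uvar i) =
      ((oneAddXUnit ^ ((N : ℤ) - 1 - i) : (PowerSeries ℂ)ˣ) : PowerSeries ℂ) := by
    intro i hi
    have : Θ (X i) = principalSpec N i := substAlgHom_X _ _
    rw [uvar, map_add, map_one, this, principalSpec, if_pos hi]
    ring
  have hΘu : ∀ i < N, ∀ n : ℤ, Θ ((uunit i ^ n : PSeriesˣ) : PSeries) =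
      (((oneAddXUnit ^ n) ^ ((N : ℤ) - 1 - i) : (PowerSeries ℂ)ˣ) : PowerSeries ℂ) := by
    intro i hi n
    have h1 : Units.map (Θ : PSeries →* PowerSeries ℂ) (uunit i) = oneAddXUnit ^ ((N : ℤ) - 1 - i) := by
      ext1
      exact hΘ i hi
    have := congrArg Units.val (map_zpow (Units.map (Θ : PSeries →* PowerSeries ℂ)) (uunit i) n)
    rw [h1, ← zpow_mul, mul_comm, zpow_mul] at this
    exact this
  have hΘa : Θ (alternant l) = ∏ i : Fin N, ∏ j ∈ Finset.Ioi i,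
      (((oneAddXUnit ^ l i : (PowerSeries ℂ)ˣ) : PowerSeries ℂ) -
      ((oneAddXUnit ^ l j : (PowerSeries ℂ)ˣ) : PowerSeries ℂ)) := by
    have h := Matrix.det_projVandermonde (fun _ : Fin N => (1 : PowerSeries ℂ))
      (fun i => ((oneAddXUnit ^ l i : (PowerSeries ℂ)ˣ) : PowerSeries ℂ))
    simp only [one_mul] at h
    rw [← h, alternant, AlgHom.map_det, ← Matrix.det_transpose]
    congr 1
    ext1 i j
    simp only [Matrix.transpose_apply, AlgHom.mapMatrix_apply, Matrix.map_apply, Matrix.of_apply,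
      Matrix.projVandermonde_apply, one_pow, one_mul, hΘu j j.2]
    rw [← Units.val_pow_eq_pow_val, ← zpow_natCast]
    congr 2
    rw [Fin.val_rev]
    have := j.2
    omega
  have hΘv : Θ (vdm N) = ∏ i : Fin N, ∏ j ∈ Finset.Ioi i,
      (((oneAddXUnit ^ ((N : ℤ) - 1 - (i : ℕ)) : (PowerSeries ℂ)ˣ) : PowerSeries ℂ) -
      ((oneAddXUnit ^ ((N : ℤ) - 1 - (j : ℕ)) : (PowerSeries ℂ)ˣ) : PowerSeries ℂ)) := by
    simp only [vdm, ← uvar_sub, map_prod, map_sub]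
    refine Finset.prod_congr rfl fun i _ => Finset.prod_congr rfl fun j _ => ?_
    rw [hΘ i i.2, hΘ j j.2]
  obtain ⟨E, hE, hE'⟩ := exists_prod_sub_oneAddX_zpow l
  obtain ⟨G, hG, hG'⟩ := exists_prod_sub_oneAddX_zpow fun i : Fin N => (N : ℤ) - 1 - (i : ℕ)
  have h := congrArg Θ (vdm_mul_schurSeries l)
  rw [map_mul, hΘa, hΘv, hE, hG, mul_assoc] at h
  have hX : (∏ i : Fin N, ∏ _j ∈ Finset.Ioi i, (PowerSeries.X : PowerSeries ℂ)) ≠ 0 :=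
    Finset.prod_ne_zero_iff.2 fun _ _ => Finset.prod_ne_zero_iff.2 fun _ _ => PowerSeries.X_ne_zero
  have h2 := congrArg PowerSeries.constantCoeff (mul_left_cancel₀ hX h)
  rw [map_mul, hE', hG'] at h2
  have h3 : PowerSeries.constantCoeff (Θ (schurSeries l)) = constantCoeff (schurSeries l) := by
    have h0 : ∀ i, MvPowerSeries.constantCoeff (principalSpec N i) = 0 := fun i =>
      IsNilpotent.eq_zero ((hasSubst_principalSpec N).const_coeff i)
    have h4 := constantCoeff_subst_eq_zero (R := ℂ) (hasSubst_principalSpec N) h0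
      (f := schurSeries l - algebraMap ℂ PSeries (constantCoeff (schurSeries l)))
      (by simp [MvPowerSeries.algebraMap_apply])
    rw [← substAlgHom_apply (hasSubst_principalSpec N), map_sub, map_sub, AlgHom.commutes,
      sub_eq_zero] at h4
    refine h4.trans ?_
    rw [MvPowerSeries.algebraMap_apply]
    simp
  rw [← h2, h3, mul_comm]
  congr 1
  refine Finset.prod_congr rfl fun i _ => Finset.prod_congr rfl fun j _ => ?_
  push_cast
  ring

lemma constantCoeff_schurSeries_ne_zero {N : ℕ} {l : Fin N → ℤ} (hl : Function.Injective l) :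
    constantCoeff (schurSeries l) ≠ 0 := by
  intro h
  have := constantCoeff_schurSeries l
  rw [h, zero_mul, eq_comm, Finset.prod_eq_zero_iff] at this
  obtain ⟨i, -, hi⟩ := this
  obtain ⟨j, hj, hij⟩ := Finset.prod_eq_zero_iff.1 hi
  have : l i = l j := by exact_mod_cast sub_eq_zero.1 hij
  exact (Finset.mem_Ioi.1 hj).ne (hl this)

end PSeries

/-- Averages are governed by the common value of the generic terms; the finitely many exceptional
indices are bounded and carry the factor `1 / N`. -/
lemma tendsto_average {a : ℕ → ℕ → ℂ} {b : ℕ → ℂ} {c : ℂ} (S : Finset ℕ)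
    (hb : Tendsto b atTop (𝓝 c)) (hab : ∀ᶠ N in atTop, ∀ j < N, j ∉ S → a N j = b N)
    (hS : ∀ j ∈ S, ∃ x, Tendsto (fun N => a N j) atTop (𝓝 x)) :
    Tendsto (fun N : ℕ => (N : ℂ)⁻¹ * ∑ j ∈ Finset.range N, a N j) atTop (𝓝 c) := by
  choose! x hx using hS
  have hinv : Tendsto (fun N : ℕ => (N : ℂ)⁻¹) atTop (𝓝 0) := tendsto_inv_atTop_nhds_zero_nat (𝕜 := ℂ)
  have h1 : Tendsto (fun N : ℕ => b N + (N : ℂ)⁻¹ * ∑ j ∈ S, (a N j - b N)) atTop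
      (𝓝 (c + 0 * ∑ j ∈ S, (x j - c))) :=
    hb.add (hinv.mul (tendsto_finsetSum _ fun j hj => (hx j hj).sub hb))
  rw [zero_mul, add_zero] at h1
  refine h1.congr' ?_
  filter_upwards [hab, eventually_gt_atTop (S.sup id), eventually_gt_atTop 0] with N hN hN2 hN0
  have hsub : S ⊆ Finset.range N := fun j hj =>
    Finset.mem_range.2 ((Finset.le_sup (f := id) hj).trans_lt hN2)
  have h2 : ∑ j ∈ Finset.range N, (a N j - b N) = ∑ j ∈ S, (a N j - b N) :=
    (Finset.sum_subset hsub fun j hj hjS => by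
      rw [hN j (Finset.mem_range.1 hj) hjS, sub_self]).symm
  have hne : (N : ℂ) ≠ 0 := by exact_mod_cast hN0.ne'
  rw [← h2, Finset.sum_sub_distrib]
  simp
  field_simp
  ring

/-! ### Coefficientwise limits as the number of variables grows. -/

namespace PSeries

open MvPowerSeries

/-- The embedding of power series in one variable as power series in the variable `X 0`. -/
noncomputable def iota : PowerSeries ℂ →ₐ[ℂ] PSeries :=
  rename (⟨fun _ => 0, fun _ _ _ => rfl⟩ : Unit ↪ ℕ)

lemma coeff_iota_single (n : ℕ) (f : PowerSeries ℂ) :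
    coeff (Finsupp.single 0 n) (iota f) = PowerSeries.coeff n f := by
  have h := coeff_embDomain_rename (R := ℂ) (⟨fun _ => 0, fun _ _ _ => rfl⟩ : Unit ↪ ℕ) f
    (Finsupp.single () n)
  rw [Finsupp.embDomain_single] at h
  exact h

lemma coeff_iota_of_ne {α : ℕ →₀ ℕ} {j : ℕ} (hj : j ≠ 0) (hα : α j ≠ 0) (f : PowerSeries ℂ) :
    coeff α (iota f) = 0 := by
  refine coeff_rename_eq_zero _ f ?_
  rintro ⟨β, rfl⟩
  apply hα
  apply Finsupp.mapDomain_of_notMem_range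
  rintro ⟨_, h⟩
  exact hj h.symm

lemma eq_single_or_exists (α : ℕ →₀ ℕ) : α = Finsupp.single 0 (α 0) ∨ ∃ j, j ≠ 0 ∧ α j ≠ 0 := by
  by_contra! h
  refine h.1 ?_
  ext j
  rcases eq_or_ne j 0 with rfl | hj
  · simp
  · rw [h.2 j hj, Finsupp.single_eq_of_ne hj]

lemma iota_one_add_X : iota (1 + PowerSeries.X) = uvar 0 := by
  have : iota PowerSeries.X = X 0 := rename_X _ _
  rw [map_add, map_one, this, uvar]

lemma swapV_iota {i j : ℕ} (hi : 1 ≤ i) (hj : 1 ≤ j) (f : PowerSeries ℂ) :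
    swapV i j (iota f) = iota f := by
  ext α
  rw [coeff_swapV]
  have h0 : Equiv.swap i j 0 = 0 := Equiv.swap_apply_of_ne_of_ne (by omega) (by omega)
  rcases eq_single_or_exists α with h | ⟨k, hk, hαk⟩
  · have : swapE i j α = α := by
      ext m
      rw [swapE_apply, h]
      rcases eq_or_ne m 0 with rfl | hm
      · rw [h0]
      · rw [Finsupp.single_eq_of_ne hm, Finsupp.single_eq_of_ne]
        intro h1
        rw [← h0] at h1
        exact hm ((Equiv.swap i j).injective h1)
    rw [this]
  · rw [coeff_iota_of_ne hk hαk, coeff_iota_of_ne (j := Equiv.swap i j k)]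
    · intro h1
      rw [← h0] at h1
      exact hk ((Equiv.swap i j).injective h1)
    · rw [swapE_apply, Equiv.swap_apply_self]
      exact hαk

/-- The sequence `g N` of power series, symmetric in the variables `1, …, N - 1`, converges
coefficientwise to `f (X 0)`. -/
structure Tame (g : ℕ → PSeries) (f : PowerSeries ℂ) : Prop where
  sym : ∀ N, IsSymRest N (g N)
  lim : ∀ α, Tendsto (fun N => coeff α (g N)) atTop (𝓝 (coeff α (iota f)))

lemma Tame.const (f : PowerSeries ℂ) : Tame (fun _ => iota f) f where
  sym _ _ _ hi _ hj _ := swapV_iota hi hj f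
  lim _ := tendsto_const_nhds

lemma Tame.add {g g' : ℕ → PSeries} {f f' : PowerSeries ℂ} (h : Tame g f) (h' : Tame g' f') :
    Tame (fun N => g N + g' N) (f + f') where
  sym N i j hi hiN hj hjN := by
    rw [map_add, h.sym N i j hi hiN hj hjN, h'.sym N i j hi hiN hj hjN]
  lim α := by
    simp only [map_add]
    exact (h.lim α).add (h'.lim α)

lemma Tame.mul {g g' : ℕ → PSeries} {f f' : PowerSeries ℂ} (h : Tame g f) (h' : Tame g' f') :
    Tame (fun N => g N * g' N) (f * f') where
  sym N i j hi hiN hj hjN := by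
    rw [map_mul, h.sym N i j hi hiN hj hjN, h'.sym N i j hi hiN hj hjN]
  lim α := by
    classical
    simp only [map_mul, coeff_mul]
    exact tendsto_finsetSum _ fun p _ => (h.lim p.1).mul (h'.lim p.2)

lemma Tame.inv_smul_eulerD {g : ℕ → PSeries} {f : PowerSeries ℂ} (h : Tame g f) :
    Tame (fun N => (N : ℂ)⁻¹ • eulerD 0 (g N)) 0 where
  sym N i j hi hiN hj hjN := by
    have h0 : Equiv.swap i j 0 = 0 := Equiv.swap_apply_of_ne_of_ne (by omega) (by omega)
    rw [map_smul, swapV_eulerD, h0, h.sym N i j hi hiN hj hjN]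
  lim α := by
    classical
    have hinv : Tendsto (fun N : ℕ => (N : ℂ)⁻¹) atTop (𝓝 0) :=
      tendsto_inv_atTop_nhds_zero_nat (𝕜 := ℂ)
    have h1 : ∃ x, Tendsto (fun N => coeff α (eulerD 0 (g N))) atTop (𝓝 x) := by
      simp only [eulerD_apply, coeff_mul, coeff_pderiv]
      exact ⟨_, tendsto_finsetSum _ fun p _ => ((h.lim _).mul_const _).const_mul _⟩
    obtain ⟨x, hx⟩ := h1
    simpa using hinv.mul hx

/-- The difference quotient `(f - f 0) / X`. -/
noncomputable def shiftDown (f : PowerSeries ℂ) : PowerSeries ℂ :=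
  PowerSeries.mk fun n => PowerSeries.coeff (n + 1) f

/-- An index outside the support of `α`. -/
def freshIndex (α : ℕ →₀ ℕ) : ℕ := α.support.sup id + 1

lemma freshIndex_pos (α : ℕ →₀ ℕ) : 1 ≤ freshIndex α := Nat.le_add_left _ _

lemma apply_freshIndex (α : ℕ →₀ ℕ) : α (freshIndex α) = 0 := by
  by_contra h
  have := Finset.le_sup (f := id) (Finsupp.mem_support_iff.2 h)
  simp only [id, freshIndex] at this
  omega

lemma IsSymRest.coeff_swapE {N : ℕ} {g : PSeries} (hg : IsSymRest N g) {α : ℕ →₀ ℕ} {i j : ℕ}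
    (hi : 1 ≤ i) (hiN : i < N) (hj : 1 ≤ j) (hjN : j < N) (hαi : α i = 0) (hαj : α j = 0) :
    coeff (swapE 0 i α) g = coeff (swapE 0 j α) g := by
  conv_rhs => rw [← hg i j hi hiN hj hjN, coeff_swapV]
  congr 2
  ext m
  simp only [swapE_apply]
  rcases eq_or_ne m 0 with rfl | hm0
  · rw [Equiv.swap_apply_left, Equiv.swap_apply_of_ne_of_ne (show 0 ≠ i by omega) (show 0 ≠ j by omega),
      Equiv.swap_apply_left, hαi, hαj]
  rcases eq_or_ne m i with rfl | hmi
  · rw [Equiv.swap_apply_right, Equiv.swap_apply_left, Equiv.swap_apply_right]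
  rcases eq_or_ne m j with rfl | hmj
  · rw [Equiv.swap_apply_of_ne_of_ne hm0 hmi, Equiv.swap_apply_right,
      Equiv.swap_apply_of_ne_of_ne (by omega) hmi.symm, hαi, hαj]
  · rw [Equiv.swap_apply_of_ne_of_ne hm0 hmi, Equiv.swap_apply_of_ne_of_ne hmi hmj,
      Equiv.swap_apply_of_ne_of_ne hm0 hmj]

/-- For `j` outside the support of `α` and different from `0`, the coefficient of `α` is that of `β
= α + e_0` minus that of `β` with `0` and `j` exchanged. By symmetry neither depends on `j`, and the
second tends to zero because it contains a variable other than `X 0`. -/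
lemma Tame.average_divDiff {g : ℕ → PSeries} {f : PowerSeries ℂ} (h : Tame g f) :
    Tame (fun N => (N : ℂ)⁻¹ • ∑ j ∈ Finset.Ico 1 N, divDiff j (g N)) (shiftDown f) where
  sym N a b ha haN hb hbN := by
    rw [map_smul, map_sum]
    congr 1
    rw [Finset.sum_congr rfl (g := fun j => divDiff (Equiv.swap a b j) (g N)) fun j hj => by
      rw [swapV_divDiff ha hb (Finset.mem_Ico.1 hj).1, h.sym N a b ha haN hb hbN]]
    refine Equiv.Perm.sum_comp (Equiv.swap a b) (Finset.Ico 1 N) (fun j => divDiff j (g N)) ?_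
    intro j hj
    have := Equiv.swap_apply_ne_self_iff.1 hj
    simp only [Finset.coe_Ico, Set.mem_Ico]
    rcases this.2 with rfl | rfl <;> omega
  lim α := by
    set β := α + Finsupp.single 0 1 with hβ
    have hβj : ∀ j, j ≠ 0 → β j = α j := fun j hj => by simp [hβ, hj]
    set m := freshIndex α with hm
    have hm1 : 1 ≤ m := freshIndex_pos α
    have hβm : β m = 0 := by rw [hβj m (by omega)]; exact apply_freshIndex α
    have hlim : Tendsto (fun N => coeff β (g N) - coeff (swapE 0 m β) (g N)) atTop
        (𝓝 (coeff α (iota (shiftDown f)))) := by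
      have h1 : coeff (swapE 0 m β) (iota f) = 0 := by
        apply coeff_iota_of_ne (j := m) (by omega)
        rw [swapE_apply, Equiv.swap_apply_right]
        simp [hβ]
      have h2 : coeff β (iota f) = coeff α (iota (shiftDown f)) := by
        rcases eq_single_or_exists α with hα | ⟨k, hk, hαk⟩
        · rw [hβ, hα, ← Finsupp.single_add, coeff_iota_single, coeff_iota_single, shiftDown,
            PowerSeries.coeff_mk]
        · rw [coeff_iota_of_ne hk hαk, coeff_iota_of_ne hk (by rwa [hβj k hk])]
      have := (h.lim β).sub (h.lim (swapE 0 m β))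
      rwa [h1, h2, sub_zero] at this
    have key := tendsto_average (a := fun N j => if j = 0 then 0 else coeff α (divDiff j (g N)))
      (insert 0 α.support) hlim ?_ ?_
    · refine key.congr' ?_
      filter_upwards [eventually_gt_atTop 0] with N hN
      rw [map_smul, map_sum, smul_eq_mul, Finset.range_eq_Ico, Finset.sum_eq_sum_Ico_succ_bot hN]
      simp only [if_true, zero_add]
      congr 1
      refine Finset.sum_congr rfl fun j hj => ?_
      rw [if_neg (by have := (Finset.mem_Ico.1 hj).1; omega)]
    · filter_upwards [eventually_gt_atTop m] with N hN j hjN hj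
      simp only [Finset.mem_insert, Finsupp.mem_support_iff, not_or, not_not] at hj
      have e : coeff α (divDiff j (g N)) = coeff β (g N) - coeff (swapE 0 j β) (g N) := by
        rw [coeff_divDiff, hj.2]
        simp [coeff_swapV, hβ]
      rw [if_neg hj.1, e, (h.sym N).coeff_swapE (by omega) hjN hm1 hN (by rw [hβj j hj.1, hj.2]) hβm]
    · intro j _
      by_cases hj : j = 0
      · exact ⟨0, by simp [hj]⟩
      · simp only [hj, if_false, coeff_divDiff, map_sub, coeff_swapV]
        exact ⟨_, tendsto_finsetSum _ fun t _ => (h.lim _).sub (h.lim _)⟩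

/-- Generic swaps move the variable `X 0` to a variable absent from `α`, so in the limit only the
constant term survives. This collapse is the source of the factorisation of second moments. -/
lemma Tame.average_swapV {g : ℕ → PSeries} {f : PowerSeries ℂ} (h : Tame g f) :
    Tame (fun N => (N : ℂ)⁻¹ • ∑ j ∈ Finset.range N, swapV 0 j (g N))
      (PowerSeries.C (PowerSeries.constantCoeff f)) where
  sym N a b ha haN hb hbN := by
    have h0 : Equiv.swap a b 0 = 0 := Equiv.swap_apply_of_ne_of_ne (by omega) (by omega)
    rw [map_smul, map_sum]
    congr 1
    rw [Finset.sum_congr rfl (g := fun j => swapV 0 (Equiv.swap a b j) (g N)) fun j hj => by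
      rw [swapV_conj, h0, h.sym N a b ha haN hb hbN]]
    refine Equiv.Perm.sum_comp (Equiv.swap a b) (Finset.range N) (fun j => swapV 0 j (g N)) ?_
    intro j hj
    have := Equiv.swap_apply_ne_self_iff.1 hj
    simp only [Finset.coe_range, Set.mem_Iio]
    rcases this.2 with rfl | rfl <;> omega
  lim α := by
    set m := freshIndex α with hm
    have hm1 : 1 ≤ m := freshIndex_pos α
    have hαm : α m = 0 := apply_freshIndex α
    have hlim : Tendsto (fun N => coeff (swapE 0 m α) (g N)) atTop
        (𝓝 (coeff α (iota (PowerSeries.C (PowerSeries.constantCoeff f))))) := by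
      have h1 : coeff (swapE 0 m α) (iota f) =
          coeff α (iota (PowerSeries.C (PowerSeries.constantCoeff f))) := by
        rcases eq_single_or_exists α with hα | ⟨k, hk, hαk⟩
        · by_cases h0 : α 0 = 0
          · have hα0 : α = 0 := by rw [hα, h0]; simp
            have : swapE 0 m α = Finsupp.single 0 0 := by ext; simp [swapE_apply, hα0]
            rw [this, hα, h0, coeff_iota_single, coeff_iota_single]
            simp
          · rw [coeff_iota_of_ne (j := m) (by omega), hα, coeff_iota_single, PowerSeries.coeff_C, if_neg h0]
            rw [swapE_apply, Equiv.swap_apply_right]; exact h0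
        · have hkm : k ≠ m := fun h => hαk (h ▸ hαm)
          rw [coeff_iota_of_ne hk hαk, coeff_iota_of_ne hk]
          rwa [swapE_apply, Equiv.swap_apply_of_ne_of_ne hk hkm]
      rw [← h1]
      exact h.lim _
    have key := tendsto_average (a := fun N j => coeff α (swapV 0 j (g N)))
      (insert 0 α.support) hlim ?_ ?_
    · refine key.congr fun N => ?_
      rw [map_smul, map_sum, smul_eq_mul]
    · filter_upwards [eventually_gt_atTop m] with N hN j hjN hj
      simp only [Finset.mem_insert, Finsupp.mem_support_iff, not_or, not_not] at hj
      rw [coeff_swapV, (h.sym N).coeff_swapE (by omega) hjN hm1 hN hj.2 hαm]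
    · intro j _
      simp only [coeff_swapV]
      exact ⟨_, h.lim _⟩

/-- The operator `lowOp N / N`, conjugated by a symmetric power series with logarithmic
derivative `N ℓ`. -/
noncomputable def redOp (N : ℕ) (ℓ g : PSeries) : PSeries :=
  (N : ℂ)⁻¹ • eulerD 0 g + ℓ * g + uvar 0 * ((N : ℂ)⁻¹ • ∑ j ∈ Finset.Ico 1 N, divDiff j g)

/-- The limit of the operators `redOp N`. -/
noncomputable def limOp (ψ f : PowerSeries ℂ) : PowerSeries ℂ :=
  (1 + PowerSeries.X) * (ψ * f + shiftDown f)

lemma Tame.redOp {g ℓ : ℕ → PSeries} {f ψ : PowerSeries ℂ} (hg : Tame g f)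
    (hℓ : Tame ℓ ((1 + PowerSeries.X) * ψ)) :
    Tame (fun N => PSeries.redOp N (ℓ N) (g N)) (limOp ψ f) := by
  have := (hg.inv_smul_eulerD.add (hℓ.mul hg)).add ((Tame.const (1 + PowerSeries.X)).mul hg.average_divDiff)
  simp only [iota_one_add_X] at this
  have e : limOp ψ f = 0 + (1 + PowerSeries.X) * ψ * f + (1 + PowerSeries.X) * shiftDown f := by
    unfold limOp; ring
  rw [e]
  exact this

lemma Tame.iterate_redOp {g ℓ : ℕ → PSeries} {f ψ : PowerSeries ℂ} (hg : Tame g f)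
    (hℓ : Tame ℓ ((1 + PowerSeries.X) * ψ)) (k : ℕ) :
    Tame (fun N => (PSeries.redOp N (ℓ N))^[k] (g N)) ((limOp ψ)^[k] f) := by
  induction k with
  | zero => exact hg
  | succ k ih =>
    simp only [Function.iterate_succ_apply']
    exact ih.redOp hℓ

lemma divDiff_mul {j : ℕ} (hj : j ≠ 0) {s : PSeries} (hs : swapV 0 j s = s) (g : PSeries) :
    divDiff j (s * g) = s * divDiff j g := by
  apply mul_left_cancel₀ (X_sub_ne_zero hj.symm)
  rw [divDiff_spec hj, mul_left_comm, divDiff_spec hj, map_mul, hs, mul_sub]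

/-- A symmetric factor passes through the divided differences, and through the Euler derivation at
the price of its logarithmic derivative. -/
lemma lowOp_mul {N : ℕ} (hN : 0 < N) {s ℓ : PSeries} (hs : IsSym N s)
    (hℓ : eulerD 0 s = (N : ℂ) • (ℓ * s)) (g : PSeries) :
    lowOp N (s * g) = (N : ℂ) • (s * redOp N ℓ g) := by
  have hne : (N : ℂ) ≠ 0 := by exact_mod_cast hN.ne'
  rw [lowOp_apply, Derivation.leibniz, hℓ, Finset.sum_congr rfl (g := fun j => s * divDiff j g)
    fun j hj => divDiff_mul (by have := (Finset.mem_Ico.1 hj).1; omega)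
      (hs 0 j hN (Finset.mem_Ico.1 hj).2) g, ← Finset.mul_sum, redOp]
  simp only [smul_eq_mul, mul_add, smul_add, mul_smul_comm, smul_smul,
    mul_inv_cancel₀ hne, one_smul]
  rw [show g * (ℓ * s) = s * (ℓ * g) by ring]
  ring

lemma iterate_lowOp_mul {N : ℕ} (hN : 0 < N) {s ℓ : PSeries} (hs : IsSym N s)
    (hℓ : eulerD 0 s = (N : ℂ) • (ℓ * s)) (g : PSeries) (k : ℕ) :
    (lowOp N)^[k] (s * g) = (N : ℂ) ^ k • (s * (redOp N ℓ)^[k] g) := by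
  induction k with
  | zero => simp
  | succ k ih =>
    rw [Function.iterate_succ_apply', ih, map_smul, lowOp_mul hN hs hℓ, smul_smul, pow_succ,
      Function.iterate_succ_apply']

lemma shiftDown_smul (c : ℂ) (f : PowerSeries ℂ) : shiftDown (c • f) = c • shiftDown f := by
  ext n; simp [shiftDown]

lemma iterate_limOp_C (ψ : PowerSeries ℂ) (c : ℂ) (k : ℕ) :
    (limOp ψ)^[k] (PowerSeries.C c) = c • (limOp ψ)^[k] 1 := by
  induction k with
  | zero => simp [PowerSeries.smul_eq_C_mul]
  | succ k ih =>
    rw [Function.iterate_succ_apply', ih, Function.iterate_succ_apply', limOp, limOp, shiftDown_smul,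
      mul_smul_comm, ← smul_add, mul_smul_comm]

/-! ### Limits for symmetric series with a convergent logarithmic derivative. -/

section Limit

variable {s ℓ : ℕ → PSeries} {ψ : PowerSeries ℂ} (hs : ∀ N, IsSym N (s N))
  (hs0 : ∀ N, constantCoeff (s N) = 1) (hℓs : ∀ N, 0 < N → eulerD 0 (s N) = (N : ℂ) • (ℓ N * s N))
  (hℓ : Tame ℓ ((1 + PowerSeries.X) * ψ))

include hs hs0 hℓs hℓ

theorem tendsto_constantCoeff_lowOp (k : ℕ) :
    Tendsto (fun N : ℕ => ((N : ℂ) ^ k)⁻¹ * constantCoeff ((lowOp N)^[k] (s N))) atTop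
      (𝓝 (PowerSeries.constantCoeff ((limOp ψ)^[k] 1))) := by
  have h := ((Tame.const 1).iterate_redOp hℓ k).lim (Finsupp.single 0 0)
  rw [coeff_iota_single, PowerSeries.coeff_zero_eq_constantCoeff] at h
  refine h.congr' ?_
  filter_upwards [eventually_gt_atTop 0] with N hN
  have hne : (N : ℂ) ≠ 0 := by exact_mod_cast hN.ne'
  have := iterate_lowOp_mul hN (hs N) (hℓs N hN) 1 k
  rw [mul_one] at this
  rw [this, ← coeff_zero_eq_constantCoeff_apply, map_smul, coeff_zero_eq_constantCoeff_apply, map_mul,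
    hs0, one_mul, smul_eq_mul, inv_mul_cancel_left₀ (pow_ne_zero _ hne), map_one,
    ← coeff_zero_eq_constantCoeff_apply, Finsupp.single_zero]

/-- After `s N` and the power of `N` are taken out, the shift operator yields an average over swaps,
which tends to a constant. The remaining powers of the limit operator act linearly on that constant,
hence the product. The factor `u_0⁻¹` is invisible because it equals one at `1`. -/
theorem tendsto_constantCoeff_lowOp_shiftOp (k k' : ℕ) :
    Tendsto (fun N : ℕ => ((N : ℂ) ^ (k + k' + 1))⁻¹ *
        constantCoeff ((lowOp N)^[k'] (shiftOp N k (s N)))) atTop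
      (𝓝 (PowerSeries.constantCoeff ((limOp ψ)^[k] 1) *
        PowerSeries.constantCoeff ((limOp ψ)^[k'] 1))) := by
  have hunit : ((uunit 0)⁻¹ : PSeriesˣ).1 = iota ((1 + PowerSeries.X)⁻¹) := by
    have h1 : (1 + PowerSeries.X : PowerSeries ℂ) * (1 + PowerSeries.X)⁻¹ = 1 :=
      PowerSeries.mul_inv_cancel _ (by simp)
    have h2 := congrArg iota h1
    rw [map_mul, iota_one_add_X, map_one, ← coe_uunit] at h2
    exact Units.inv_eq_of_mul_eq_one_right h2
  have h1 := (((Tame.const ((1 + PowerSeries.X)⁻¹)).mul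
    ((Tame.const 1).iterate_redOp hℓ k)).average_swapV).iterate_redOp hℓ k'
  have h := h1.lim (Finsupp.single 0 0)
  rw [coeff_iota_single, iterate_limOp_C, PowerSeries.coeff_zero_eq_constantCoeff] at h
  have e : ∀ f : PowerSeries ℂ, PowerSeries.constantCoeff (PowerSeries.constantCoeff
      ((1 + PowerSeries.X)⁻¹ * (limOp ψ)^[k] 1) • f) =
      PowerSeries.constantCoeff ((limOp ψ)^[k] 1) * PowerSeries.constantCoeff f := by
    intro f
    simp [PowerSeries.smul_eq_C_mul]
  rw [e] at h
  refine h.congr' ?_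
  filter_upwards [eventually_gt_atTop 0] with N hN
  have hne : (N : ℂ) ≠ 0 := by exact_mod_cast hN.ne'
  have h2 : shiftOp N k (s N) = (N : ℂ) ^ (k + 1) • (s N * ((N : ℂ)⁻¹ • ∑ j ∈ Finset.range N,
      swapV 0 j (iota ((1 + PowerSeries.X)⁻¹) * (redOp N (ℓ N))^[k] (iota 1)))) := by
    have h3 := iterate_lowOp_mul hN (hs N) (hℓs N hN) 1 k
    rw [mul_one] at h3
    rw [shiftOp_apply, h3, hunit, mul_smul_comm (N : ℂ)⁻¹ (s N), smul_smul, pow_succ, mul_assoc,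
      mul_inv_cancel₀ hne, mul_one, Finset.mul_sum, Finset.smul_sum, map_one]
    refine Finset.sum_congr rfl fun i hi => ?_
    rw [mul_smul_comm, map_smul, mul_left_comm, map_mul, hs N 0 i hN (Finset.mem_range.1 hi)]
  have h4 : (lowOp N)^[k'] (shiftOp N k (s N)) = (N : ℂ) ^ (k + k' + 1) • (s N *
      (redOp N (ℓ N))^[k'] ((N : ℂ)⁻¹ • ∑ j ∈ Finset.range N,
      swapV 0 j (iota ((1 + PowerSeries.X)⁻¹) * (redOp N (ℓ N))^[k] (iota 1)))) := by
    rw [h2, ← Module.End.pow_apply, map_smul, Module.End.pow_apply,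
      iterate_lowOp_mul hN (hs N) (hℓs N hN), smul_smul, ← pow_add]
    congr 2
    ring
  rw [h4, ← coeff_zero_eq_constantCoeff_apply, map_smul, coeff_zero_eq_constantCoeff_apply, map_mul,
    hs0, one_mul, smul_eq_mul, inv_mul_cancel_left₀ (pow_ne_zero _ hne),
    ← coeff_zero_eq_constantCoeff_apply, Finsupp.single_zero]

end Limit

end PSeries

/-- The weight `∏_{j ≠ p} (x_p - x_j - h) / (x_p - x_j)`. -/
noncomputable def stepWeight {N : ℕ} (h : ℝ) (x : Fin N → ℝ) (p : Fin N) : ℝ :=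
  ∏ j ∈ Finset.univ.erase p, ((x p - x j - h) / (x p - x j))

/-- The coordinates `(lam_i + N - i) / N` of a strictly decreasing tuple. -/
noncomputable def scaled {N : ℕ} (l : Fin N → ℤ) (i : Fin N) : ℝ := (l i : ℝ) / N

/-- The moments of the `q`-deformed Perelomov–Popov measure. -/
noncomputable def ppMoment {N : ℕ} (q : ℝ) (l : Fin N → ℤ) (k : ℕ) : ℝ :=
  (N : ℝ)⁻¹ * ∑ p, stepWeight (q / N) (scaled l) p * scaled l p ^ k

/-- The average of `x_p ^ k m_k' (l - e_p)` with respect to the Perelomov–Popov weights. -/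
noncomputable def shiftedMoment {N : ℕ} (l : Fin N → ℤ) (k k' : ℕ) : ℝ :=
  (N : ℝ)⁻¹ * ∑ p, stepWeight (1 / N) (scaled l) p * scaled l p ^ k *
    ppMoment 1 (l - Pi.single p 1) k'

lemma scaled_injective {N : ℕ} {l : Fin N → ℤ} (hl : Function.Injective l) :
    Function.Injective (scaled l) := by
  intro i j h
  have hN : (N : ℝ) ≠ 0 := by exact_mod_cast (Fin.pos i).ne'
  exact hl (by exact_mod_cast (div_left_inj' hN).1 h)

lemma stepWeight_scaled {N : ℕ} (q : ℝ) (l : Fin N → ℤ) (p : Fin N) :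
    stepWeight (q / N) (scaled l) p =
      ∏ j ∈ Finset.univ.erase p, (((l p : ℝ) - l j - q) / ((l p : ℝ) - l j)) := by
  have hN : (N : ℝ) ≠ 0 := by exact_mod_cast (Fin.pos p).ne'
  refine Finset.prod_congr rfl fun j _ => ?_
  simp only [scaled]
  rw [← sub_div, ← sub_div, div_div_div_cancel_right₀ hN]

/-! ### Perelomov–Popov moments as values at `1`. -/

namespace PSeries

open MvPowerSeries

/-- Coefficientwise summation of power series. -/
def CoeffHasSum {β : Type*} (F : β → PSeries) (G : PSeries) : Prop :=
  ∀ α, HasSum (fun b => coeff α (F b)) (coeff α G)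

namespace CoeffHasSum

variable {β : Type*} {F F' : β → PSeries} {G G' : PSeries}

lemma add (h : CoeffHasSum F G) (h' : CoeffHasSum F' G') :
    CoeffHasSum (fun b => F b + F' b) (G + G') := fun α => by
  simp only [map_add]
  exact (h α).add (h' α)

lemma sum {κ : Type*} (s : Finset κ) {F : κ → β → PSeries} {G : κ → PSeries}
    (h : ∀ i ∈ s, CoeffHasSum (F i) (G i)) :
    CoeffHasSum (fun b => ∑ i ∈ s, F i b) (∑ i ∈ s, G i) := fun α => by
  simp only [map_sum]
  exact hasSum_sum fun i hi => h i hi α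

lemma mul_left (h : CoeffHasSum F G) (f : PSeries) : CoeffHasSum (fun b => f * F b) (f * G) :=
  fun α => by
    classical
    simp only [coeff_mul]
    exact hasSum_sum fun p _ => (h p.2).mul_left _

lemma eulerD (h : CoeffHasSum F G) (i : ℕ) :
    CoeffHasSum (fun b => PSeries.eulerD i (F b)) (PSeries.eulerD i G) := by
  simp only [eulerD_apply]
  refine mul_left (fun α => ?_) _
  simp only [coeff_pderiv]
  exact (h _).mul_right _

lemma swapV (h : CoeffHasSum F G) (i j : ℕ) :
    CoeffHasSum (fun b => PSeries.swapV i j (F b)) (PSeries.swapV i j G) := fun α => by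
  simp only [coeff_swapV]
  exact h _

lemma divDiff (h : CoeffHasSum F G) (j : ℕ) :
    CoeffHasSum (fun b => PSeries.divDiff j (F b)) (PSeries.divDiff j G) := fun α => by
  simp only [coeff_divDiff, map_sub]
  exact hasSum_sum fun t _ => (h _).sub (h.swapV 0 j _)

lemma lowOp (h : CoeffHasSum F G) (N : ℕ) :
    CoeffHasSum (fun b => PSeries.lowOp N (F b)) (PSeries.lowOp N G) := by
  simp only [lowOp_apply]
  exact (h.eulerD 0).add ((sum _ fun j _ => h.divDiff j).mul_left _)

lemma iterate_lowOp (h : CoeffHasSum F G) (N k : ℕ) :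
    CoeffHasSum (fun b => (PSeries.lowOp N)^[k] (F b)) ((PSeries.lowOp N)^[k] G) := by
  induction k with
  | zero => exact h
  | succ k ih =>
    simp only [Function.iterate_succ_apply']
    exact ih.lowOp N

lemma shiftOp (h : CoeffHasSum F G) (N k : ℕ) :
    CoeffHasSum (fun b => PSeries.shiftOp N k (F b)) (PSeries.shiftOp N k G) := by
  simp only [shiftOp_apply]
  exact sum _ fun i _ => ((h.iterate_lowOp N k).mul_left _).swapV 0 i

lemma constantCoeff (h : CoeffHasSum F G) :
    HasSum (fun b => MvPowerSeries.constantCoeff (F b)) (MvPowerSeries.constantCoeff G) := by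
  simpa only [coeff_zero_eq_constantCoeff_apply] using h 0

end CoeffHasSum

/-- At the point `1` the exchanges act trivially and `u_i⁻¹ = 1`, so the `N` summands agree. -/
lemma constantCoeff_shiftOp (N k : ℕ) (f : PSeries) :
    constantCoeff (shiftOp N k f) = N * constantCoeff ((lowOp N)^[k] f) := by
  have h1 : constantCoeff (((uunit 0)⁻¹ : PSeriesˣ) : PSeries) = 1 := by
    simp [uvar]
  rw [shiftOp_apply, map_sum]
  simp [swapV, h1]

lemma schurSeries_eq_zero {N : ℕ} {l : Fin N → ℤ} (hl : ¬ Function.Injective l) :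
    schurSeries l = 0 := by
  have h : alternant l = 0 := by
    simp only [Function.Injective, not_forall] at hl
    obtain ⟨i, j, hij, hne⟩ := hl
    exact Matrix.det_zero_of_column_eq hne fun k => by simp [hij]
  have := vdm_mul_schurSeries l
  rw [h] at this
  exact (mul_eq_zero.1 this).resolve_left (vdm_ne_zero N)

/-- Only the factors that involve the index `p` change. Each is multiplied by a ratio unaffected by
reversing the order of its two indices, so the ratios assemble into a product over all `j ≠ p`. -/
lemma prod_Ioi_shift {N : ℕ} {l : Fin N → ℤ} (hl : Function.Injective l) (p : Fin N) :
    ∏ i : Fin N, ∏ j ∈ Finset.Ioi i,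
      ((((l - Pi.single p 1 : Fin N → ℤ) i : ℤ) : ℂ) - ((l - Pi.single p 1 : Fin N → ℤ) j : ℤ)) =
      (∏ j ∈ Finset.univ.erase p, (((l p : ℂ) - l j - 1) / ((l p : ℂ) - l j))) *
      ∏ i : Fin N, ∏ j ∈ Finset.Ioi i, ((l i : ℂ) - l j) := by
  have hne : ∀ i j, i ≠ j → ((l i : ℂ) - l j) ≠ 0 := fun i j hij => by
    rw [sub_ne_zero]; exact_mod_cast hl.ne hij
  set r : Fin N → ℂ := fun j => ((l p : ℂ) - l j - 1) / ((l p : ℂ) - l j) with hr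
  have h1 : ∀ i, ∀ j ∈ Finset.Ioi i,
      ((((l - Pi.single p 1 : Fin N → ℤ) i : ℤ) : ℂ) - ((l - Pi.single p 1 : Fin N → ℤ) j : ℤ)) =
      (if i = p then r j else 1) * (if j = p then r i else 1) * ((l i : ℂ) - l j) := by
    intro i j hj
    have hij : i ≠ j := (Finset.mem_Ioi.1 hj).ne
    have := hne i j hij
    by_cases hi : i = p
    · subst hi
      simp only [Pi.sub_apply, Pi.single_eq_same, Pi.single_eq_of_ne hij.symm, if_true, hij.symm, if_false, hr]
      push_cast
      field_simp
      ring
    · by_cases hj' : j = p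
      · subst hj'
        have h2 := hne j i hij.symm
        simp only [Pi.sub_apply, Pi.single_eq_same, Pi.single_eq_of_ne hij, if_true, hij, if_false, hr]
        push_cast
        rw [← neg_sub (l j : ℂ) (l i)]
        field_simp
        ring
      · simp [hi, hj']
  rw [Finset.prod_congr rfl fun i _ => Finset.prod_congr rfl (h1 i)]
  simp only [Finset.prod_mul_distrib]
  congr 1
  have h2 : ∏ i : Fin N, ∏ j ∈ Finset.Ioi i, (if i = p then r j else 1) = ∏ j ∈ Finset.Ioi p, r j := by
    rw [Finset.prod_eq_single p]
    · simp
    · intro i _ hi; simp [hi]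
    · simp
  have h3 : ∏ i : Fin N, ∏ j ∈ Finset.Ioi i, (if j = p then r i else 1) = ∏ j ∈ Finset.Iio p, r j := by
    simp only [Finset.prod_ite_eq', Finset.mem_Ioi]
    rw [← Finset.prod_filter]
    congr 1
    ext i; simp
  rw [h2, h3, mul_comm, ← Finset.prod_union]
  · congr 1
    ext i; simp
  · rw [Finset.disjoint_left]
    intro a ha hb
    simp at ha hb
    exact absurd ha hb.not_gt

/-- The origin of the Perelomov–Popov weights: up to the factor `1 / N` they are, at `q = 1`, the
ratios of the Weyl dimensions of `l - e_p` and `l`. -/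
lemma constantCoeff_schurSeries_shift {N : ℕ} {l : Fin N → ℤ} (hl : Function.Injective l)
    (p : Fin N) : constantCoeff (schurSeries (l - Pi.single p 1)) =
      (stepWeight (1 / N) (scaled l) p : ℂ) * constantCoeff (schurSeries l) := by
  have hV : ∏ i : Fin N, ∏ j ∈ Finset.Ioi i, (((j : ℕ) : ℂ) - (i : ℕ)) ≠ 0 :=
    Finset.prod_ne_zero_iff.2 fun i _ => Finset.prod_ne_zero_iff.2 fun j hj => by
      rw [sub_ne_zero]
      exact_mod_cast Fin.val_injective.ne (Finset.mem_Ioi.1 hj).ne'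
  apply mul_right_cancel₀ hV
  rw [constantCoeff_schurSeries, prod_Ioi_shift hl, mul_assoc, constantCoeff_schurSeries,
    stepWeight_scaled]
  push_cast
  rfl

lemma constantCoeff_lowOp_schurSeries {N : ℕ} (hN : 0 < N) {l : Fin N → ℤ}
    (hl : Function.Injective l) (k : ℕ) : constantCoeff ((lowOp N)^[k] (schurSeries l)) =
      (N : ℂ) ^ k * (ppMoment 1 l k : ℝ) * constantCoeff (schurSeries l) := by
  have hne : (N : ℂ) ≠ 0 := by exact_mod_cast hN.ne'
  have h := constantCoeff_shiftOp N k (schurSeries l)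
  apply mul_left_cancel₀ hne
  rw [← h, shiftOp_schurSeries, map_sum, ppMoment]
  push_cast
  rw [Finset.mul_sum, Finset.mul_sum, Finset.sum_mul, Finset.mul_sum]
  refine Finset.sum_congr rfl fun p _ => ?_
  rw [← coeff_zero_eq_constantCoeff_apply, map_smul, coeff_zero_eq_constantCoeff_apply,
    constantCoeff_schurSeries_shift hl, scaled]
  push_cast
  rw [smul_eq_mul, div_pow]
  field_simp

lemma constantCoeff_lowOp_shiftOp_schurSeries {N : ℕ} (hN : 0 < N) {l : Fin N → ℤ}
    (hl : Function.Injective l) (k k' : ℕ) :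
    constantCoeff ((lowOp N)^[k'] (shiftOp N k (schurSeries l))) =
      (N : ℂ) ^ (k + k' + 1) * (shiftedMoment l k k' : ℝ) * constantCoeff (schurSeries l) := by
  have hne : (N : ℂ) ≠ 0 := by exact_mod_cast hN.ne'
  rw [shiftOp_schurSeries, ← Module.End.pow_apply, map_sum, map_sum, shiftedMoment]
  push_cast
  rw [Finset.mul_sum, Finset.mul_sum, Finset.sum_mul]
  refine Finset.sum_congr rfl fun p _ => ?_
  rw [map_smul, Module.End.pow_apply, ← coeff_zero_eq_constantCoeff_apply, map_smul,
    coeff_zero_eq_constantCoeff_apply]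
  have hs : constantCoeff ((lowOp N)^[k'] (schurSeries (l - Pi.single p 1))) =
      (N : ℂ) ^ k' * (ppMoment 1 (l - Pi.single p 1) k' : ℝ) *
        ((stepWeight (1 / N) (scaled l) p : ℂ) * constantCoeff (schurSeries l)) := by
    rw [← constantCoeff_schurSeries_shift hl]
    -- If lowering `l_p` makes two exponents collide, the Schur series is zero and both sides
    -- vanish.
    by_cases hp : Function.Injective (l - Pi.single p 1)
    · exact constantCoeff_lowOp_schurSeries hN hp k'
    · rw [schurSeries_eq_zero hp, ← Module.End.pow_apply]
      simp
  rw [hs, scaled]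
  push_cast
  rw [smul_eq_mul, pow_add, pow_add, div_pow]
  field_simp

end PSeries

/-! ### Smooth germs at `1` and their partial derivatives. -/

section PartialDerivatives

variable {N : ℕ} {f g : (Fin N → ℂ) → ℂ}

lemma partialD_of_le {i : ℕ} (h : N ≤ i) (f : (Fin N → ℂ) → ℂ) : partialD i f = 0 := by
  funext u
  simp [partialD, h.not_gt]

lemma partialD_eq_fderiv {i : ℕ} (h : i < N) {u : Fin N → ℂ} (hf : DifferentiableAt ℂ f u) :
    partialD i f u = fderiv ℂ f u (Pi.single ⟨i, h⟩ 1) := by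
  rw [partialD, dif_pos h]
  have h1 : HasDerivAt (fun t : ℂ => Function.update u ⟨i, h⟩ t) (Pi.single ⟨i, h⟩ 1) (u ⟨i, h⟩) :=
    hasDerivAt_update u ⟨i, h⟩ (u ⟨i, h⟩)
  have h2 : HasFDerivAt f (fderiv ℂ f u) (Function.update u ⟨i, h⟩ (u ⟨i, h⟩)) := by
    rw [Function.update_eq_self]; exact hf.hasFDerivAt
  exact (h2.comp_hasDerivAt _ h1).deriv

lemma partialD_congr {i : ℕ} {u : Fin N → ℂ} (h : f =ᶠ[𝓝 u] g) :
    partialD i f =ᶠ[𝓝 u] partialD i g := by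
  filter_upwards [eventually_eventually_nhds.2 h] with v hv
  unfold partialD
  split_ifs with hi
  · apply Filter.EventuallyEq.deriv_eq
    have hc : Tendsto (fun t : ℂ => Function.update v ⟨i, hi⟩ t) (𝓝 (v ⟨i, hi⟩)) (𝓝 v) := by
      have : Continuous (fun t : ℂ => Function.update v ⟨i, hi⟩ t) := by fun_prop
      simpa using this.tendsto (v ⟨i, hi⟩)
    exact hc.eventually hv
  · rfl

/-- Smooth germs at `1`. -/
def SmoothAtOne (f : (Fin N → ℂ) → ℂ) : Prop := ContDiffAt ℂ ∞ f 1

lemma SmoothAtOne.eventually_differentiableAt (hf : SmoothAtOne f) :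
    ∀ᶠ u in 𝓝 (1 : Fin N → ℂ), DifferentiableAt ℂ f u := by
  have h1 : ContDiffAt ℂ 1 f 1 := ContDiffAt.of_le hf (by exact_mod_cast le_top)
  filter_upwards [h1.eventually (by simp)] with u hu
  exact hu.differentiableAt one_ne_zero

lemma SmoothAtOne.partialD_eventuallyEq (hf : SmoothAtOne f) {i : ℕ} (h : i < N) :
    partialD i f =ᶠ[𝓝 1] fun u => fderiv ℂ f u (Pi.single ⟨i, h⟩ 1) := by
  filter_upwards [hf.eventually_differentiableAt] with u hu using partialD_eq_fderiv h hu

lemma SmoothAtOne.fderiv (hf : SmoothAtOne f) : ContDiffAt ℂ ∞ (fderiv ℂ f) 1 :=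
  ContDiffAt.fderiv_right hf (m := ∞) (by simp)

lemma SmoothAtOne.congr (hf : SmoothAtOne f) (h : g =ᶠ[𝓝 1] f) : SmoothAtOne g :=
  ContDiffAt.congr_of_eventuallyEq hf h

lemma SmoothAtOne.const (c : ℂ) : SmoothAtOne (fun _ : Fin N → ℂ => c) := contDiffAt_const

lemma SmoothAtOne.partialD (hf : SmoothAtOne f) (i : ℕ) : SmoothAtOne (partialD i f) := by
  by_cases h : i < N
  · exact SmoothAtOne.congr (hf.fderiv.clm_apply contDiffAt_const) (hf.partialD_eventuallyEq h)
  · rw [partialD_of_le (not_lt.1 h)]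
    exact SmoothAtOne.const 0

lemma SmoothAtOne.add (hf : SmoothAtOne f) (hg : SmoothAtOne g) : SmoothAtOne (fun u => f u + g u) :=
  ContDiffAt.add hf hg

lemma SmoothAtOne.mul (hf : SmoothAtOne f) (hg : SmoothAtOne g) : SmoothAtOne (fun u => f u * g u) :=
  ContDiffAt.mul hf hg

lemma SmoothAtOne.partialD_add (hf : SmoothAtOne f) (hg : SmoothAtOne g) (i : ℕ) :
    _root_.partialD i (fun u => f u + g u) =ᶠ[𝓝 1] fun u => _root_.partialD i f u + _root_.partialD i g u := by
  by_cases h : i < N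
  · filter_upwards [hf.eventually_differentiableAt, hg.eventually_differentiableAt] with u hu hv
    rw [partialD_eq_fderiv h (hu.fun_add hv), partialD_eq_fderiv h hu, partialD_eq_fderiv h hv,
      fderiv_fun_add hu hv]
    rfl
  · simp [partialD_of_le (not_lt.1 h)]
    rfl

lemma SmoothAtOne.partialD_mul (hf : SmoothAtOne f) (hg : SmoothAtOne g) (i : ℕ) :
    _root_.partialD i (fun u => f u * g u) =ᶠ[𝓝 1]
      fun u => f u * _root_.partialD i g u + _root_.partialD i f u * g u := by
  by_cases h : i < N
  · filter_upwards [hf.eventually_differentiableAt, hg.eventually_differentiableAt] with u hu hv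
    rw [partialD_eq_fderiv h (hu.fun_mul hv), partialD_eq_fderiv h hu, partialD_eq_fderiv h hv,
      fderiv_fun_mul hu hv]
    simp [mul_comm]
  · simp [partialD_of_le (not_lt.1 h)]
    rfl

lemma SmoothAtOne.partialD_comm (hf : SmoothAtOne f) (i j : ℕ) :
    _root_.partialD i (_root_.partialD j f) =ᶠ[𝓝 1] _root_.partialD j (_root_.partialD i f) := by
  by_cases hi : i < N
  swap
  · rw [partialD_of_le (not_lt.1 hi), partialD_of_le (not_lt.1 hi)]
    refine Eventually.of_forall fun u => ?_
    by_cases hj : j < N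
    · rw [partialD_eq_fderiv hj (by exact differentiableAt_const 0)]
      simp
    · rw [partialD_of_le (not_lt.1 hj)]
  by_cases hj : j < N
  swap
  · rw [partialD_of_le (not_lt.1 hj), partialD_of_le (not_lt.1 hj)]
    refine Eventually.of_forall fun u => ?_
    rw [partialD_eq_fderiv hi (by exact differentiableAt_const 0)]
    simp
  have key : ∀ a b (ha : a < N) (hb : b < N), _root_.partialD a (_root_.partialD b f) =ᶠ[𝓝 1]
      fun u => (_root_.fderiv ℂ (_root_.fderiv ℂ f) u (Pi.single ⟨a, ha⟩ 1)) (Pi.single ⟨b, hb⟩ 1) := by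
    intro a b ha hb
    refine (partialD_congr (hf.partialD_eventuallyEq hb)).trans ?_
    have h1 : ContDiffAt ℂ 1 (_root_.fderiv ℂ f) 1 := hf.fderiv.of_le (by exact_mod_cast le_top)
    filter_upwards [h1.eventually (by simp)] with u hu
    have hd := hu.differentiableAt one_ne_zero
    rw [partialD_eq_fderiv ha (hd.clm_apply (differentiableAt_const _)),
      fderiv_clm_apply hd (differentiableAt_const _)]
    simp
  have h2 : ContDiffAt ℂ 2 f 1 := ContDiffAt.of_le hf (by
    rw [show (2 : WithTop ℕ∞) = ((2 : ℕ∞) : WithTop ℕ∞) from rfl]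
    exact_mod_cast le_top)
  filter_upwards [key i j hi hj, key j i hj hi, h2.eventually (by simp)] with u h3 h4 h5
  rw [h3, h4]
  exact (h5.isSymmSndFDerivAt (by simp)) _ _

lemma SmoothAtOne.iterPartialD (hf : SmoothAtOne f) (is : List ℕ) : SmoothAtOne (iterPartialD is f) := by
  induction is with
  | nil => exact hf
  | cons i is ih => exact ih.partialD i

lemma iterPartialD_congr (h : f =ᶠ[𝓝 1] g) (is : List ℕ) :
    iterPartialD is f =ᶠ[𝓝 1] iterPartialD is g := by
  induction is with
  | nil => exact h
  | cons i is ih => exact partialD_congr ih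

lemma SmoothAtOne.iterPartialD_perm (hf : SmoothAtOne f) {is js : List ℕ} (h : is.Perm js) :
    _root_.iterPartialD is f =ᶠ[𝓝 1] _root_.iterPartialD js f := by
  induction h with
  | nil => rfl
  | cons i _ ih => exact partialD_congr ih
  | swap i j l => exact (hf.iterPartialD l).partialD_comm j i
  | trans _ _ h1 h2 => exact h1.trans h2

lemma SmoothAtOne.sum {κ : Type*} (s : Finset κ) {F : κ → (Fin N → ℂ) → ℂ}
    (h : ∀ i ∈ s, SmoothAtOne (F i)) : SmoothAtOne (fun u => ∑ i ∈ s, F i u) :=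
  ContDiffAt.sum h

lemma SmoothAtOne.prod {κ : Type*} (s : Finset κ) {F : κ → (Fin N → ℂ) → ℂ}
    (h : ∀ i ∈ s, SmoothAtOne (F i)) : SmoothAtOne (fun u => ∏ i ∈ s, F i u) := by
  classical
  induction s using Finset.induction_on with
  | empty => simpa using SmoothAtOne.const 1
  | insert a s ha ih =>
    simp only [Finset.prod_insert ha]
    exact (h a (Finset.mem_insert_self _ _)).mul (ih fun i hi => h i (Finset.mem_insert_of_mem hi))

end PartialDerivatives

/-! ### Taylor expansion as a homomorphism from germs to power series. -/

namespace PSeries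

open MvPowerSeries

variable {N : ℕ} {f g : (Fin N → ℂ) → ℂ}

/-- The Taylor expansion at `1` of a smooth germ. -/
noncomputable def taylor (f : (Fin N → ℂ) → ℂ) : PSeries := fun α =>
  iterPartialD (Finsupp.toMultiset α).toList f 1 / ((α.prod fun _ n => n.factorial : ℕ) : ℂ)

lemma coeff_taylor (f : (Fin N → ℂ) → ℂ) (α : ℕ →₀ ℕ) : coeff α (taylor f) =
    iterPartialD (Finsupp.toMultiset α).toList f 1 / ((α.prod fun _ n => n.factorial : ℕ) : ℂ) := rfl

lemma taylor_congr (h : f =ᶠ[𝓝 1] g) : taylor f = taylor g := by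
  ext α
  rw [coeff_taylor, coeff_taylor, (iterPartialD_congr h _).self_of_nhds]

lemma constantCoeff_taylor (f : (Fin N → ℂ) → ℂ) : constantCoeff (taylor f) = f 1 := by
  rw [← coeff_zero_eq_constantCoeff_apply, coeff_taylor]
  simp [iterPartialD]

lemma prod_factorial_add_single (α : ℕ →₀ ℕ) (i : ℕ) :
    ((α + Finsupp.single i 1).prod fun _ n => n.factorial) =
      (α i + 1) * α.prod fun _ n => n.factorial := by
  classical
  have h : ∀ β : ℕ →₀ ℕ, ∀ s : Finset ℕ, β.support ⊆ s → (β.prod fun _ n => n.factorial) =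
      ∏ j ∈ s, (β j).factorial := fun β s hs =>
    Finsupp.prod_of_support_subset _ hs _ (by simp)
  set s := insert i α.support
  have hs : (α + Finsupp.single i 1).support ⊆ s := by
    intro j hj
    by_contra hjs
    simp only [s, Finset.mem_insert, Finsupp.mem_support_iff, not_or, not_not] at hjs
    simp [hjs.2, Finsupp.single_eq_of_ne hjs.1] at hj
  rw [h _ s hs, h α s (Finset.subset_insert _ _),
    ← Finset.mul_prod_erase s _ (Finset.mem_insert_self i _),
    ← Finset.mul_prod_erase s (fun j => (α j).factorial) (Finset.mem_insert_self i _), ← mul_assoc]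
  congr 1
  · simp [Nat.factorial_succ]
  · refine Finset.prod_congr rfl fun j hj => ?_
    simp [Finsupp.single_eq_of_ne (Finset.ne_of_mem_erase hj)]

lemma taylor_partialD (hf : SmoothAtOne f) (i : ℕ) :
    taylor (partialD i f) = pderiv ℂ i (taylor f) := by
  ext α
  rw [coeff_pderiv, coeff_taylor, coeff_taylor, prod_factorial_add_single]
  have h1 : iterPartialD (Finsupp.toMultiset (α + Finsupp.single i 1)).toList f 1 =
      iterPartialD (Finsupp.toMultiset α).toList (partialD i f) 1 := by
    have hp : (Finsupp.toMultiset (α + Finsupp.single i 1)).toList.Perm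
        ((Finsupp.toMultiset α).toList ++ [i]) := by
      rw [← Multiset.coe_eq_coe, Multiset.coe_toList, ← Multiset.coe_add, Multiset.coe_toList]
      simp
    rw [(hf.iterPartialD_perm hp).self_of_nhds]
    simp [iterPartialD]
  rw [h1]
  have h2 : ((α i : ℂ) + 1) ≠ 0 := by exact_mod_cast Nat.succ_ne_zero (α i)
  push_cast
  field_simp

/-- A coefficient of positive degree is recovered from one derivative, so identities between Taylor
expansions follow by induction on the degree from the product rule and the value at `1`. -/
lemma ext_of_pderiv {P Q : PSeries} {α : ℕ →₀ ℕ} {i : ℕ} (hi : α i ≠ 0)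
    (h : coeff (α - Finsupp.single i 1) (pderiv ℂ i P) = coeff (α - Finsupp.single i 1) (pderiv ℂ i Q)) :
    coeff α P = coeff α Q := by
  have h1 : α - Finsupp.single i 1 + Finsupp.single i 1 = α :=
    tsub_add_cancel_of_le (Finsupp.single_le_iff.2 (Nat.one_le_iff_ne_zero.2 hi))
  rw [coeff_pderiv, coeff_pderiv, h1] at h
  refine mul_right_cancel₀ ?_ h
  exact_mod_cast Nat.succ_ne_zero ((α - Finsupp.single i 1 : ℕ →₀ ℕ) i)

lemma degree_sub_single {α : ℕ →₀ ℕ} {i n : ℕ} (hi : α i ≠ 0) (hn : α.degree = n + 1) :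
    (α - Finsupp.single i 1).degree = n := by
  have h1 : α - Finsupp.single i 1 + Finsupp.single i 1 = α :=
    tsub_add_cancel_of_le (Finsupp.single_le_iff.2 (Nat.one_le_iff_ne_zero.2 hi))
  rw [← h1, map_add, Finsupp.degree_single] at hn
  omega

lemma exists_ne_zero_of_degree {α : ℕ →₀ ℕ} {n : ℕ} (hn : α.degree = n + 1) : ∃ i, α i ≠ 0 := by
  by_contra! h
  rw [show α = 0 from Finsupp.ext h] at hn
  simp at hn

lemma eq_zero_of_degree {α : ℕ →₀ ℕ} (hn : α.degree = 0) : α = 0 := by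
  exact (Finsupp.degree_eq_zero_iff α).1 hn

lemma taylor_add (hf : SmoothAtOne f) (hg : SmoothAtOne g) :
    taylor (fun u => f u + g u) = taylor f + taylor g := by
  ext α
  obtain ⟨n, hn⟩ : ∃ n, α.degree = n := ⟨_, rfl⟩
  induction n generalizing α f g with
  | zero =>
    rw [eq_zero_of_degree hn]
    simp [constantCoeff_taylor]
  | succ n ih =>
    obtain ⟨i, hi⟩ := exists_ne_zero_of_degree hn
    apply ext_of_pderiv hi
    rw [← taylor_partialD (hf.add hg), taylor_congr (hf.partialD_add hg i),
      ih (hf.partialD i) (hg.partialD i) _ (degree_sub_single hi hn), map_add (pderiv ℂ i),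
      taylor_partialD hf, taylor_partialD hg]

lemma taylor_mul (hf : SmoothAtOne f) (hg : SmoothAtOne g) :
    taylor (fun u => f u * g u) = taylor f * taylor g := by
  ext α
  obtain ⟨n, hn⟩ : ∃ n, α.degree = n := ⟨_, rfl⟩
  induction n generalizing α f g with
  | zero =>
    rw [eq_zero_of_degree hn]
    simp [constantCoeff_taylor]
  | succ n ih =>
    obtain ⟨i, hi⟩ := exists_ne_zero_of_degree hn
    apply ext_of_pderiv hi
    rw [← taylor_partialD (hf.mul hg), taylor_congr (hf.partialD_mul hg i),
      taylor_add (hf.mul (hg.partialD i)) ((hf.partialD i).mul hg), map_add,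
      ih hf (hg.partialD i) _ (degree_sub_single hi hn),
      ih (hf.partialD i) hg _ (degree_sub_single hi hn), Derivation.leibniz, map_add,
      taylor_partialD hf, taylor_partialD hg, smul_eq_mul, smul_eq_mul, mul_comm (pderiv ℂ i _)]

lemma taylor_const (c : ℂ) : taylor (fun _ : Fin N → ℂ => c) = C c := by
  ext α
  obtain ⟨n, hn⟩ : ∃ n, α.degree = n := ⟨_, rfl⟩
  induction n generalizing α c with
  | zero =>
    rw [eq_zero_of_degree hn]
    simp [constantCoeff_taylor]
  | succ n ih =>
    obtain ⟨i, hi⟩ := exists_ne_zero_of_degree hn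
    apply ext_of_pderiv hi
    have h0 : partialD i (fun _ : Fin N → ℂ => c) = fun _ => 0 := by
      funext u
      by_cases h : i < N
      · rw [partialD_eq_fderiv h (differentiableAt_const c)]
        simp
      · rw [partialD_of_le (not_lt.1 h)]
        rfl
    rw [← taylor_partialD (SmoothAtOne.const c), h0, ih 0 _ (degree_sub_single hi hn)]
    simp

lemma taylor_sum {κ : Type*} (s : Finset κ) {F : κ → (Fin N → ℂ) → ℂ}
    (h : ∀ i ∈ s, SmoothAtOne (F i)) : taylor (fun u => ∑ i ∈ s, F i u) = ∑ i ∈ s, taylor (F i) := by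
  classical
  induction s using Finset.induction_on with
  | empty => simpa using taylor_const (N := N) 0
  | insert a s ha ih =>
    have h1 := fun i hi => h i (Finset.mem_insert_of_mem hi)
    simp only [Finset.sum_insert ha]
    rw [taylor_add (h a (Finset.mem_insert_self _ _)) (SmoothAtOne.sum s h1), ih h1]

lemma taylor_prod {κ : Type*} (s : Finset κ) {F : κ → (Fin N → ℂ) → ℂ}
    (h : ∀ i ∈ s, SmoothAtOne (F i)) : taylor (fun u => ∏ i ∈ s, F i u) = ∏ i ∈ s, taylor (F i) := by
  classical
  induction s using Finset.induction_on with
  | empty => simpa using taylor_const (N := N) 1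
  | insert a s ha ih =>
    have h1 := fun i hi => h i (Finset.mem_insert_of_mem hi)
    simp only [Finset.prod_insert ha]
    rw [taylor_mul (h a (Finset.mem_insert_self _ _)) (SmoothAtOne.prod s h1), ih h1]

lemma smoothAtOne_coord (i : Fin N) : SmoothAtOne (fun u : Fin N → ℂ => u i) :=
  contDiffAt_apply ℂ ℂ i 1

lemma taylor_coord (i : Fin N) : taylor (fun u : Fin N → ℂ => u i) = uvar i := by
  have hpd : ∀ j : ℕ, partialD j (fun u : Fin N → ℂ => u i) = fun _ => if j = i then 1 else 0 := by
    intro j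
    funext u
    by_cases h : j < N
    · have hd : HasFDerivAt (fun u : Fin N → ℂ => u i) (ContinuousLinearMap.proj i) u :=
        (ContinuousLinearMap.proj (R := ℂ) (φ := fun _ : Fin N => ℂ) i).hasFDerivAt
      rw [partialD_eq_fderiv h hd.differentiableAt, hd.fderiv]
      simp [Pi.single_apply, Fin.ext_iff, eq_comm]
    · rw [partialD_of_le (not_lt.1 h), if_neg (fun h' => h (by rw [h']; exact i.2))]
      rfl
  ext α
  obtain ⟨n, hn⟩ : ∃ n, α.degree = n := ⟨_, rfl⟩
  cases n with
  | zero =>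
    rw [eq_zero_of_degree hn]
    simp [constantCoeff_taylor, uvar]
  | succ n =>
    obtain ⟨j, hj⟩ := exists_ne_zero_of_degree hn
    apply ext_of_pderiv hj
    rw [← taylor_partialD (smoothAtOne_coord i), hpd, taylor_const, uvar, map_add,
      Derivation.map_one_eq_zero, zero_add, pderiv_X]
    by_cases h : j = i
    · subst h; simp
    · simp [h, Ne.symm h]

lemma eventually_coord_ne_zero (i : Fin N) : ∀ᶠ u in 𝓝 (1 : Fin N → ℂ), u i ≠ 0 :=
  (continuous_apply i).continuousAt.eventually_ne (by simp)

lemma smoothAtOne_coord_zpow (i : Fin N) (n : ℤ) : SmoothAtOne (fun u : Fin N → ℂ => u i ^ n) := by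
  cases n with
  | ofNat n =>
    simp only [Int.ofNat_eq_natCast, zpow_natCast]
    exact ContDiffAt.pow (smoothAtOne_coord i) n
  | negSucc n =>
    simp only [zpow_negSucc]
    exact ContDiffAt.inv (ContDiffAt.pow (smoothAtOne_coord i) (n + 1)) (by simp)

lemma taylor_coord_pow (i : Fin N) (n : ℕ) : taylor (fun u : Fin N → ℂ => u i ^ n) = uvar i ^ n := by
  have := taylor_prod (Finset.range n) (F := fun _ (u : Fin N → ℂ) => u i) fun _ _ => smoothAtOne_coord i
  simpa [taylor_coord] using this

lemma taylor_coord_zpow (i : Fin N) (n : ℤ) :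
    taylor (fun u : Fin N → ℂ => u i ^ n) = ((uunit i ^ n : PSeriesˣ) : PSeries) := by
  cases n with
  | ofNat n =>
    simp only [Int.ofNat_eq_natCast, zpow_natCast, taylor_coord_pow]
    simp
  | negSucc n =>
    have h1 := taylor_mul (smoothAtOne_coord_zpow i (Int.negSucc n)) (smoothAtOne_coord_zpow i (n + 1 : ℕ))
    have h2 : (fun u : Fin N → ℂ => u i ^ Int.negSucc n * u i ^ ((n + 1 : ℕ) : ℤ)) =ᶠ[𝓝 1] fun _ => 1 := by
      filter_upwards [eventually_coord_ne_zero i] with u hu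
      rw [← zpow_add₀ hu]
      simp [Int.negSucc_eq]
    rw [taylor_congr h2, taylor_const, map_one] at h1
    simp only [zpow_natCast, taylor_coord_pow] at h1
    rw [zpow_negSucc]
    refine (Units.inv_eq_of_mul_eq_one_left ?_).symm
    rw [Units.val_pow_eq_pow_val, coe_uunit]
    exact h1.symm

end PSeries

/-! ### Uniform limits of holomorphic functions of several variables. -/

section UniformLimits

variable {E G : Type} [NormedAddCommGroup E] [NormedSpace ℂ E] [NormedAddCommGroup G]
  [NormedSpace ℂ G] {ι : Type*} {l : Filter ι} {F : ι → E → G} {f : E → G} {c : E} {r : ℝ}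

/-- A Cauchy-type estimate: on a ball of radius `r / 2` around each point of the half-size ball, the
derivative of a difference is controlled by its oscillation. -/
lemma uniformCauchySeqOn_fderiv (hr : 0 < r) (hF : ∀ s, DifferentiableOn ℂ (F s) (Metric.ball c r))
    (h : UniformCauchySeqOn F l (Metric.ball c r)) :
    UniformCauchySeqOn (fun s => fderiv ℂ (F s)) l (Metric.ball c (r / 2)) := by
  intro u hu
  obtain ⟨ε, hε, hεu⟩ := Metric.mem_uniformity_dist.1 hu
  -- Two values below `ε r / 8` give an oscillation of at most `ε r / 4`; divided by the radius `r /
  -- 2` this is `ε / 2 < ε`.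
  have h1 := h _ (Metric.dist_mem_uniformity (show 0 < ε * r / 8 by positivity))
  filter_upwards [h1] with m hm x hx
  apply hεu
  have hsub : Metric.ball x (r / 2) ⊆ Metric.ball c r := by
    apply Metric.ball_subset_ball'
    have := Metric.mem_ball.1 hx
    linarith
  have hxc : x ∈ Metric.ball c r := hsub (Metric.mem_ball_self (by positivity))
  have hd1 := ((hF m.1).differentiableAt (Metric.isOpen_ball.mem_nhds hxc))
  have hd2 := ((hF m.2).differentiableAt (Metric.isOpen_ball.mem_nhds hxc))
  rw [dist_eq_norm, ← fderiv_sub hd1 hd2]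
  have hb := Complex.norm_fderiv_le_div_of_mapsTo_ball (f := F m.1 - F m.2) (c := x) (R₁ := r / 2)
    (R₂ := ε * r / 4) (((hF m.1).sub (hF m.2)).mono hsub) ?_ (by positivity)
  · refine hb.trans_lt ?_
    rw [div_div_eq_mul_div, div_lt_iff₀ hr]
    nlinarith [mul_pos hε hr]
  · intro y hy
    rw [Metric.mem_closedBall, dist_eq_norm]
    have h2 := hm y (hsub hy)
    have h3 := hm x hxc
    simp only [dist_eq_norm] at h2 h3
    calc ‖(F m.1 - F m.2) y - (F m.1 - F m.2) x‖ ≤ ‖F m.1 y - F m.2 y‖ + ‖F m.1 x - F m.2 x‖ :=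
          norm_sub_le _ _
      _ ≤ ε * r / 4 := by linarith

lemma hasFDerivAt_and_tendstoUniformlyOn_fderiv [CompleteSpace G] [l.NeBot] (hr : 0 < r)
    (hF : ∀ s, DifferentiableOn ℂ (F s) (Metric.ball c r))
    (h : TendstoUniformlyOn F f l (Metric.ball c r)) :
    (∀ x ∈ Metric.ball c (r / 2), HasFDerivAt f (fderiv ℂ f x) x) ∧
      TendstoUniformlyOn (fun s => fderiv ℂ (F s)) (fderiv ℂ f) l (Metric.ball c (r / 2)) := by
  have hc := uniformCauchySeqOn_fderiv hr hF h.uniformCauchySeqOn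
  have hex : ∀ x, ∃ L, x ∈ Metric.ball c (r / 2) → Tendsto (fun s => fderiv ℂ (F s) x) l (𝓝 L) := by
    intro x
    by_cases hx : x ∈ Metric.ball c (r / 2)
    · obtain ⟨L, hL⟩ := CompleteSpace.complete (hc.cauchy_map hx)
      exact ⟨L, fun _ => hL⟩
    · exact ⟨0, fun h => absurd h hx⟩
  choose g' hg' using hex
  have hu : TendstoUniformlyOn (fun s => fderiv ℂ (F s)) g' l (Metric.ball c (r / 2)) :=
    hc.tendstoUniformlyOn_of_tendsto fun x hx => hg' x hx
  have hsub : Metric.ball c (r / 2) ⊆ Metric.ball c r := Metric.ball_subset_ball (by linarith)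
  have hd : ∀ x ∈ Metric.ball c (r / 2), HasFDerivAt f (g' x) x := fun x hx =>
    hasFDerivAt_of_tendstoUniformlyOn Metric.isOpen_ball hu
      (fun s y hy => ((hF s).differentiableAt (Metric.isOpen_ball.mem_nhds (hsub hy))).hasFDerivAt)
      (fun y hy => h.tendsto_at (hsub hy)) hx
  refine ⟨fun x hx => by rw [(hd x hx).fderiv]; exact hd x hx, hu.congr_right fun x hx => ?_⟩
  exact (hd x hx).fderiv.symm

end UniformLimits

/-- The derivatives converge uniformly on the half-size ball, so one order of smoothness is gained
per step. The target space has to vary in the induction, since derivatives take values in spaces of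
linear maps. -/
lemma contDiffAt_of_tendstoUniformlyOn {E : Type} [NormedAddCommGroup E] [NormedSpace ℂ E]
    {ι : Type*} {l : Filter ι} [l.NeBot] {c : E} (n : ℕ) :
    ∀ {G : Type} [NormedAddCommGroup G] [NormedSpace ℂ G] [CompleteSpace G] {F : ι → E → G}
      {f : E → G} {r : ℝ}, 0 < r → (∀ s, ContDiffOn ℂ ∞ (F s) (Metric.ball c r)) →
      TendstoUniformlyOn F f l (Metric.ball c r) → ContDiffAt ℂ n f c := by
  induction n with
  | zero =>
    intro G _ _ _ F f r hr hF h
    have h1 := hasFDerivAt_and_tendstoUniformlyOn_fderiv hr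
      (fun s => (hF s).differentiableOn (by simp)) h
    have h2 : ContinuousOn f (Metric.ball c (r / 2)) := fun x hx =>
      (h1.1 x hx).continuousAt.continuousWithinAt
    exact contDiffAt_zero.2 ⟨_, Metric.ball_mem_nhds c (by positivity), h2⟩
  | succ n ih =>
    intro G _ _ _ F f r hr hF h
    have h1 := hasFDerivAt_and_tendstoUniformlyOn_fderiv hr
      (fun s => (hF s).differentiableOn (by simp)) h
    refine contDiffAt_succ_iff_hasFDerivAt.2 ⟨fderiv ℂ f,
      ⟨_, Metric.ball_mem_nhds c (by positivity), h1.1⟩,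
      ih (r := r / 2) (by positivity) (fun s => ?_) h1.2⟩
    exact ((hF s).fderiv_of_isOpen Metric.isOpen_ball (m := ∞) (by simp)).mono
      (Metric.ball_subset_ball (by linarith))

section IteratedPartials

variable {N : ℕ} {ι : Type*} {l : Filter ι} [l.NeBot] {F : ι → (Fin N → ℂ) → ℂ}
  {f : (Fin N → ℂ) → ℂ} {r : ℝ}

lemma smoothAtOne_of_tendstoUniformlyOn (hr : 0 < r)
    (hF : ∀ s, ContDiffOn ℂ ∞ (F s) (Metric.ball 1 r))
    (h : TendstoUniformlyOn F f l (Metric.ball 1 r)) : SmoothAtOne f :=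
  contDiffAt_infty.2 fun n => contDiffAt_of_tendstoUniformlyOn n hr hF h

lemma contDiffOn_partialD {g : (Fin N → ℂ) → ℂ} (hg : ContDiffOn ℂ ∞ g (Metric.ball 1 r)) (i : ℕ) :
    ContDiffOn ℂ ∞ (partialD i g) (Metric.ball 1 r) := by
  by_cases h : i < N
  · refine ((hg.fderiv_of_isOpen Metric.isOpen_ball (m := ∞) (by simp)).clm_apply
      (contDiffOn_const (c := Pi.single ⟨i, h⟩ 1))).congr fun u hu => ?_
    exact partialD_eq_fderiv h
      ((hg.differentiableOn (by simp)).differentiableAt (Metric.isOpen_ball.mem_nhds hu))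
  · rw [partialD_of_le (not_lt.1 h)]
    exact contDiffOn_const

lemma tendstoUniformlyOn_partialD (hr : 0 < r)
    (hF : ∀ s, ContDiffOn ℂ ∞ (F s) (Metric.ball 1 r))
    (h : TendstoUniformlyOn F f l (Metric.ball 1 r)) (i : ℕ) :
    TendstoUniformlyOn (fun s => partialD i (F s)) (partialD i f) l (Metric.ball 1 (r / 2)) := by
  have h1 := hasFDerivAt_and_tendstoUniformlyOn_fderiv hr
    (fun s => (hF s).differentiableOn (by simp)) h
  by_cases hi : i < N
  · have hsub : Metric.ball (1 : Fin N → ℂ) (r / 2) ⊆ Metric.ball 1 r :=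
      Metric.ball_subset_ball (by linarith)
    have h2 : TendstoUniformlyOn (fun s u => fderiv ℂ (F s) u (Pi.single ⟨i, hi⟩ 1))
        (fun u => fderiv ℂ f u (Pi.single ⟨i, hi⟩ 1)) l (Metric.ball 1 (r / 2)) :=
      (ContinuousLinearMap.apply ℂ ℂ (Pi.single ⟨i, hi⟩ 1 : Fin N → ℂ)).uniformContinuous.comp_tendstoUniformlyOn h1.2
    refine (h2.congr (Eventually.of_forall fun s u hu => ?_)).congr_right fun u hu => ?_
    · exact (partialD_eq_fderiv hi (((hF s).differentiableOn (by simp)).differentiableAt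
        (Metric.isOpen_ball.mem_nhds (hsub hu)))).symm
    · exact (partialD_eq_fderiv hi (h1.1 u hu).differentiableAt).symm
  · simp only [partialD_of_le (not_lt.1 hi)]
    exact fun u hu => Eventually.of_forall fun s x _ => refl_mem_uniformity hu

lemma tendsto_iterPartialD_of_tendstoUniformlyOn (hr : 0 < r)
    (hF : ∀ s, ContDiffOn ℂ ∞ (F s) (Metric.ball 1 r))
    (h : TendstoUniformlyOn F f l (Metric.ball 1 r)) (is : List ℕ) :
    Tendsto (fun s => iterPartialD is (F s) 1) l (𝓝 (iterPartialD is f 1)) := by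
  have key : ∃ r' > 0, (∀ s, ContDiffOn ℂ ∞ (iterPartialD is (F s)) (Metric.ball 1 r')) ∧
      TendstoUniformlyOn (fun s => iterPartialD is (F s)) (iterPartialD is f) l (Metric.ball 1 r') := by
    induction is with
    | nil => exact ⟨r, hr, hF, h⟩
    | cons i is ih =>
      obtain ⟨r', hr', h1, h2⟩ := ih
      exact ⟨r' / 2, by positivity, fun s => (contDiffOn_partialD (h1 s) i).mono
        (Metric.ball_subset_ball (by linarith)), tendstoUniformlyOn_partialD hr' h1 h2 i⟩
  obtain ⟨r', hr', -, h2⟩ := key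
  exact h2.tendsto_at (Metric.mem_ball_self hr')

end IteratedPartials

/-! ### Schur functions and Schur generating functions as germs at `1`. -/

namespace PSeries

open MvPowerSeries

variable {N : ℕ}

/-- Uniform convergence of the finite partial sums passes to every iterated partial derivative at
`1`. After this the generating function can be treated purely formally, coefficient by coefficient.
-/
lemma coeffHasSum_taylor {β : Type*} {F : β → (Fin N → ℂ) → ℂ} {U : Set (Fin N → ℂ)}
    (hU : U ∈ 𝓝 1) (h : SummableUniformlyOn F U) {r : ℝ} (hr : 0 < r)
    (hF : ∀ b, ContDiffOn ℂ ∞ (F b) (Metric.ball 1 r)) :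
    SmoothAtOne (fun u => ∑' b, F b u) ∧
      CoeffHasSum (fun b => taylor (F b)) (taylor fun u => ∑' b, F b u) := by
  obtain ⟨r', hr', hsub⟩ := Metric.mem_nhds_iff.1 hU
  set ρ := min r r'
  have hρ : 0 < ρ := lt_min hr hr'
  have hu : TendstoUniformlyOn (fun (s : Finset β) u => ∑ b ∈ s, F b u) (fun u => ∑' b, F b u) atTop
      (Metric.ball 1 ρ) :=
    (hasSumUniformlyOn_iff_tendstoUniformlyOn.1 h.hasSumUniformlyOn).mono
      ((Metric.ball_subset_ball (min_le_right _ _)).trans hsub)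
  have hc : ∀ b, ContDiffOn ℂ ∞ (F b) (Metric.ball 1 ρ) := fun b =>
    (hF b).mono (Metric.ball_subset_ball (min_le_left _ _))
  have hs : ∀ s : Finset β, ContDiffOn ℂ ∞ (fun u => ∑ b ∈ s, F b u) (Metric.ball 1 ρ) := fun s =>
    ContDiffOn.sum fun b _ => hc b
  refine ⟨smoothAtOne_of_tendstoUniformlyOn hρ hs hu, fun α => ?_⟩
  have h1 := tendsto_iterPartialD_of_tendstoUniformlyOn hρ hs hu (Finsupp.toMultiset α).toList
  have h2 := h1.div_const ((α.prod fun _ n => n.factorial : ℕ) : ℂ)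
  refine h2.congr fun s => ?_
  have h3 := taylor_sum s (F := F) fun b _ => (hc b).contDiffAt (Metric.ball_mem_nhds _ hρ)
  rw [← coeff_taylor, h3, map_sum]

/-- The exponents of a signature, `lam_j + N - j` in the customary numbering. -/
def exponents (lam : Signature N) (j : Fin N) : ℤ := lam.1 j + (N : ℤ) - 1 - ((j : ℕ) : ℤ)

lemma exponents_strictAnti (lam : Signature N) : StrictAnti (exponents lam) := by
  intro i j hij
  have h1 := lam.2 hij.le
  have h2 : (i : ℕ) < (j : ℕ) := hij
  unfold exponents
  omega

/-- Divisibility by the Vandermonde product provides a Laurent polynomial that is smooth wherever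
all coordinates are non-zero, including points with equal coordinates. -/
lemma exists_schur_polynomial (l : Fin N → ℤ) : ∃ R : (Fin N → ℂ) → ℂ,
    (∀ u, (∀ i, u i ≠ 0) → ContDiffAt ℂ ∞ R u) ∧ ∀ u, (∀ i, u i ≠ 0) →
      (∏ i : Fin N, ∏ j ∈ Finset.Ioi i, (u i - u j)) * R u =
        (Matrix.of fun i j : Fin N => u i ^ l j).det := by
  obtain ⟨M, hM⟩ : ∃ M : ℕ, ∀ j, 0 ≤ l j + M := by
    refine ⟨∑ j, (l j).natAbs, fun j => ?_⟩
    have := Finset.single_le_sum (f := fun j => (l j).natAbs) (fun _ _ => Nat.zero_le _) (Finset.mem_univ j)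
    have h2 : (((l j).natAbs : ℕ) : ℤ) ≤ ((∑ j, (l j).natAbs : ℕ) : ℤ) := by exact_mod_cast this
    omega
  obtain ⟨Q, hQ⟩ := vandermonde_dvd_det (fun i : Fin N => (MvPolynomial.X i : MvPolynomial (Fin N) ℂ))
    (fun j : Fin N => Polynomial.X ^ (l j + M).toNat)
  refine ⟨fun u => (∏ i, u i ^ (-(M : ℤ))) * MvPolynomial.eval u Q, fun u hu => ?_, fun u hu => ?_⟩
  · refine ContDiffAt.mul ?_ ?_
    · refine contDiffAt_prod fun i _ => ?_
      simp only [zpow_neg, zpow_natCast]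
      exact ((contDiffAt_apply ℂ ℂ i u).pow M).inv (pow_ne_zero _ (hu i))
    · clear hQ
      induction Q using MvPolynomial.induction_on with
      | C a => simpa using contDiffAt_const
      | add p q hp hq => simpa using hp.add hq
      | mul_X p i hp => simpa using hp.mul (contDiffAt_apply ℂ ℂ i u)
  · have h := congrArg (MvPolynomial.eval u) hQ
    rw [RingHom.map_det, map_mul, map_prod] at h
    simp only [map_prod, map_sub, MvPolynomial.eval_X] at h
    dsimp only
    rw [mul_left_comm, ← h, ← Matrix.det_mul_column]
    congr 1
    ext1 i j
    simp only [Matrix.of_apply, RingHom.mapMatrix_apply, Matrix.map_apply, Polynomial.eval_pow,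
      Polynomial.eval_X, map_pow, MvPolynomial.eval_X]
    rw [← zpow_natCast, ← zpow_add₀ (hu i), Int.toNat_of_nonneg (hM j)]
    congr 1
    ring

lemma prod_Ioi_sub_ne_zero {u : Fin N → ℂ} (hu : Function.Injective u) :
    (∏ i : Fin N, ∏ j ∈ Finset.Ioi i, (u i - u j)) ≠ 0 :=
  Finset.prod_ne_zero_iff.2 fun _ _ => Finset.prod_ne_zero_iff.2 fun _ hj =>
    sub_ne_zero.2 (hu.ne (Finset.mem_Ioi.1 hj).ne)

lemma mem_closure_injective (u : Fin N → ℂ) :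
    u ∈ closure {v : Fin N → ℂ | Function.Injective v} := by
  have h1 : Tendsto (fun t : ℂ => u + t • (fun i : Fin N => ((i : ℕ) : ℂ))) (𝓝[≠] 0) (𝓝 u) := by
    have hc : Continuous fun t : ℂ => u + t • (fun i : Fin N => ((i : ℕ) : ℂ)) := by fun_prop
    simpa using (hc.tendsto 0).mono_left nhdsWithin_le_nhds
  refine mem_closure_of_tendsto h1 ?_
  have h2 : ∀ i j : Fin N, i ≠ j → ∀ᶠ t : ℂ in 𝓝[≠] 0, u i + t * (i : ℕ) ≠ u j + t * (j : ℕ) := by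
    intro i j hij
    have hne : ((j : ℕ) : ℂ) - (i : ℕ) ≠ 0 := sub_ne_zero.2 (by
      exact_mod_cast fun h : (j : ℕ) = i => hij (Fin.ext h.symm))
    by_cases h0 : (u i - u j) / (((j : ℕ) : ℂ) - (i : ℕ)) = 0
    · filter_upwards [self_mem_nhdsWithin] with t ht h
      apply ht
      have : t = (u i - u j) / (((j : ℕ) : ℂ) - (i : ℕ)) := by
        rw [eq_div_iff hne]; linear_combination -h
      simpa [h0] using this
    · have h3 : ∀ᶠ t : ℂ in 𝓝[≠] 0, t ≠ (u i - u j) / (((j : ℕ) : ℂ) - (i : ℕ)) :=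
        nhdsWithin_le_nhds (isOpen_ne.mem_nhds (Ne.symm h0))
      filter_upwards [h3] with t ht h
      exact ht (by rw [eq_div_iff hne]; linear_combination -h)
  have h3 : ∀ᶠ t : ℂ in 𝓝[≠] 0, ∀ i j : Fin N, i ≠ j → u i + t * (i : ℕ) ≠ u j + t * (j : ℕ) := by
    simp only [eventually_all]
    exact h2
  filter_upwards [h3] with t ht i j hij
  by_contra hne
  exact ht i j hne (by simpa using hij)

/-- Points with distinct coordinates are dense, and the quotient agrees with the continuous function
`R` there, so the extension by continuity is `R`. -/
lemma rationalSchur_eq (lam : Signature N) {R : (Fin N → ℂ) → ℂ}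
    (hR : ∀ u, (∀ i, u i ≠ 0) → ContDiffAt ℂ ∞ R u)
    (hR' : ∀ u, (∀ i, u i ≠ 0) → (∏ i : Fin N, ∏ j ∈ Finset.Ioi i, (u i - u j)) * R u =
        (Matrix.of fun i j : Fin N => u i ^ exponents lam j).det)
    {u : Fin N → ℂ} (hu : ∀ i, u i ≠ 0) : rationalSchur lam u = R u := by
  refine extendFrom_eq (mem_closure_injective u) ?_
  have h1 : Tendsto R (𝓝[{v | Function.Injective v}] u) (𝓝 (R u)) :=
    ((hR u hu).continuousAt.tendsto).mono_left nhdsWithin_le_nhds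
  refine h1.congr' ?_
  have h2 : ∀ᶠ v in 𝓝 u, ∀ i, v i ≠ 0 := by
    rw [eventually_all]
    exact fun i => (continuous_apply i).continuousAt.eventually_ne (hu i)
  filter_upwards [nhdsWithin_le_nhds h2, self_mem_nhdsWithin] with v hv hinj
  rw [schurRatio, eq_div_iff (prod_Ioi_sub_ne_zero hinj), mul_comm]
  exact hR' v hv

lemma coord_ne_zero_of_mem_ball {u : Fin N → ℂ} (hu : u ∈ Metric.ball 1 1) (i : Fin N) : u i ≠ 0 := by
  intro h
  have h1 := (dist_pi_lt_iff one_pos).1 (Metric.mem_ball.1 hu) i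
  simp [h] at h1

lemma contDiffOn_rationalSchur (lam : Signature N) :
    ContDiffOn ℂ ∞ (rationalSchur lam) (Metric.ball 1 1) := by
  obtain ⟨R, hR, hR'⟩ := exists_schur_polynomial (exponents lam)
  have h1 : ContDiffOn ℂ ∞ R (Metric.ball 1 1) := fun u hu =>
    (hR u (coord_ne_zero_of_mem_ball hu)).contDiffWithinAt
  exact h1.congr fun u hu => rationalSchur_eq lam hR hR' (coord_ne_zero_of_mem_ball hu)

lemma smoothAtOne_rationalSchur (lam : Signature N) : SmoothAtOne (rationalSchur lam) :=
  (contDiffOn_rationalSchur lam).contDiffAt (Metric.ball_mem_nhds _ one_pos)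

lemma taylor_det (l : Fin N → ℤ) :
    taylor (fun u : Fin N → ℂ => (Matrix.of fun i j : Fin N => u i ^ l j).det) = alternant l := by
  have hp : ∀ σ : Equiv.Perm (Fin N), SmoothAtOne fun u : Fin N → ℂ => ∏ i, u (σ i) ^ l i := fun σ =>
    SmoothAtOne.prod _ fun i _ => smoothAtOne_coord_zpow _ _
  simp only [alternant, Matrix.det_apply', Matrix.of_apply]
  rw [taylor_sum _ fun σ _ => (SmoothAtOne.const _).mul (hp σ)]
  refine Finset.sum_congr rfl fun σ _ => ?_
  rw [taylor_mul (SmoothAtOne.const _) (hp σ), taylor_const,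
    taylor_prod _ fun i _ => smoothAtOne_coord_zpow _ _]
  simp [taylor_coord_zpow]

lemma taylor_sub_coord (i j : Fin N) :
    taylor (fun u : Fin N → ℂ => u i - u j) = X (i : ℕ) - X (j : ℕ) := by
  have h : (fun u : Fin N → ℂ => u i - u j) = fun u => u i + (fun _ => (-1 : ℂ)) u * u j := by
    funext u; ring
  rw [h, taylor_add (smoothAtOne_coord i) ((SmoothAtOne.const _).mul (smoothAtOne_coord j)),
    taylor_mul (SmoothAtOne.const _) (smoothAtOne_coord j), taylor_const, taylor_coord, taylor_coord,
    uvar, uvar, map_neg, map_one]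
  ring

lemma taylor_rationalSchur (lam : Signature N) :
    taylor (rationalSchur lam) = schurSeries (exponents lam) := by
  obtain ⟨R, hR, hR'⟩ := exists_schur_polynomial (exponents lam)
  apply mul_left_cancel₀ (vdm_ne_zero N)
  have hsub : ∀ i j : Fin N, SmoothAtOne fun u : Fin N → ℂ => u i - u j := fun i j =>
    ContDiffAt.sub (smoothAtOne_coord i) (smoothAtOne_coord j)
  have hv : taylor (fun u : Fin N → ℂ => ∏ i : Fin N, ∏ j ∈ Finset.Ioi i, (u i - u j)) = vdm N := by
    rw [taylor_prod _ fun i _ => SmoothAtOne.prod _ fun j _ => hsub i j]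
    refine Finset.prod_congr rfl fun i _ => ?_
    rw [taylor_prod _ fun j _ => hsub i j]
    exact Finset.prod_congr rfl fun j _ => taylor_sub_coord i j
  rw [vdm_mul_schurSeries, ← hv, ← taylor_mul
    (SmoothAtOne.prod _ fun i _ => SmoothAtOne.prod _ fun j _ => hsub i j)
    (smoothAtOne_rationalSchur lam), ← taylor_det]
  refine taylor_congr ?_
  filter_upwards [Metric.ball_mem_nhds (1 : Fin N → ℂ) one_pos] with u hu
  rw [rationalSchur_eq lam hR hR' (coord_ne_zero_of_mem_ball hu)]
  exact hR' u (coord_ne_zero_of_mem_ball hu)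

lemma rationalSchur_one (lam : Signature N) :
    rationalSchur lam 1 = constantCoeff (schurSeries (exponents lam)) := by
  rw [← taylor_rationalSchur, constantCoeff_taylor]

lemma rationalSchur_one_ne_zero (lam : Signature N) : rationalSchur lam 1 ≠ 0 := by
  rw [rationalSchur_one]
  exact constantCoeff_schurSeries_ne_zero (exponents_strictAnti lam).injective

lemma schurTerm_eq (ϱ : PMF (Signature N)) (lam : Signature N) : schurTerm ϱ lam =
    fun u => ((ϱ lam).toReal : ℂ) / rationalSchur lam 1 * rationalSchur lam u := by
  funext u
  rw [schurTerm]
  ring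

lemma taylor_schurTerm (ϱ : PMF (Signature N)) (lam : Signature N) : taylor (schurTerm ϱ lam) =
    (((ϱ lam).toReal : ℂ) / rationalSchur lam 1) • schurSeries (exponents lam) := by
  rw [schurTerm_eq, taylor_mul (SmoothAtOne.const _) (smoothAtOne_rationalSchur lam), taylor_const,
    taylor_rationalSchur, smul_eq_C_mul]

lemma hasSum_toReal {β : Type*} (p : PMF β) : HasSum (fun b => (p b).toReal) 1 := by
  have h := ENNReal.hasSum_toReal (f := p) (by rw [p.tsum_coe]; exact ENNReal.one_ne_top)
  rwa [← ENNReal.tsum_toReal_eq p.apply_ne_top, p.tsum_coe, ENNReal.toReal_one] at h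

lemma schurGen_one (ϱ : PMF (Signature N)) : schurGen ϱ 1 = 1 := by
  have h1 : ∀ lam, schurTerm ϱ lam 1 = ((ϱ lam).toReal : ℂ) := fun lam => by
    rw [schurTerm, div_self (rationalSchur_one_ne_zero lam), mul_one]
  simp only [schurGen, h1]
  exact_mod_cast congrArg (Complex.ofReal) (hasSum_toReal ϱ).tsum_eq

/-- The Taylor expansion of the Schur generating function. -/
noncomputable def genSeries (ϱ : PMF (Signature N)) : PSeries := taylor (schurGen ϱ)

lemma constantCoeff_genSeries (ϱ : PMF (Signature N)) : constantCoeff (genSeries ϱ) = 1 := by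
  rw [genSeries, constantCoeff_taylor, schurGen_one]

section Generating

variable {ϱ : PMF (Signature N)} {U : Set (Fin N → ℂ)} (hU : U ∈ 𝓝 1)
  (hS : SummableUniformlyOn (schurTerm ϱ) U)

include hU hS

lemma smooth_and_coeffHasSum : SmoothAtOne (schurGen ϱ) ∧
    CoeffHasSum (fun lam => (((ϱ lam).toReal : ℂ) / rationalSchur lam 1) • schurSeries (exponents lam))
      (genSeries ϱ) := by
  have h := coeffHasSum_taylor hU hS one_pos fun lam => by
    rw [schurTerm_eq]
    exact contDiffOn_const.mul (contDiffOn_rationalSchur lam)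
  simp only [taylor_schurTerm] at h
  exact h

lemma isSym_genSeries : IsSym N (genSeries ϱ) := by
  intro i j hi hj
  have h := (smooth_and_coeffHasSum hU hS).2
  have h1 := h.swapV i j
  have h2 : ∀ lam, swapV i j ((((ϱ lam).toReal : ℂ) / rationalSchur lam 1) • schurSeries (exponents lam)) =
      (((ϱ lam).toReal : ℂ) / rationalSchur lam 1) • schurSeries (exponents lam) := fun lam => by
    rw [map_smul, isSym_schurSeries _ i j hi hj]
  simp only [h2] at h1
  ext α
  exact (h1 α).unique (h α)

lemma hasSum_ppMoment (hN : 0 < N) (k : ℕ) :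
    HasSum (fun lam => (((ϱ lam).toReal * ppMoment 1 (exponents lam) k : ℝ) : ℂ))
      (((N : ℂ) ^ k)⁻¹ * constantCoeff ((lowOp N)^[k] (genSeries ϱ))) := by
  have hne : (N : ℂ) ≠ 0 := by exact_mod_cast hN.ne'
  have h := (((smooth_and_coeffHasSum hU hS).2.iterate_lowOp N k).constantCoeff).mul_left ((N : ℂ) ^ k)⁻¹
  refine h.congr_fun fun lam => ?_
  rw [← Module.End.pow_apply, map_smul, ← coeff_zero_eq_constantCoeff_apply, map_smul,
    coeff_zero_eq_constantCoeff_apply, Module.End.pow_apply, constantCoeff_lowOp_schurSeries hN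
    (exponents_strictAnti lam).injective, ← rationalSchur_one]
  have := rationalSchur_one_ne_zero lam
  push_cast
  rw [smul_eq_mul]
  field_simp

lemma hasSum_shiftedMoment (hN : 0 < N) (k k' : ℕ) :
    HasSum (fun lam => (((ϱ lam).toReal * shiftedMoment (exponents lam) k k' : ℝ) : ℂ))
      (((N : ℂ) ^ (k + k' + 1))⁻¹ * constantCoeff ((lowOp N)^[k'] (shiftOp N k (genSeries ϱ)))) := by
  have hne : (N : ℂ) ≠ 0 := by exact_mod_cast hN.ne'
  have h := ((((smooth_and_coeffHasSum hU hS).2.shiftOp N k).iterate_lowOp N k').constantCoeff).mul_left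
    ((N : ℂ) ^ (k + k' + 1))⁻¹
  refine h.congr_fun fun lam => ?_
  rw [map_smul, ← Module.End.pow_apply, map_smul, ← coeff_zero_eq_constantCoeff_apply, map_smul,
    coeff_zero_eq_constantCoeff_apply, Module.End.pow_apply, constantCoeff_lowOp_shiftOp_schurSeries hN
    (exponents_strictAnti lam).injective, ← rationalSchur_one]
  have := rationalSchur_one_ne_zero lam
  push_cast
  rw [smul_eq_mul]
  field_simp

lemma smoothAtOne_logSchurGen : SmoothAtOne (logSchurGen ϱ) := by
  refine contDiffAt_const.mul
    ((Complex.contDiffAt_log ?_).comp 1 (smooth_and_coeffHasSum hU hS).1)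
  rw [schurGen_one]
  exact Complex.one_mem_slitPlane

/-- The chain rule for the logarithm, valid near `1` because the generating function equals one
there and so stays in the slit plane. -/
lemma pderiv_genSeries (hN : 0 < N) (i : ℕ) :
    pderiv ℂ i (genSeries ϱ) = (N : ℂ) • (pderiv ℂ i (taylor (logSchurGen ϱ)) * genSeries ϱ) := by
  have hne : (N : ℂ) ≠ 0 := by exact_mod_cast hN.ne'
  have hsm := (smooth_and_coeffHasSum hU hS).1
  have hL := smoothAtOne_logSchurGen hU hS
  rw [genSeries, ← taylor_partialD hsm, ← taylor_partialD hL, ← taylor_mul (hL.partialD i) hsm,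
    smul_eq_C_mul, ← taylor_const (N := N), ← taylor_mul (SmoothAtOne.const _) ((hL.partialD i).mul hsm)]
  refine taylor_congr ?_
  by_cases hi : i < N
  swap
  · rw [partialD_of_le (not_lt.1 hi), partialD_of_le (not_lt.1 hi)]
    simp
    rfl
  have hslit : ∀ᶠ u in 𝓝 (1 : Fin N → ℂ), schurGen ϱ u ∈ Complex.slitPlane :=
    hsm.continuousAt.eventually (Complex.isOpen_slitPlane.mem_nhds (by
      rw [schurGen_one]; exact Complex.one_mem_slitPlane))
  filter_upwards [hsm.eventually_differentiableAt, hL.eventually_differentiableAt, hslit] with u h1 h2 h3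
  rw [partialD_eq_fderiv hi h1, partialD_eq_fderiv hi h2]
  have hd : HasFDerivAt (logSchurGen ϱ) ((1 / (N : ℂ)) • ((schurGen ϱ u)⁻¹ • fderiv ℂ (schurGen ϱ) u)) u :=
    (h1.hasFDerivAt.clog h3).const_mul _
  rw [hd.fderiv]
  have := Complex.slitPlane_ne_zero h3
  simp only [smul_apply, smul_eq_mul]
  field_simp

/-- Symmetry of the logarithmic derivative follows from that of the generating series by cancelling
the latter in an integral domain; the logarithm itself need not be permuted. -/
lemma isSymRest_pderiv_log : IsSymRest N (pderiv ℂ 0 (taylor (logSchurGen ϱ))) := by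
  intro i j hi hiN hj hjN
  have hN : 0 < N := by omega
  have hne : (N : ℂ) ≠ 0 := by exact_mod_cast hN.ne'
  have hsym := isSym_genSeries hU hS
  have h0 : genSeries ϱ ≠ 0 := fun h => by
    have := constantCoeff_genSeries ϱ
    simp [h] at this
  have hp := pderiv_genSeries hU hS hN 0
  have h1 := congrArg (swapV i j) hp
  rw [map_smul, map_mul, hsym i j hiN hjN, swapV_pderiv, hsym i j hiN hjN,
    Equiv.swap_apply_of_ne_of_ne (by omega) (by omega), hp] at h1
  exact (mul_right_cancel₀ h0 (smul_right_injective _ hne h1)).symm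

end Generating

end PSeries

/-! ### Convergence of expected moments under the hypotheses of the theorem. -/

namespace PSeries

open MvPowerSeries

/-- The Taylor expansion at `1` of `Ψ'`. -/
noncomputable def derivSeries (a : ℕ → ℝ) : PowerSeries ℂ :=
  PowerSeries.mk fun n => (a (n + 1) : ℂ) / (n.factorial : ℂ)

section Limit

variable {ϱ : ∀ N : ℕ, PMF (Signature N)} {a : ℕ → ℝ}

/-- Coefficients at pure powers of `X 0` see only repeated derivatives in one variable. At any other
exponent the extra derivative in the variable `0` brings the number of distinct indices to at least
two, so the mixed hypothesis applies. -/
lemma tendsto_coeff_pderiv_log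
    (ha : ∀ i k : ℕ, 1 ≤ k →
      Tendsto (fun N : ℕ => iterPartialD (List.replicate k i) (logSchurGen (ϱ N)) 1)
        atTop (𝓝 (a k : ℂ)))
    (hmix : ∀ is : List ℕ, 2 ≤ is.toFinset.card →
      Tendsto (fun N : ℕ => iterPartialD is (logSchurGen (ϱ N)) 1) atTop (𝓝 0)) (α : ℕ →₀ ℕ) :
    Tendsto (fun N => coeff α (pderiv ℂ 0 (taylor (logSchurGen (ϱ N))))) atTop
      (𝓝 (coeff α (iota (derivSeries a)))) := by
  classical
  simp only [coeff_pderiv, coeff_taylor]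
  rcases eq_single_or_exists α with h | ⟨j, hj, hα⟩
  · obtain ⟨n, rfl⟩ : ∃ n, α = Finsupp.single 0 n := ⟨_, h⟩
    have hl : (Finsupp.toMultiset (Finsupp.single 0 n + Finsupp.single 0 1)).toList =
        List.replicate (n + 1) 0 := by
      rw [← Finsupp.single_add, Finsupp.toMultiset_single, Multiset.nsmul_singleton]
      exact List.perm_replicate.1
        (Multiset.coe_eq_coe.1 ((Multiset.coe_toList _).trans (Multiset.coe_replicate _ _).symm))
    rw [hl, coeff_iota_single, derivSeries, PowerSeries.coeff_mk, ← Finsupp.single_add,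
      Finsupp.prod_single_index (by simp)]
    have h1 := ((ha 0 (n + 1) (by omega)).div_const (((n + 1).factorial : ℕ) : ℂ)).mul_const ((n : ℂ) + 1)
    have h2 : (n : ℂ) + 1 ≠ 0 := by exact_mod_cast Nat.succ_ne_zero n
    convert h1 using 2
    · simp
    · rw [Nat.factorial_succ]
      push_cast
      have := Nat.factorial_ne_zero n
      field_simp
  · rw [coeff_iota_of_ne hj hα]
    have hc : 2 ≤ (Finsupp.toMultiset (α + Finsupp.single 0 1)).toList.toFinset.card := by
      have hsub : ({0, j} : Finset ℕ) ⊆ (Finsupp.toMultiset (α + Finsupp.single 0 1)).toList.toFinset := by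
        intro x hx
        rw [List.mem_toFinset, Multiset.mem_toList, Finsupp.mem_toMultiset, Finsupp.mem_support_iff]
        simp only [Finset.mem_insert, Finset.mem_singleton] at hx
        rcases hx with rfl | rfl
        · simp
        · simp [hα]
      calc 2 = ({0, j} : Finset ℕ).card := (Finset.card_pair hj.symm).symm
        _ ≤ _ := Finset.card_le_card hsub
    have h1 := ((hmix _ hc).div_const
      (((α + Finsupp.single 0 1).prod fun _ n => n.factorial : ℕ) : ℂ)).mul_const ((α 0 : ℂ) + 1)
    simpa using h1

/-- The moments of the limit measure for `q = 1`. -/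
noncomputable def baseMoment (a : ℕ → ℝ) (k : ℕ) : ℝ :=
  (PowerSeries.constantCoeff ((limOp (derivSeries a))^[k] 1)).re

variable (hS : ∀ N : ℕ, ∃ U ∈ 𝓝 (1 : Fin N → ℂ), SummableUniformlyOn (schurTerm (ϱ N)) U)

include hS

lemma isSymRest_log (N : ℕ) : IsSymRest N (pderiv ℂ 0 (taylor (logSchurGen (ϱ N)))) := by
  obtain ⟨U, hU, h⟩ := hS N
  exact isSymRest_pderiv_log hU h

lemma isSym_gen (N : ℕ) : IsSym N (genSeries (ϱ N)) := by
  obtain ⟨U, hU, h⟩ := hS N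
  exact isSym_genSeries hU h

variable (ha : ∀ i k : ℕ, 1 ≤ k →
      Tendsto (fun N : ℕ => iterPartialD (List.replicate k i) (logSchurGen (ϱ N)) 1)
        atTop (𝓝 (a k : ℂ)))
    (hmix : ∀ is : List ℕ, 2 ≤ is.toFinset.card →
      Tendsto (fun N : ℕ => iterPartialD is (logSchurGen (ϱ N)) 1) atTop (𝓝 0))

include ha hmix

lemma tame_log : Tame (fun N => eulerD 0 (taylor (logSchurGen (ϱ N))))
    ((1 + PowerSeries.X) * derivSeries a) := by
  have h1 : Tame (fun N => pderiv ℂ 0 (taylor (logSchurGen (ϱ N)))) (derivSeries a) :=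
    ⟨isSymRest_log hS, tendsto_coeff_pderiv_log ha hmix⟩
  have h2 := (Tame.const (1 + PowerSeries.X)).mul h1
  simpa only [iota_one_add_X, eulerD_apply] using h2

omit ha hmix in
lemma eulerD_gen (N : ℕ) (hN : 0 < N) : eulerD 0 (genSeries (ϱ N)) =
    (N : ℂ) • (eulerD 0 (taylor (logSchurGen (ϱ N))) * genSeries (ϱ N)) := by
  obtain ⟨U, hU, h⟩ := hS N
  rw [eulerD_apply, eulerD_apply, pderiv_genSeries hU h hN, mul_smul_comm, mul_assoc]

theorem tendsto_expectation_complex (k : ℕ) :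
    Tendsto (fun N => ((∑' lam, ((ϱ N) lam).toReal * ppMoment 1 (exponents lam) k : ℝ) : ℂ)) atTop
      (𝓝 (PowerSeries.constantCoeff ((limOp (derivSeries a))^[k] 1))) := by
  refine (tendsto_constantCoeff_lowOp (isSym_gen hS) (fun N => constantCoeff_genSeries (ϱ N))
    (eulerD_gen hS) (tame_log hS ha hmix) k).congr' ?_
  filter_upwards [eventually_gt_atTop 0] with N hN
  obtain ⟨U, hU, h⟩ := hS N
  rw [Complex.ofReal_tsum]
  exact (hasSum_ppMoment hU h hN k).tsum_eq.symm

theorem tendsto_shifted_expectation_complex (k k' : ℕ) :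
    Tendsto (fun N => ((∑' lam, ((ϱ N) lam).toReal * shiftedMoment (exponents lam) k k' : ℝ) : ℂ)) atTop
      (𝓝 (PowerSeries.constantCoeff ((limOp (derivSeries a))^[k] 1) *
        PowerSeries.constantCoeff ((limOp (derivSeries a))^[k'] 1))) := by
  refine (tendsto_constantCoeff_lowOp_shiftOp (isSym_gen hS) (fun N => constantCoeff_genSeries (ϱ N))
    (eulerD_gen hS) (tame_log hS ha hmix) k k').congr' ?_
  filter_upwards [eventually_gt_atTop 0] with N hN
  obtain ⟨U, hU, h⟩ := hS N
  rw [Complex.ofReal_tsum]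
  exact (hasSum_shiftedMoment hU h hN k k').tsum_eq.symm

/-- Limits of real expectations are real, so nothing is lost by the real part in `baseMoment`. -/
lemma ofReal_baseMoment (k : ℕ) :
    (baseMoment a k : ℂ) = PowerSeries.constantCoeff ((limOp (derivSeries a))^[k] 1) := by
  have h := (Complex.continuous_im.tendsto _).comp (tendsto_expectation_complex hS ha hmix k)
  have h0 := tendsto_nhds_unique h (tendsto_const_nhds.congr fun N => (Complex.ofReal_im _).symm)
  exact Complex.ext (Complex.ofReal_re _) (by rw [Complex.ofReal_im]; exact h0.symm)

theorem tendsto_expectation (k : ℕ) :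
    Tendsto (fun N => ∑' lam, ((ϱ N) lam).toReal * ppMoment 1 (exponents lam) k) atTop
      (𝓝 (baseMoment a k)) := by
  have h := tendsto_expectation_complex hS ha hmix k
  rw [← ofReal_baseMoment hS ha hmix] at h
  exact (Complex.continuous_re.tendsto _).comp h

theorem tendsto_shifted_expectation (k k' : ℕ) :
    Tendsto (fun N => ∑' lam, ((ϱ N) lam).toReal * shiftedMoment (exponents lam) k k') atTop
      (𝓝 (baseMoment a k * baseMoment a k')) := by
  have h := tendsto_shifted_expectation_complex hS ha hmix k k'
  rw [← ofReal_baseMoment hS ha hmix, ← ofReal_baseMoment hS ha hmix, ← Complex.ofReal_mul] at h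
  exact (Complex.continuous_re.tendsto _).comp h

omit ha hmix

lemma summable_expectation {N : ℕ} (hN : 0 < N) (k : ℕ) :
    Summable fun lam => ((ϱ N) lam).toReal * ppMoment 1 (exponents lam) k := by
  obtain ⟨U, hU, h⟩ := hS N
  exact Complex.summable_ofReal.1 (hasSum_ppMoment hU h hN k).summable

lemma summable_shifted_expectation {N : ℕ} (hN : 0 < N) (k k' : ℕ) :
    Summable fun lam => ((ϱ N) lam).toReal * shiftedMoment (exponents lam) k k' := by
  obtain ⟨U, hU, h⟩ := hS N
  exact Complex.summable_ofReal.1 (hasSum_shiftedMoment hU h hN k k').summable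

end Limit

end PSeries

/-! ### Partial fractions for a translated root polynomial. -/

section Lagrange

variable {N : ℕ} {x : Fin N → ℝ} (h : ℝ)

/-- Lagrange interpolation: after cancellation of the leading terms both sides have degree below
`N`, and at `z = x p` both reduce to `-h ∏_{j ≠ p} (x p - x j - h)`. -/
lemma prod_sub_shift (hx : Function.Injective x) (z : ℝ) : ∏ j, (z - (x j + h)) =
    ∏ j, (z - x j) - h * ∑ p, stepWeight h x p * ∏ j ∈ Finset.univ.erase p, (z - x j) := by
  classical
  set P : Polynomial ℝ := ∏ j, (Polynomial.X - Polynomial.C (x j + h))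
  set Q : Polynomial ℝ := ∏ j, (Polynomial.X - Polynomial.C (x j))
  set T : Polynomial ℝ := ∑ p, Polynomial.C (stepWeight h x p) *
    ∏ j ∈ Finset.univ.erase p, (Polynomial.X - Polynomial.C (x j))
  have hPm : P.Monic := Polynomial.monic_prod_of_monic _ _ fun j _ => Polynomial.monic_X_sub_C _
  have hQm : Q.Monic := Polynomial.monic_prod_of_monic _ _ fun j _ => Polynomial.monic_X_sub_C _
  have hdeg : ∀ y : Fin N → ℝ, (∏ j, (Polynomial.X - Polynomial.C (y j))).degree = (N : WithBot ℕ) := by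
    intro y
    rw [Polynomial.degree_prod]
    simp
  have hT : T.degree < (Finset.univ : Finset (Fin N)).card := by
    rw [Polynomial.degree_lt_iff_coeff_zero]
    intro m hm
    rw [Polynomial.finsetSum_coeff]
    refine Finset.sum_eq_zero fun p _ => ?_
    rw [Polynomial.coeff_C_mul, Polynomial.coeff_eq_zero_of_degree_lt, mul_zero]
    rw [Polynomial.degree_prod]
    simp only [Polynomial.degree_X_sub_C, Finset.sum_const, Finset.mem_univ, Finset.card_erase_of_mem,
      Finset.card_univ, Fintype.card_fin, nsmul_eq_mul, mul_one] at hm ⊢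
    have := Fin.pos p
    exact_mod_cast (by omega : N - 1 < m)
  have hPQ : (P - Q).degree < (Finset.univ : Finset (Fin N)).card := by
    have h1 := Polynomial.degree_sub_lt_left (p := P) (q := Q) (by rw [hdeg, hdeg]) hPm.ne_zero
      (by rw [hPm.leadingCoeff, hQm.leadingCoeff])
    rwa [hdeg, ← Fintype.card_fin N, ← Finset.card_univ] at h1
  have key : P = Q - Polynomial.C h * T := by
    refine Polynomial.eq_of_degree_sub_lt_of_eval_index_eq (s := Finset.univ) (v := x) hx.injOn ?_ ?_
    · rw [← sub_add]
      refine lt_of_le_of_lt (Polynomial.degree_add_le _ _) (max_lt hPQ ?_)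
      rw [← Polynomial.smul_eq_C_mul]
      exact lt_of_le_of_lt (Polynomial.degree_smul_le _ _) hT
    · intro p _
      simp only [P, Q, T, Polynomial.eval_prod, Polynomial.eval_sub, Polynomial.eval_X,
        Polynomial.eval_C, Polynomial.eval_mul, Polynomial.eval_finsetSum]
      rw [Finset.prod_eq_zero (f := fun j => x p - x j) (Finset.mem_univ p) (sub_self (x p)),
        Finset.sum_eq_single p,
        stepWeight, ← Finset.prod_mul_distrib, ← Finset.mul_prod_erase Finset.univ _ (Finset.mem_univ p)]
      · have h2 : ∏ j ∈ Finset.univ.erase p, ((x p - x j - h) / (x p - x j) * (x p - x j)) =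
            ∏ j ∈ Finset.univ.erase p, (x p - (x j + h)) := by
          refine Finset.prod_congr rfl fun j hj => ?_
          have : x p - x j ≠ 0 := sub_ne_zero.2 (hx.ne (Finset.ne_of_mem_erase hj).symm)
          rw [div_mul_cancel₀ _ this]
          ring
        rw [h2]
        ring
      · intro r _ hr
        rw [Finset.prod_eq_zero (Finset.mem_erase.2 ⟨hr.symm, Finset.mem_univ p⟩) (sub_self (x p)),
          mul_zero]
      · simp
  have := congrArg (Polynomial.eval z) key
  simpa only [P, Q, T, Polynomial.eval_prod, Polynomial.eval_sub, Polynomial.eval_X,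
        Polynomial.eval_C, Polynomial.eval_mul, Polynomial.eval_finsetSum] using this

/-- The reversed form of `prod_sub_shift`, at `z = t⁻¹`; it is suited to expansion in powers of `t`.
-/
lemma prod_one_sub_shift (hx : Function.Injective x) (t : ℝ) : ∏ j, (1 - (x j + h) * t) =
    ∏ j, (1 - x j * t) -
      h * t * ∑ p, stepWeight h x p * ∏ j ∈ Finset.univ.erase p, (1 - x j * t) := by
  rcases eq_or_ne t 0 with rfl | ht
  · simp
  have h1 : ∀ (s : Finset (Fin N)) (y : Fin N → ℝ), ∏ j ∈ s, (1 - y j * t) =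
      t ^ s.card * ∏ j ∈ s, (t⁻¹ - y j) := fun s y => by
    rw [← Finset.prod_const, ← Finset.prod_mul_distrib]
    refine Finset.prod_congr rfl fun j _ => ?_
    field_simp
  have h2 : ∀ p, stepWeight h x p * ∏ j ∈ Finset.univ.erase p, (1 - x j * t) =
      t ^ (N - 1) * (stepWeight h x p * ∏ j ∈ Finset.univ.erase p, (t⁻¹ - x j)) := fun p => by
    rw [h1, Finset.card_erase_of_mem (Finset.mem_univ p), Finset.card_univ, Fintype.card_fin]
    ring
  rw [h1, h1, Finset.sum_congr rfl fun p _ => h2 p, ← Finset.mul_sum, prod_sub_shift h hx]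
  rcases Nat.eq_zero_or_pos N with rfl | hN
  · simp
  rw [Finset.card_univ, Fintype.card_fin]
  have h3 : t ^ N = t * t ^ (N - 1) := by rw [← pow_succ', Nat.sub_add_cancel hN]
  rw [h3]
  ring

end Lagrange

/-! ### Moment series, Vieta products and power means. -/

section MomentSeries

open PowerSeries

/-- The geometric series `1 / (1 - y t)`. -/
noncomputable def geom (y : ℝ) : PowerSeries ℝ := PowerSeries.mk fun n => y ^ n

lemma geom_mul (y : ℝ) : geom y * (1 - C y * X) = 1 := by
  ext n
  cases n with
  | zero => simp [geom, mul_sub, ← mul_assoc]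
  | succ n => simp [geom, mul_sub, ← mul_assoc, coeff_succ_mul_X, pow_succ, coeff_one]

lemma one_sub_C_mul_X_ne_zero (y : ℝ) : (1 - C y * X : PowerSeries ℝ) ≠ 0 := by
  intro h
  have := geom_mul y
  simp [h] at this

variable {N : ℕ} {x : Fin N → ℝ}

/-- The product `∏_j (1 - x_j t)`. -/
noncomputable def vieta (x : Fin N → ℝ) : PowerSeries ℝ := ∏ j, (1 - C (x j) * X)

lemma vieta_ne_zero (x : Fin N → ℝ) : vieta x ≠ 0 :=
  Finset.prod_ne_zero_iff.2 fun _ _ => one_sub_C_mul_X_ne_zero _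

lemma vieta_add_const (hx : Function.Injective x) (h : ℝ) : vieta (fun j => x j + h) =
    (1 - C h * X * PowerSeries.mk fun k => ∑ p, stepWeight h x p * x p ^ k) * vieta x := by
  classical
  have hpoly : (∏ j, (1 - Polynomial.C (x j + h) * Polynomial.X) : Polynomial ℝ) =
      ∏ j, (1 - Polynomial.C (x j) * Polynomial.X) - Polynomial.C h * Polynomial.X *
        ∑ p, Polynomial.C (stepWeight h x p) *
          ∏ j ∈ Finset.univ.erase p, (1 - Polynomial.C (x j) * Polynomial.X) := by
    refine Polynomial.funext fun t => ?_
    simpa only [Polynomial.eval_prod, Polynomial.eval_sub, Polynomial.eval_X, Polynomial.eval_one,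
        Polynomial.eval_C, Polynomial.eval_mul, Polynomial.eval_finsetSum] using prod_one_sub_shift h hx t
  have h1 := congrArg (Polynomial.coeToPowerSeries.ringHom (R := ℝ)) hpoly
  simp only [map_prod, map_sub, map_one, map_mul, map_sum,
    Polynomial.coeToPowerSeries.ringHom_apply, Polynomial.coe_C, Polynomial.coe_X] at h1
  have h2 : (PowerSeries.mk fun k => ∑ p, stepWeight h x p * x p ^ k) =
      ∑ p, C (stepWeight h x p) * geom (x p) := by
    ext k
    simp [geom]
  rw [vieta, h1, vieta, h2, sub_mul, one_mul, mul_assoc (C h * X) _ (∏ j, _), Finset.sum_mul]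
  congr 2
  refine Finset.sum_congr rfl fun p _ => ?_
  rw [← Finset.mul_prod_erase Finset.univ _ (Finset.mem_univ p), mul_assoc, ← mul_assoc (geom (x p)),
    geom_mul, one_mul]

/-- The moment series of the `q`-deformed Perelomov–Popov measure. -/
noncomputable def ppSeries (q : ℝ) (l : Fin N → ℤ) : PowerSeries ℝ := PowerSeries.mk (ppMoment q l)

/-- All deformations are tied together here: the `q`-moment series is the ratio of two root
products, the roots in one being translated by `q / N`. -/
lemma vieta_scaled {l : Fin N → ℤ} (hl : Function.Injective l) (q : ℝ) :
    vieta (fun j => scaled l j + q / N) = (1 - C q * X * ppSeries q l) * vieta (scaled l) := by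
  rw [vieta_add_const (scaled_injective hl)]
  congr 2
  ext n
  rcases n with _ | n
  · simp
  · rw [mul_assoc, mul_assoc, coeff_C_mul, coeff_C_mul, mul_comm X, mul_comm X, coeff_succ_mul_X,
      coeff_succ_mul_X, ppSeries, coeff_mk, coeff_mk, ppMoment]
    ring

/-- Total mass one follows from the coefficient of `t`: translating `N` roots by `q / N` changes
their sum by `q`. Division by `q` excludes `q = 0`. -/
lemma ppMoment_zero (hN : 0 < N) {l : Fin N → ℤ} (hl : Function.Injective l) {q : ℝ} (hq : q ≠ 0) :
    ppMoment q l 0 = 1 := by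
  have hne : (N : ℝ) ≠ 0 := by exact_mod_cast hN.ne'
  have hv : ∀ y : Fin N → ℝ, constantCoeff (vieta y) = 1 ∧ coeff 1 (vieta y) = -∑ j, y j := by
    intro y
    have h0 : ∀ s : Finset (Fin N), constantCoeff (∏ j ∈ s, (1 - C (y j) * X)) = 1 ∧
        coeff 1 (∏ j ∈ s, (1 - C (y j) * X)) = -∑ j ∈ s, y j := by
      classical
      intro s
      induction s using Finset.induction_on with
      | empty => simp [coeff_one]
      | insert a s ha ih =>
        rw [Finset.prod_insert ha, Finset.sum_insert ha, sub_mul, one_mul, mul_assoc]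
        refine ⟨by simp [ih.1], ?_⟩
        rw [map_sub, ih.2, coeff_C_mul, mul_comm X, show (1 : ℕ) = 0 + 1 from rfl, coeff_succ_mul_X,
          coeff_zero_eq_constantCoeff_apply, ih.1]
        ring
    exact h0 Finset.univ
  have h := congrArg (coeff 1) (vieta_scaled hl q)
  rw [(hv _).2, sub_mul, one_mul, map_sub, (hv _).2, mul_assoc, mul_assoc, coeff_C_mul, mul_comm X,
    show (1 : ℕ) = 0 + 1 from rfl, coeff_succ_mul_X, coeff_zero_eq_constantCoeff_apply, map_mul,
    (hv _).1, ppSeries, ← coeff_zero_eq_constantCoeff_apply, coeff_mk, Finset.sum_add_distrib] at h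
  simp only [Finset.sum_const, Finset.card_univ, Fintype.card_fin, nsmul_eq_mul] at h
  have h2 : q * ppMoment q l 0 = q * 1 := by
    rw [mul_div_cancel₀ _ hne] at h
    linarith
  exact mul_left_cancel₀ hq h2

/-- The normalised power sums. -/
noncomputable def powerMean (l : Fin N → ℤ) (r : ℕ) : ℝ := (N : ℝ)⁻¹ * ∑ j, scaled l j ^ r

/-- The difference quotients of the power sums. -/
noncomputable def diffMean (q : ℝ) (l : Fin N → ℤ) (n : ℕ) : ℝ :=
  ∑ r ∈ Finset.range n, (n.choose r : ℝ) * (q / N) ^ (n - 1 - r) * powerMean l r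

lemma derivative_vieta (y : Fin N → ℝ) : d⁄dX ℝ (vieta y) =
    -vieta y * PowerSeries.mk fun n => ∑ j, y j ^ (n + 1) := by
  classical
  have h0 : ∀ s : Finset (Fin N), d⁄dX ℝ (∏ j ∈ s, (1 - C (y j) * X)) =
      -(∏ j ∈ s, (1 - C (y j) * X)) * PowerSeries.mk fun n => ∑ j ∈ s, y j ^ (n + 1) := by
    intro s
    induction s using Finset.induction_on with
    | empty => 
      simp only [Finset.prod_empty, Finset.sum_empty, Derivation.map_one_eq_zero]
      ext n; simp
    | insert a s ha ih =>
      have h1 : (PowerSeries.mk fun n => ∑ j ∈ insert a s, y j ^ (n + 1)) =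
          C (y a) * geom (y a) + PowerSeries.mk fun n => ∑ j ∈ s, y j ^ (n + 1) := by
        ext n
        simp [geom, Finset.sum_insert ha, pow_succ']
      have h2 : d⁄dX ℝ (1 - C (y a) * X) = -C (y a) := by
        rw [map_sub, Derivation.map_one_eq_zero, Derivation.leibniz, derivative_X, derivative_C]
        simp
      rw [Finset.prod_insert ha, Derivation.leibniz, ih, h1, h2, smul_eq_mul, smul_eq_mul]
      have h3 := geom_mul (y a)
      linear_combination (C (y a)) * (∏ j ∈ s, (1 - C (y j) * X)) * h3
  exact h0 Finset.univ

/-- Coefficient extraction from `F' = -F D`, where `F = 1 - q t M_q(t)` and `D` collects the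
differences `(x_j + q / N) ^ (n + 1) - x_j ^ (n + 1)` of power sums. Expanding these binomially
produces a factor `q / N`, hence the normalisation in `diffMean`. -/
theorem ppMoment_recursion (hN : 0 < N) {l : Fin N → ℤ} (hl : Function.Injective l) {q : ℝ}
    (hq : q ≠ 0) (k : ℕ) : ((k : ℝ) + 1) * ppMoment q l k = diffMean q l (k + 1) -
      q * ∑ b ∈ Finset.range k, ppMoment q l b * diffMean q l (k - b) := by
  have hne : (N : ℝ) ≠ 0 := by exact_mod_cast hN.ne'
  set F := 1 - C q * X * ppSeries q l with hF
  set D : PowerSeries ℝ := PowerSeries.mk fun n => q * diffMean q l (n + 1) with hD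
  have hDn : D = (PowerSeries.mk fun n => ∑ j, (scaled l j + q / N) ^ (n + 1)) -
      PowerSeries.mk fun n => ∑ j, scaled l j ^ (n + 1) := by
    ext n
    rw [hD, map_sub, coeff_mk, coeff_mk, coeff_mk, ← Finset.sum_sub_distrib, diffMean, Finset.mul_sum]
    have h1 : ∀ j, (scaled l j + q / N) ^ (n + 1) - scaled l j ^ (n + 1) =
        ∑ r ∈ Finset.range (n + 1), scaled l j ^ r * (q / N) ^ (n + 1 - r) * ((n + 1).choose r : ℝ) := by
      intro j
      rw [add_pow, Finset.sum_range_succ]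
      simp
    rw [Finset.sum_congr rfl fun j _ => h1 j, Finset.sum_comm]
    refine Finset.sum_congr rfl fun r hr => ?_
    rw [powerMean, ← Finset.sum_mul, ← Finset.sum_mul]
    have h2 : n + 1 - r = (n + 1 - 1 - r) + 1 := by
      have := Finset.mem_range.1 hr; omega
    rw [h2, pow_succ]
    field_simp
  have hv := vieta_scaled hl q
  have h1 := congrArg (d⁄dX ℝ) hv
  rw [Derivation.leibniz, derivative_vieta, derivative_vieta, hv, ← hF, smul_eq_mul, smul_eq_mul] at h1
  have h2 : d⁄dX ℝ F = -(F * D) := by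
    apply mul_left_cancel₀ (vieta_ne_zero (scaled l))
    rw [hDn]
    linear_combination -h1
  have hFs : ∀ n, coeff (n + 1) F = -(q * ppMoment q l n) := fun n => by
    rw [hF, map_sub, mul_assoc, coeff_C_mul, mul_comm X, coeff_succ_mul_X, ppSeries, coeff_mk, coeff_one]
    simp
  have hF0 : coeff 0 F = 1 := by simp [hF]
  have h3 := congrArg (coeff k) h2
  rw [coeff_derivative, hFs, map_neg, coeff_mul, Finset.Nat.sum_antidiagonal_eq_sum_range_succ_mk,
    Finset.sum_range_succ'] at h3
  simp only [hFs, hF0, hD, coeff_mk] at h3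
  have h4 : ∀ b ∈ Finset.range k, -(q * ppMoment q l b) * (q * diffMean q l (k - (b + 1) + 1)) =
      -q * (q * (ppMoment q l b * diffMean q l (k - b))) := fun b hb => by
    have : k - (b + 1) + 1 = k - b := by have := Finset.mem_range.1 hb; omega
    rw [this]; ring
  rw [Finset.sum_congr rfl h4, ← Finset.mul_sum, ← Finset.mul_sum] at h3
  apply mul_left_cancel₀ hq
  simp only [Nat.sub_zero] at h3
  linear_combination -h3

lemma ppMoment_zero_left {l : Fin N → ℤ} (hl : Function.Injective l) (k : ℕ) :
    ppMoment 0 l k = powerMean l k := by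
  rw [ppMoment, powerMean]
  congr 1
  refine Finset.sum_congr rfl fun p _ => ?_
  rw [stepWeight, Finset.prod_eq_one, one_mul]
  intro j hj
  rw [zero_div, sub_zero, div_self (sub_ne_zero.2 ((scaled_injective hl).ne (Finset.ne_of_mem_erase hj).symm))]

end MomentSeries

/-! ### Lowering one coordinate changes the moments to second order in `1 / N`. -/

section Shift

open PowerSeries

variable {N : ℕ} {l : Fin N → ℤ}

/-- Distinct integers differ by at least one, so subtracting `q` with `|q| ≤ 1` never reverses the
sign of a difference. -/
lemma stepWeight_nonneg (hl : Function.Injective l) {q : ℝ} (hq : q ∈ Set.Icc (-1 : ℝ) 1)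
    (p : Fin N) : 0 ≤ stepWeight (q / N) (scaled l) p := by
  rw [stepWeight_scaled]
  refine Finset.prod_nonneg fun j hj => ?_
  have hne : l p ≠ l j := hl.ne (Finset.ne_of_mem_erase hj).symm
  rcases lt_or_gt_of_ne hne with h | h
  · have h1 : (l p : ℝ) + 1 ≤ l j := by exact_mod_cast h
    exact div_nonneg_of_nonpos (by linarith [hq.1]) (by linarith)
  · have h1 : (l j : ℝ) + 1 ≤ l p := by exact_mod_cast h
    exact div_nonneg (by linarith [hq.2]) (by linarith)

/-- A collision means `l_j = l_p - 1` for some `j`, which kills a factor of the weight at `q = 1`.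
Averages therefore only see admissible shifts. -/
lemma stepWeight_eq_zero (hl : Function.Injective l) {p : Fin N}
    (hp : ¬ Function.Injective (l - Pi.single p 1)) : stepWeight (1 / N) (scaled l) p = 0 := by
  classical
  have hex : ∃ j, j ≠ p ∧ l p - 1 = l j := by
    by_contra! hcon
    apply hp
    intro i j hij
    simp only [Pi.sub_apply, Pi.single_apply] at hij
    by_contra hne
    split_ifs at hij with h1 h2 h2
    · exact hne (h1.trans h2.symm)
    · subst h1; exact hcon j h2 (by omega)
    · subst h2; exact hcon i h1 (by omega)
    · exact hne (hl (by omega))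
  obtain ⟨j, hj, h⟩ := hex
  rw [stepWeight_scaled]
  refine Finset.prod_eq_zero (Finset.mem_erase.2 ⟨hj, Finset.mem_univ j⟩) ?_
  have : (l p : ℝ) - 1 = l j := by exact_mod_cast h
  rw [← this]
  simp

lemma scaled_sub_single (p j : Fin N) :
    scaled (l - Pi.single p 1) j = if j = p then scaled l p - 1 / N else scaled l j := by
  classical
  simp only [scaled, Pi.sub_apply, Pi.single_apply]
  split_ifs with h
  · subst h; push_cast; ring
  · simp

lemma vieta_update {x y : Fin N → ℝ} {p : Fin N} (h : ∀ j, j ≠ p → y j = x j) :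
    vieta y * (1 - C (x p) * X) = vieta x * (1 - C (y p) * X) := by
  classical
  have h1 : ∏ j ∈ Finset.univ.erase p, (1 - C (y j) * X : PowerSeries ℝ) =
      ∏ j ∈ Finset.univ.erase p, (1 - C (x j) * X) :=
    Finset.prod_congr rfl fun j hj => by rw [h j (Finset.ne_of_mem_erase hj)]
  rw [vieta, vieta, ← Finset.mul_prod_erase Finset.univ _ (Finset.mem_univ p),
    ← Finset.mul_prod_erase Finset.univ (fun j => (1 - C (x j) * X : PowerSeries ℝ)) (Finset.mem_univ p), h1]
  ring

/-- With `ε = 1 / N`, the shift multiplies `1 - t M_1` by `(1 - x_p t) ^ 2 / ((1 - (x_p - ε) t) (1 -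
(x_p + ε) t))`. The terms linear in `ε` cancel, leaving a correction of order `ε ^ 2`. -/
lemma ppSeries_shift (hl : Function.Injective l) {p : Fin N}
    (hp : Function.Injective (l - Pi.single p 1)) :
    ppSeries 1 (l - Pi.single p 1) = ppSeries 1 l - C ((1 / N : ℝ) ^ 2) * X *
      (geom (scaled l p - 1 / N) * geom (scaled l p + 1 / N)) * (1 - X * ppSeries 1 l) := by
  set x := scaled l with hx
  set ε : ℝ := 1 / N
  set x' := scaled (l - Pi.single p 1) with hx'
  have hxp : x' p = x p - ε := by rw [hx', scaled_sub_single, if_pos rfl]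
  have hxj : ∀ j, j ≠ p → x' j = x j := fun j hj => by rw [hx', scaled_sub_single, if_neg hj]
  have h1 := vieta_update hxj
  have h2 := vieta_update (x := fun j => x j + ε) (y := fun j => x' j + ε) (p := p)
    (fun j hj => by simp only [hxj j hj])
  have h3 := vieta_scaled hl 1
  have h4 := vieta_scaled hp 1
  simp only [map_one, one_mul] at h3 h4
  simp only [hxp, sub_add_cancel] at h1 h2
  rw [← hx] at h3
  rw [← hx'] at h4
  have h5 := geom_mul (x p - ε)
  have h6 := geom_mul (x p + ε)
  have e1 : (C (x p - ε) : PowerSeries ℝ) = C (x p) - C ε := map_sub _ _ _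
  have e2 : (C (x p + ε) : PowerSeries ℝ) = C (x p) + C ε := map_add _ _ _
  have e3 : (C (ε ^ 2) : PowerSeries ℝ) = C ε ^ 2 := map_pow _ _ _
  set a := (1 - C (x p - ε) * X : PowerSeries ℝ) with ha
  set b := (1 - C (x p + ε) * X : PowerSeries ℝ) with hb
  set g := (1 - C (x p) * X : PowerSeries ℝ) with hg
  set m := ppSeries 1 l
  set m' := ppSeries 1 (l - Pi.single p 1)
  have hgg : g ^ 2 = a * b + C (ε ^ 2) * X ^ 2 := by
    rw [ha, hb, hg, e1, e2, e3]; ring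
  have h7 : (1 - X * m') * (a * b) = (1 - X * m) * g ^ 2 := by
    apply mul_left_cancel₀ (vieta_ne_zero x)
    have h8 : (1 - X * m') * vieta x' * b = (1 - X * m) * vieta x * g := by
      rw [← h4, ← h3]; exact h2
    linear_combination g * h8 - (1 - X * m') * b * h1
  apply mul_left_cancel₀ (X_ne_zero (R := ℝ))
  set ga := geom (x p - ε)
  set gb := geom (x p + ε)
  rw [hgg] at h7
  linear_combination -(ga * gb) * h7 + ((1 - X * m') - (1 - X * m)) * (h5 + (ga * a) * h6)

/-- The average with respect to the Perelomov–Popov weights. -/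
noncomputable def weightAvg (l : Fin N → ℤ) (f : Fin N → ℝ) : ℝ :=
  (N : ℝ)⁻¹ * ∑ p, stepWeight (1 / N) (scaled l) p * f p

lemma weightAvg_mono (hl : Function.Injective l) {f g : Fin N → ℝ}
    (h : ∀ p, stepWeight (1 / N) (scaled l) p ≠ 0 → f p ≤ g p) : weightAvg l f ≤ weightAvg l g := by
  refine mul_le_mul_of_nonneg_left (Finset.sum_le_sum fun p _ => ?_) (by positivity)
  by_cases h0 : stepWeight (1 / N) (scaled l) p = 0
  · rw [h0, zero_mul, zero_mul]
  · exact mul_le_mul_of_nonneg_left (h p h0) (stepWeight_nonneg hl (by norm_num) p)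

lemma abs_weightAvg_le (hl : Function.Injective l) (f : Fin N → ℝ) :
    |weightAvg l f| ≤ weightAvg l fun p => |f p| := by
  rw [weightAvg, weightAvg, abs_mul, abs_of_nonneg (by positivity : (0 : ℝ) ≤ (N : ℝ)⁻¹)]
  refine mul_le_mul_of_nonneg_left ((Finset.abs_sum_le_sum_abs _ _).trans_eq ?_) (by positivity)
  refine Finset.sum_congr rfl fun p _ => ?_
  rw [abs_mul, abs_of_nonneg (stepWeight_nonneg hl (by norm_num) p)]

lemma weightAvg_sub (f g : Fin N → ℝ) :
    weightAvg l (fun p => f p - g p) = weightAvg l f - weightAvg l g := by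
  simp only [weightAvg, mul_sub, Finset.sum_sub_distrib]

lemma weightAvg_add (f g : Fin N → ℝ) :
    weightAvg l (fun p => f p + g p) = weightAvg l f + weightAvg l g := by
  simp only [weightAvg, mul_add, Finset.sum_add_distrib]

lemma weightAvg_mul_const (f : Fin N → ℝ) (c : ℝ) :
    weightAvg l (fun p => f p * c) = weightAvg l f * c := by
  simp only [weightAvg, ← mul_assoc, ← Finset.sum_mul]

lemma ppMoment_one (k : ℕ) : ppMoment 1 l k = weightAvg l fun p => scaled l p ^ k := rfl

/-- The absolute moments `∫ (|t| + 1)^s`. -/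
noncomputable def absMoment (l : Fin N → ℤ) (s : ℕ) : ℝ := weightAvg l fun p => (|scaled l p| + 1) ^ s

lemma absMoment_zero (hN : 0 < N) (hl : Function.Injective l) : absMoment l 0 = 1 := by
  rw [← ppMoment_zero hN hl one_ne_zero, ppMoment_one]
  simp [absMoment]

lemma weightAvg_const (hN : 0 < N) (hl : Function.Injective l) (c : ℝ) :
    weightAvg l (fun _ => c) = c := by
  have h := absMoment_zero hN hl
  simp only [absMoment, pow_zero] at h
  have h2 := weightAvg_mul_const (l := l) (fun _ => 1) c
  simpa [h] using h2

lemma absMoment_mono (hl : Function.Injective l) {s s' : ℕ} (h : s ≤ s') :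
    absMoment l s ≤ absMoment l s' :=
  weightAvg_mono hl fun p _ => pow_le_pow_right₀ (by linarith [abs_nonneg (scaled l p)]) h

lemma one_le_absMoment (hN : 0 < N) (hl : Function.Injective l) (s : ℕ) : 1 ≤ absMoment l s := by
  rw [← absMoment_zero hN hl]
  exact absMoment_mono hl (Nat.zero_le s)

lemma absMoment_sq_le (hN : 0 < N) (hl : Function.Injective l) (s : ℕ) :
    absMoment l s ^ 2 ≤ absMoment l (2 * s) := by
  set A := absMoment l s with hA
  have h1 : weightAvg l (fun _ => 0) ≤ weightAvg l fun p =>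
      (|scaled l p| + 1) ^ (2 * s) - (|scaled l p| + 1) ^ s * (2 * A) + A ^ 2 :=
    weightAvg_mono hl fun p _ => by
      nlinarith [sq_nonneg ((|scaled l p| + 1) ^ s - A), pow_mul' (|scaled l p| + 1) 2 s]
  rw [weightAvg_const hN hl, weightAvg_add, weightAvg_const hN hl, weightAvg_sub,
    weightAvg_mul_const] at h1
  change 0 ≤ absMoment l (2 * s) - A * (2 * A) + A ^ 2 at h1
  nlinarith

lemma abs_ppMoment_le (hl : Function.Injective l) (k : ℕ) : |ppMoment 1 l k| ≤ absMoment l k := by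
  rw [ppMoment_one]
  refine (abs_weightAvg_le hl _).trans (weightAvg_mono hl fun p _ => ?_)
  rw [abs_pow]
  exact pow_le_pow_left₀ (abs_nonneg _) (by linarith) k

/-- Even powers ignore the absolute value, so absolute moments are bounded by genuine moments, whose
expectations are known to converge. -/
lemma absMoment_even_le (hN : 0 < N) (hl : Function.Injective l) (s : ℕ) :
    absMoment l (2 * s) ≤ 2 ^ (2 * s) * (ppMoment 1 l (2 * s) + 1) := by
  have h1 : absMoment l (2 * s) ≤ weightAvg l fun p => (scaled l p ^ (2 * s) + 1) * 2 ^ (2 * s) := by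
    refine weightAvg_mono hl fun p _ => ?_
    have h2 := add_pow_le (abs_nonneg (scaled l p)) zero_le_one (2 * s)
    rw [one_pow, (even_two_mul s).pow_abs] at h2
    refine h2.trans ?_
    have h3 : (2 : ℝ) ^ (2 * s - 1) ≤ 2 ^ (2 * s) := pow_le_pow_right₀ (by norm_num) (by omega)
    have h4 : 0 ≤ scaled l p ^ (2 * s) := (even_two_mul s).pow_nonneg _
    nlinarith
  rw [weightAvg_mul_const, weightAvg_add, weightAvg_const hN hl] at h1
  rw [ppMoment_one]
  linarith

lemma abs_coeff_geom_mul_geom_le {x ε : ℝ} (hε : 0 ≤ ε) (hε1 : ε ≤ 1) (n : ℕ) :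
    |coeff n (geom (x - ε) * geom (x + ε))| ≤ (n + 1) * (|x| + 1) ^ n := by
  rw [coeff_mul]
  refine (Finset.abs_sum_le_sum_abs _ _).trans ?_
  have h1 : ∀ ab ∈ Finset.HasAntidiagonal.antidiagonal n, |coeff ab.1 (geom (x - ε)) * coeff ab.2 (geom (x + ε))| ≤
      (|x| + 1) ^ n := by
    intro ab hab
    rw [← Finset.HasAntidiagonal.mem_antidiagonal.1 hab, pow_add, geom, geom, coeff_mk, coeff_mk, abs_mul, abs_pow,
      abs_pow]
    have h2 : |x - ε| ≤ |x| + 1 := (abs_sub _ _).trans (by rw [abs_of_nonneg hε]; linarith)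
    have h3 : |x + ε| ≤ |x| + 1 := (abs_add_le _ _).trans (by rw [abs_of_nonneg hε]; linarith)
    gcongr
  refine (Finset.sum_le_card_nsmul _ _ _ h1).trans_eq ?_
  rw [Finset.Nat.card_antidiagonal, nsmul_eq_mul]
  push_cast
  ring

lemma abs_ppMoment_shift_sub_le (hN : 0 < N) (hl : Function.Injective l) {p : Fin N}
    (hp : Function.Injective (l - Pi.single p 1)) (k : ℕ) :
    |ppMoment 1 (l - Pi.single p 1) k - ppMoment 1 l k| ≤
      (1 / N : ℝ) ^ 2 * ((k + 1) ^ 2 * (|scaled l p| + 1) ^ k * absMoment l k) := by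
  have hε : (0 : ℝ) ≤ 1 / N := by positivity
  have hε1 : (1 / N : ℝ) ≤ 1 := by
    rw [div_le_one (by exact_mod_cast hN)]; exact_mod_cast hN
  have h1 := congrArg (coeff k) (ppSeries_shift hl hp)
  rw [map_sub, ppSeries, coeff_mk, ppSeries, coeff_mk] at h1
  rw [h1, sub_sub_cancel_left, abs_neg, mul_assoc, mul_assoc, coeff_C_mul, abs_mul,
    abs_of_nonneg (sq_nonneg _)]
  refine mul_le_mul_of_nonneg_left ?_ (sq_nonneg _)
  have hY : 1 ≤ |scaled l p| + 1 := by linarith [abs_nonneg (scaled l p)]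
  have hA := one_le_absMoment hN hl k
  rcases k with _ | n
  · rw [coeff_zero_eq_constantCoeff_apply, map_mul]
    simp only [constantCoeff_X, zero_mul, abs_zero]
    positivity
  rw [mul_comm X, coeff_succ_mul_X, coeff_mul]
  refine (Finset.abs_sum_le_sum_abs _ _).trans ?_
  have h2 : ∀ ab ∈ Finset.HasAntidiagonal.antidiagonal n, |coeff ab.1 (geom (scaled l p - 1 / N) * geom (scaled l p + 1 / N)) *
      coeff ab.2 (1 - X * PowerSeries.mk (ppMoment 1 l))| ≤
      ((n + 1 : ℕ) + 1) * (|scaled l p| + 1) ^ (n + 1) * absMoment l (n + 1) := by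
    intro ab hab
    have hab' := Finset.HasAntidiagonal.mem_antidiagonal.1 hab
    rw [abs_mul]
    have h3 : |coeff ab.2 (1 - X * PowerSeries.mk (ppMoment 1 l))| ≤ absMoment l (n + 1) := by
      rcases hb : ab.2 with _ | b
      · simpa using hA
      · rw [map_sub, mul_comm X, coeff_succ_mul_X, coeff_mk, coeff_one, if_neg (Nat.succ_ne_zero b),
          zero_sub, abs_neg]
        exact (abs_ppMoment_le hl b).trans (absMoment_mono hl (by omega))
    refine mul_le_mul ((abs_coeff_geom_mul_geom_le hε hε1 _).trans ?_) h3 (abs_nonneg _) (by positivity)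
    have h4 : (ab.1 : ℝ) ≤ (n + 1 : ℕ) := by exact_mod_cast (by omega : ab.1 ≤ n + 1)
    have h5 : (|scaled l p| + 1) ^ ab.1 ≤ (|scaled l p| + 1) ^ (n + 1) := pow_le_pow_right₀ hY (by omega)
    gcongr
  refine (Finset.sum_le_card_nsmul _ _ _ h2).trans ?_
  rw [Finset.Nat.card_antidiagonal, nsmul_eq_mul]
  have h6 : 0 ≤ (|scaled l p| + 1) ^ (n + 1) * absMoment l (n + 1) := by positivity
  push_cast
  nlinarith

/-- The mixed quantity computed by the operators is the square of the moment up to `O(N⁻²)`. The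
error is quadratic in absolute moments of order at most `2 k`, and Cauchy–Schwarz turns it into a
moment of order `4 k`. -/
theorem abs_shiftedMoment_sub_sq_le (hN : 0 < N) (hl : Function.Injective l) (k : ℕ) :
    |shiftedMoment l k k - ppMoment 1 l k ^ 2| ≤
      (1 / N : ℝ) ^ 2 * ((k + 1) ^ 2 * 2 ^ (4 * k) * (ppMoment 1 l (4 * k) + 1)) := by
  have h1 : shiftedMoment l k k - ppMoment 1 l k ^ 2 = weightAvg l fun p =>
      scaled l p ^ k * (ppMoment 1 (l - Pi.single p 1) k - ppMoment 1 l k) := by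
    simp only [mul_sub]
    rw [weightAvg_sub, weightAvg_mul_const, ← ppMoment_one, sq, shiftedMoment, weightAvg]
    simp only [mul_assoc]
  rw [h1]
  refine (abs_weightAvg_le hl _).trans ?_
  have h2 : (weightAvg l fun p => |scaled l p ^ k * (ppMoment 1 (l - Pi.single p 1) k - ppMoment 1 l k)|) ≤
      weightAvg l fun p => (|scaled l p| + 1) ^ (2 * k) *
        ((1 / N : ℝ) ^ 2 * ((k + 1) ^ 2 * absMoment l k)) := by
    refine weightAvg_mono hl fun p hp => ?_
    have hp' : Function.Injective (l - Pi.single p 1) := by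
      by_contra hcon
      exact hp (stepWeight_eq_zero hl hcon)
    rw [abs_mul, abs_pow]
    have h3 : |scaled l p| ^ k ≤ (|scaled l p| + 1) ^ k := pow_le_pow_left₀ (abs_nonneg _) (by linarith) k
    refine (mul_le_mul h3 (abs_ppMoment_shift_sub_le hN hl hp' k) (abs_nonneg _) (by positivity)).trans_eq ?_
    rw [two_mul, pow_add]
    ring
  refine h2.trans ?_
  rw [weightAvg_mul_const]
  change absMoment l (2 * k) * _ ≤ _
  have h4 : absMoment l (2 * k) * absMoment l k ≤ absMoment l (2 * (2 * k)) := by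
    have h5 := absMoment_mono hl (show k ≤ 2 * k by omega)
    have h6 := one_le_absMoment hN hl (2 * k)
    calc _ ≤ absMoment l (2 * k) * absMoment l (2 * k) := by gcongr
      _ ≤ _ := by rw [← sq]; exact absMoment_sq_le hN hl _
  have h7 := absMoment_even_le hN hl (2 * k)
  rw [show 2 * (2 * k) = 4 * k by ring] at h4 h7
  calc absMoment l (2 * k) * ((1 / N : ℝ) ^ 2 * ((k + 1) ^ 2 * absMoment l k)) =
      (1 / N : ℝ) ^ 2 * ((k + 1) ^ 2 * (absMoment l (2 * k) * absMoment l k)) := by ring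
    _ ≤ (1 / N : ℝ) ^ 2 * ((k + 1) ^ 2 * (2 ^ (4 * k) * (ppMoment 1 l (4 * k) + 1))) := by
      exact mul_le_mul_of_nonneg_left (mul_le_mul_of_nonneg_left (h4.trans h7) (by positivity))
        (by positivity)
    _ = _ := by ring

lemma ppMoment_sq_le (hN : 0 < N) (hl : Function.Injective l) (k : ℕ) :
    ppMoment 1 l k ^ 2 ≤ 2 ^ (2 * k) * (ppMoment 1 l (2 * k) + 1) := by
  have h1 := abs_ppMoment_le hl k
  calc ppMoment 1 l k ^ 2 = |ppMoment 1 l k| ^ 2 := (sq_abs _).symm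
    _ ≤ absMoment l k ^ 2 := by gcongr
    _ ≤ _ := (absMoment_sq_le hN hl k).trans (absMoment_even_le hN hl k)

end Shift

/-! ### Convergence in probability to constants. -/

section ConvergenceInProbability

/-- Convergence in probability to a constant. -/
def ConvProb (ϱ : ∀ N : ℕ, PMF (Signature N)) (Y : ∀ N : ℕ, Signature N → ℝ) (c : ℝ) : Prop :=
  ∀ ε : ℝ, 0 < ε → Tendsto (fun N : ℕ => (ϱ N).toOuterMeasure {lam | ε ≤ |Y N lam - c|}) atTop (𝓝 0)

variable {ϱ : ∀ N : ℕ, PMF (Signature N)} {Y Z : ∀ N : ℕ, Signature N → ℝ} {c d : ℝ}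

lemma ConvProb.congr (h : ConvProb ϱ Y c) (hYZ : ∀ᶠ N in atTop, ∀ lam, Y N lam = Z N lam) :
    ConvProb ϱ Z c := fun ε hε => by
  refine (h ε hε).congr' ?_
  filter_upwards [hYZ] with N hN
  simp only [hN]

lemma ConvProb.of_tendsto {y : ℕ → ℝ} (h : Tendsto y atTop (𝓝 c)) :
    ConvProb ϱ (fun N _ => y N) c := fun ε hε => by
  refine tendsto_const_nhds.congr' ?_
  filter_upwards [Metric.tendsto_nhds.1 h ε hε] with N hN
  rw [Real.dist_eq] at hN
  have h1 : {lam : Signature N | ε ≤ |y N - c|} = ∅ :=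
    Set.eq_empty_of_forall_notMem fun _ (h : ε ≤ |y N - c|) => absurd hN (not_lt.2 h)
  rw [h1]
  exact measure_empty.symm

lemma ConvProb.map₂ (hY : ConvProb ϱ Y c) (hZ : ConvProb ϱ Z d) {f : ℝ × ℝ → ℝ}
    (hf : ContinuousAt f (c, d)) : ConvProb ϱ (fun N lam => f (Y N lam, Z N lam)) (f (c, d)) := by
  intro ε hε
  obtain ⟨δ, hδ, hfδ⟩ := Metric.continuousAt_iff.1 hf ε hε
  have h1 := (hY δ hδ).add (hZ δ hδ)
  rw [add_zero] at h1
  refine tendsto_of_tendsto_of_tendsto_of_le_of_le tendsto_const_nhds h1 (fun _ => zero_le) fun N => ?_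
  refine (measure_mono (μ := (ϱ N).toOuterMeasure) fun lam hlam => ?_).trans (measure_union_le _ _)
  by_contra hcon
  have hcon' : ¬ (δ ≤ |Y N lam - c| ∨ δ ≤ |Z N lam - d|) := hcon
  push Not at hcon'
  have h2 : dist (Y N lam, Z N lam) (c, d) < δ := by
    rw [Prod.dist_eq, max_lt_iff, Real.dist_eq, Real.dist_eq]
    exact hcon'
  have h3 := hfδ h2
  rw [Real.dist_eq] at h3
  exact absurd h3 (not_lt.2 hlam)

lemma ConvProb.add (hY : ConvProb ϱ Y c) (hZ : ConvProb ϱ Z d) :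
    ConvProb ϱ (fun N lam => Y N lam + Z N lam) (c + d) :=
  hY.map₂ hZ (f := fun z => z.1 + z.2) (by fun_prop)

lemma ConvProb.sub (hY : ConvProb ϱ Y c) (hZ : ConvProb ϱ Z d) :
    ConvProb ϱ (fun N lam => Y N lam - Z N lam) (c - d) :=
  hY.map₂ hZ (f := fun z => z.1 - z.2) (by fun_prop)

lemma ConvProb.mul (hY : ConvProb ϱ Y c) (hZ : ConvProb ϱ Z d) :
    ConvProb ϱ (fun N lam => Y N lam * Z N lam) (c * d) :=
  hY.map₂ hZ (f := fun z => z.1 * z.2) (by fun_prop)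

lemma ConvProb.const (c : ℝ) : ConvProb ϱ (fun _ _ => c) c := ConvProb.of_tendsto tendsto_const_nhds

lemma ConvProb.sum {κ : Type*} (s : Finset κ) {Y : κ → ∀ N : ℕ, Signature N → ℝ} {c : κ → ℝ}
    (h : ∀ i ∈ s, ConvProb ϱ (Y i) (c i)) :
    ConvProb ϱ (fun N lam => ∑ i ∈ s, Y i N lam) (∑ i ∈ s, c i) := by
  classical
  induction s using Finset.induction_on with
  | empty => simpa using ConvProb.const (ϱ := ϱ) 0
  | insert a s ha ih =>
    simp only [Finset.sum_insert ha]
    exact (h a (Finset.mem_insert_self _ _)).add (ih fun i hi => h i (Finset.mem_insert_of_mem hi))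

/-- Chebyshev's inequality on a discrete space. -/
lemma toOuterMeasure_le_of_sq {β : Type*} (p : PMF β) {f : β → ℝ} {ε : ℝ} (hε : 0 < ε)
    (hs : Summable fun b => (p b).toReal * f b ^ 2) :
    p.toOuterMeasure {b | ε ≤ |f b|} ≤ ENNReal.ofReal ((∑' b, (p b).toReal * f b ^ 2) / ε ^ 2) := by
  classical
  rw [PMF.toOuterMeasure_apply, ← tsum_div_const, ENNReal.ofReal_tsum_of_nonneg
    (fun b => by positivity) (hs.div_const _)]
  refine ENNReal.tsum_le_tsum fun b => ?_
  by_cases hb : ε ≤ |f b|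
  · rw [Set.indicator_of_mem (by exact hb)]
    rw [← ENNReal.ofReal_toReal (p.apply_ne_top b)]
    refine ENNReal.ofReal_le_ofReal ?_
    rw [ENNReal.toReal_ofReal ENNReal.toReal_nonneg, mul_div_assoc]
    refine le_mul_of_one_le_right ENNReal.toReal_nonneg ?_
    rw [one_le_div (by positivity), ← sq_abs (f b)]
    gcongr
  · rw [Set.indicator_of_notMem (by exact hb)]
    exact zero_le

lemma ConvProb.of_second_moment
    (hs1 : ∀ᶠ N in atTop, Summable fun lam => (ϱ N lam).toReal * Y N lam)
    (hs2 : ∀ᶠ N in atTop, Summable fun lam => (ϱ N lam).toReal * Y N lam ^ 2)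
    (h1 : Tendsto (fun N => ∑' lam, (ϱ N lam).toReal * Y N lam) atTop (𝓝 c))
    (h2 : Tendsto (fun N => ∑' lam, (ϱ N lam).toReal * Y N lam ^ 2) atTop (𝓝 (c ^ 2))) :
    ConvProb ϱ Y c := by
  intro ε hε
  have h3 : Tendsto (fun N => ENNReal.ofReal (((∑' lam, (ϱ N lam).toReal * Y N lam ^ 2) -
      2 * c * (∑' lam, (ϱ N lam).toReal * Y N lam) + c ^ 2) / ε ^ 2)) atTop (𝓝 0) := by
    have h4 := ((h2.sub (h1.const_mul (2 * c))).add_const (c ^ 2)).div_const (ε ^ 2)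
    have h5 := (ENNReal.continuous_ofReal.tendsto _).comp h4
    rw [show (c ^ 2 - 2 * c * c + c ^ 2) / ε ^ 2 = 0 by ring, ENNReal.ofReal_zero] at h5
    exact h5
  refine tendsto_of_tendsto_of_tendsto_of_le_of_le' tendsto_const_nhds h3
    (Eventually.of_forall fun _ => zero_le) ?_
  filter_upwards [hs1, hs2] with N hN1 hN2
  have h6 : HasSum (fun lam => (ϱ N lam).toReal * (Y N lam - c) ^ 2)
      ((∑' lam, (ϱ N lam).toReal * Y N lam ^ 2) -
        2 * c * (∑' lam, (ϱ N lam).toReal * Y N lam) + c ^ 2) := by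
    have h7 := (hN2.hasSum.sub (hN1.hasSum.mul_left (2 * c))).add
      ((PSeries.hasSum_toReal (ϱ N)).mul_left (c ^ 2))
    rw [mul_one] at h7
    refine h7.congr_fun fun lam => ?_
    ring
  rw [← h6.tsum_eq]
  exact toOuterMeasure_le_of_sq (ϱ N) hε h6.summable

end ConvergenceInProbability

/-! ### Transport of convergence between values of `q`. -/

section LimitRecursion

/-- The limits of the normalised power sums in terms of the limit moments for `q = 1`. -/
noncomputable def powerLimit (μ : ℕ → ℝ) : ℕ → ℝ
  | k => μ k + ((k : ℝ) + 1)⁻¹ *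
      ∑ b : Fin k, μ b * (((k - b : ℕ) : ℝ) * powerLimit μ (k - b - 1))
decreasing_by omega

/-- The limit moments in terms of the limits of the normalised power sums. -/
noncomputable def momentLimit (q : ℝ) (P : ℕ → ℝ) : ℕ → ℝ
  | k => P k - q * ((k : ℝ) + 1)⁻¹ *
      ∑ b : Fin k, momentLimit q P b * (((k - b : ℕ) : ℝ) * P (k - b - 1))
decreasing_by exact b.2

lemma powerLimit_eq (μ : ℕ → ℝ) (k : ℕ) : ((k : ℝ) + 1) * powerLimit μ k = ((k : ℝ) + 1) * μ k +
    ∑ b ∈ Finset.range k, μ b * (((k - b : ℕ) : ℝ) * powerLimit μ (k - b - 1)) := by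
  have : (k : ℝ) + 1 ≠ 0 := by positivity
  rw [powerLimit, mul_add, mul_inv_cancel_left₀ this, Finset.sum_range]

lemma momentLimit_eq (q : ℝ) (P : ℕ → ℝ) (k : ℕ) :
    ((k : ℝ) + 1) * momentLimit q P k = ((k : ℝ) + 1) * P k -
      q * ∑ b ∈ Finset.range k, momentLimit q P b * (((k - b : ℕ) : ℝ) * P (k - b - 1)) := by
  have : (k : ℝ) + 1 ≠ 0 := by positivity
  rw [momentLimit, mul_sub, mul_comm q, mul_assoc _ q, mul_inv_cancel_left₀ this, Finset.sum_range]

lemma momentLimit_zero_left (P : ℕ → ℝ) : momentLimit 0 P = P := by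
  funext k
  rw [momentLimit]
  simp

variable {ϱ : ∀ N : ℕ, PMF (Signature N)}

lemma convProb_inv_pow (q : ℝ) {r : ℕ} (hr : r ≠ 0) :
    ConvProb ϱ (fun N _ => (q / N) ^ r) 0 := by
  have h := (tendsto_const_div_atTop_nhds_zero_nat q).pow r
  rw [zero_pow hr] at h
  exact ConvProb.of_tendsto h

/-- Only the top term `r = n - 1` of the difference quotient survives; the others carry a positive
power of `q / N`. The limit is the derivative of the monomial of degree `n`. -/
lemma convProb_diffMean {P : ℕ → ℝ} {n : ℕ} (q : ℝ)
    (h : ∀ r < n, ConvProb ϱ (fun _ lam => powerMean (PSeries.exponents lam) r) (P r)) :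
    ConvProb ϱ (fun _ lam => diffMean q (PSeries.exponents lam) n) (n * P (n - 1)) := by
  rcases n with _ | n
  · simpa [diffMean] using ConvProb.const (ϱ := ϱ) 0
  have h1 : ConvProb ϱ (fun N lam => ∑ r ∈ Finset.range n, ((n + 1).choose r : ℝ) *
      (q / N) ^ (n + 1 - 1 - r) * powerMean (PSeries.exponents lam) r)
      (∑ r ∈ Finset.range n, ((n + 1).choose r : ℝ) * 0 * P r) :=
    ConvProb.sum _ fun r hr => ((ConvProb.const _).mul (convProb_inv_pow q (by
      have := Finset.mem_range.1 hr; omega))).mul (h r (by have := Finset.mem_range.1 hr; omega))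
  have h2 := h1.add ((ConvProb.const (ϱ := ϱ) ((n : ℝ) + 1)).mul (h n (by omega)))
  simp only [mul_zero, zero_mul, Finset.sum_const_zero, zero_add] at h2
  have h3 : ((n + 1 : ℕ) : ℝ) * P (n + 1 - 1) = ((n : ℝ) + 1) * P n := by simp
  rw [h3]
  refine h2.congr (Eventually.of_forall fun N lam => ?_)
  rw [diffMean, Finset.sum_range_succ]
  simp

/-- The recursion at `q = 1` is triangular: `diffMean` of order `k + 1` has top term `(k + 1)` times
the `k`-th power mean, so it can be solved by strong induction. -/
lemma convProb_powerMean {μ : ℕ → ℝ}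
    (h : ∀ k, ConvProb ϱ (fun _ lam => ppMoment 1 (PSeries.exponents lam) k) (μ k)) (k : ℕ) :
    ConvProb ϱ (fun _ lam => powerMean (PSeries.exponents lam) k) (powerLimit μ k) := by
  induction k using Nat.strong_induction_on with
  | _ k ih =>
  have hk : (k : ℝ) + 1 ≠ 0 := by positivity
  have h1 : ConvProb ϱ (fun _ lam => ((k : ℝ) + 1) * ppMoment 1 (PSeries.exponents lam) k +
      ∑ b ∈ Finset.range k, ppMoment 1 (PSeries.exponents lam) b *
        diffMean 1 (PSeries.exponents lam) (k - b)) (((k : ℝ) + 1) * powerLimit μ k) := by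
    rw [powerLimit_eq]
    exact ((ConvProb.const _).mul (h k)).add (ConvProb.sum _ fun b hb => (h b).mul
      (convProb_diffMean 1 fun r hr => ih r (by omega)))
  have h2 : ConvProb ϱ (fun N lam => ∑ r ∈ Finset.range k, ((k + 1).choose r : ℝ) *
      (1 / N) ^ (k + 1 - 1 - r) * powerMean (PSeries.exponents lam) r)
      (∑ r ∈ Finset.range k, ((k + 1).choose r : ℝ) * 0 * powerLimit μ r) :=
    ConvProb.sum _ fun r hr => ((ConvProb.const _).mul (convProb_inv_pow 1 (by
      have := Finset.mem_range.1 hr; omega))).mul (ih r (by have := Finset.mem_range.1 hr; omega))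
  have h3 := (ConvProb.const (ϱ := ϱ) ((k : ℝ) + 1)⁻¹).mul (h1.sub h2)
  simp only [mul_zero, zero_mul, Finset.sum_const_zero, sub_zero, inv_mul_cancel_left₀ hk] at h3
  refine h3.congr ?_
  filter_upwards [eventually_gt_atTop 0] with N hN lam
  rw [ppMoment_recursion hN (PSeries.exponents_strictAnti lam).injective one_ne_zero, one_mul,
    sub_add_cancel, diffMean, Finset.sum_range_succ, add_sub_cancel_left]
  simp only [Nat.add_sub_cancel, Nat.sub_self, pow_zero, mul_one, Nat.choose_succ_self_right]
  push_cast
  rw [inv_mul_cancel_left₀ hk]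

lemma convProb_ppMoment {P : ℕ → ℝ}
    (h : ∀ k, ConvProb ϱ (fun _ lam => powerMean (PSeries.exponents lam) k) (P k)) (q : ℝ) (k : ℕ) :
    ConvProb ϱ (fun _ lam => ppMoment q (PSeries.exponents lam) k) (momentLimit q P k) := by
  rcases eq_or_ne q 0 with rfl | hq
  · rw [momentLimit_zero_left]
    exact (h k).congr (Eventually.of_forall fun N lam =>
      (ppMoment_zero_left (PSeries.exponents_strictAnti lam).injective k).symm)
  induction k using Nat.strong_induction_on with
  | _ k ih =>
  have hk : (k : ℝ) + 1 ≠ 0 := by positivity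
  have h1 : ConvProb ϱ (fun _ lam => diffMean q (PSeries.exponents lam) (k + 1) -
      q * ∑ b ∈ Finset.range k, ppMoment q (PSeries.exponents lam) b *
        diffMean q (PSeries.exponents lam) (k - b)) (((k : ℝ) + 1) * momentLimit q P k) := by
    have h2 := convProb_diffMean (n := k + 1) q fun r _ => h r
    push_cast at h2
    rw [momentLimit_eq]
    exact h2.sub ((ConvProb.const _).mul (ConvProb.sum _ fun b hb => (ih b (Finset.mem_range.1 hb)).mul
      (convProb_diffMean q fun r _ => h r)))
  have h3 := (ConvProb.const (ϱ := ϱ) ((k : ℝ) + 1)⁻¹).mul h1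
  rw [inv_mul_cancel_left₀ hk] at h3
  refine h3.congr ?_
  filter_upwards [eventually_gt_atTop 0] with N hN lam
  rw [← ppMoment_recursion hN (PSeries.exponents_strictAnti lam).injective hq,
    inv_mul_cancel_left₀ hk]

end LimitRecursion

/-! ### Vanishing variance and convergence of all `q`-moments. -/

namespace PSeries

variable {ϱ : ∀ N : ℕ, PMF (Signature N)} {a : ℕ → ℝ}
  (hS : ∀ N : ℕ, ∃ U ∈ 𝓝 (1 : Fin N → ℂ), SummableUniformlyOn (schurTerm (ϱ N)) U)
  (ha : ∀ i k : ℕ, 1 ≤ k →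
      Tendsto (fun N : ℕ => iterPartialD (List.replicate k i) (logSchurGen (ϱ N)) 1)
        atTop (𝓝 (a k : ℂ)))
  (hmix : ∀ is : List ℕ, 2 ≤ is.toFinset.card →
      Tendsto (fun N : ℕ => iterPartialD is (logSchurGen (ϱ N)) 1) atTop (𝓝 0))

include hS

lemma summable_sq {N : ℕ} (hN : 0 < N) (k : ℕ) :
    Summable fun lam => (ϱ N lam).toReal * ppMoment 1 (exponents lam) k ^ 2 := by
  have h1 := ((summable_expectation hS hN (2 * k)).add (hasSum_toReal (ϱ N)).summable).mul_left
    (2 ^ (2 * k))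
  refine h1.of_nonneg_of_le (fun lam => by positivity) fun lam => ?_
  have h2 := ppMoment_sq_le hN (exponents_strictAnti lam).injective k
  calc _ ≤ (ϱ N lam).toReal * (2 ^ (2 * k) * (ppMoment 1 (exponents lam) (2 * k) + 1)) := by gcongr
    _ = _ := by ring

include ha hmix

/-- The shifted expectation has the factorised limit, and its distance to the second moment is at
most `N⁻²` times a convergent expectation of order `4 k`. -/
theorem tendsto_second_moment (k : ℕ) :
    Tendsto (fun N => ∑' lam, (ϱ N lam).toReal * ppMoment 1 (exponents lam) k ^ 2) atTop
      (𝓝 (baseMoment a k ^ 2)) := by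
  have h1 := tendsto_shifted_expectation hS ha hmix k k
  have h2 := tendsto_expectation hS ha hmix (4 * k)
  set B : ℕ → ℝ := fun N => (1 / N : ℝ) ^ 2 * ((k + 1) ^ 2 * 2 ^ (4 * k) *
    ((∑' lam, (ϱ N lam).toReal * ppMoment 1 (exponents lam) (4 * k)) + 1))
  have hB : Tendsto B atTop (𝓝 0) := by
    have h3 := ((tendsto_const_div_atTop_nhds_zero_nat (1 : ℝ)).pow 2).mul
      ((h2.add_const 1).const_mul (((k : ℝ) + 1) ^ 2 * 2 ^ (4 * k)))
    rw [zero_pow two_ne_zero, zero_mul] at h3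
    exact h3
  have h4 : Tendsto (fun N => (∑' lam, (ϱ N lam).toReal * ppMoment 1 (exponents lam) k ^ 2) -
      ∑' lam, (ϱ N lam).toReal * shiftedMoment (exponents lam) k k) atTop (𝓝 0) := by
    refine squeeze_zero_norm' ?_ hB
    filter_upwards [eventually_gt_atTop 0] with N hN
    have hs1 := summable_sq hS hN k
    have hs2 := summable_shifted_expectation hS hN k k
    have hs3 := summable_expectation hS hN (4 * k)
    rw [norm_sub_rev, ← hs2.tsum_sub hs1]
    have h5 : HasSum (fun lam => (1 / N : ℝ) ^ 2 * ((k + 1) ^ 2 * 2 ^ (4 * k) *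
        ((ϱ N lam).toReal * ppMoment 1 (exponents lam) (4 * k) + (ϱ N lam).toReal))) (B N) :=
      ((hs3.hasSum.add (hasSum_toReal (ϱ N))).mul_left _).mul_left _
    refine tsum_of_norm_bounded h5 fun lam => ?_
    rw [← mul_sub, norm_mul, Real.norm_of_nonneg ENNReal.toReal_nonneg, Real.norm_eq_abs]
    have h6 := abs_shiftedMoment_sub_sq_le hN (exponents_strictAnti lam).injective k
    calc _ ≤ (ϱ N lam).toReal * ((1 / N : ℝ) ^ 2 * ((k + 1) ^ 2 * 2 ^ (4 * k) *
          (ppMoment 1 (exponents lam) (4 * k) + 1))) := by gcongr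
      _ = _ := by ring
  have h7 := h1.add h4
  simp only [add_sub_cancel, add_zero] at h7
  rwa [← sq] at h7

theorem convProb_base (k : ℕ) :
    ConvProb ϱ (fun _ lam => ppMoment 1 (exponents lam) k) (baseMoment a k) :=
  ConvProb.of_second_moment
    ((eventually_gt_atTop 0).mono fun _ hN => summable_expectation hS hN k)
    ((eventually_gt_atTop 0).mono fun _ hN => summable_sq hS hN k)
    (tendsto_expectation hS ha hmix k) (tendsto_second_moment hS ha hmix k)

theorem convProb_moment (q : ℝ) (k : ℕ) :
    ConvProb ϱ (fun _ lam => ppMoment q (exponents lam) k)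
      (momentLimit q (powerLimit (baseMoment a)) k) :=
  convProb_ppMoment (convProb_powerMean (convProb_base hS ha hmix)) q k

end PSeries

/-! ### Limits of moment sequences are moment sequences. -/

section MomentProblem

lemma abs_pow_le_one_add (k : ℕ) (t : ℝ) : |t ^ k| ≤ 1 + t ^ (2 * k) := by
  rw [pow_mul', abs_le]
  constructor <;> nlinarith [sq_nonneg (t ^ k - 1), sq_nonneg (t ^ k + 1), sq_nonneg (t ^ k)]

/-- The truncation of a power to a bounded continuous function. -/
noncomputable def clipPow (R : ℝ) (k : ℕ) : BoundedContinuousFunction ℝ ℝ :=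
  BoundedContinuousFunction.ofNormedAddCommGroup (fun t => (max (-R) (min t R)) ^ k) (by fun_prop)
    (|R| ^ k) fun t => by
      rw [norm_pow, Real.norm_eq_abs]
      refine pow_le_pow_left₀ (abs_nonneg _) (abs_le.2 ⟨?_, ?_⟩) k
      · exact (neg_le_neg (le_abs_self R)).trans (le_max_left _ _)
      · exact max_le (neg_le_abs R) ((min_le_right _ _).trans (le_abs_self R))

lemma clipPow_apply (R : ℝ) (k : ℕ) (t : ℝ) : clipPow R k t = (max (-R) (min t R)) ^ k := rfl

/-- The error lives on `|t| > R`, where it is at most `2 |t| ^ k`, and `R ≤ |t| ^ (k + 2)` there. A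
uniformly bounded higher moment then makes the truncation uniform. -/
lemma abs_sub_clipPow_le {R : ℝ} (hR : 1 ≤ R) (k : ℕ) (t : ℝ) :
    |t ^ k - clipPow R k t| ≤ t ^ (2 * (k + 1)) * (2 / R) := by
  have hnn : 0 ≤ t ^ (2 * (k + 1)) := (even_two_mul _).pow_nonneg t
  rw [clipPow_apply]
  rcases le_or_gt |t| R with h | h
  · obtain ⟨h1, h2⟩ := abs_le.1 h
    rw [min_eq_left h2, max_eq_right h1, sub_self, abs_zero]
    positivity
  · have hc : |max (-R) (min t R)| ≤ |t| := by
      refine (abs_le.2 ⟨le_max_left _ _, max_le (by linarith) (min_le_right _ _)⟩).trans h.le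
    have h1 : |t ^ k - (max (-R) (min t R)) ^ k| ≤ 2 * |t| ^ k := by
      refine (abs_sub _ _).trans ?_
      rw [abs_pow, abs_pow]
      have := pow_le_pow_left₀ (abs_nonneg _) hc k
      linarith
    refine h1.trans ?_
    rw [← (even_two_mul (k + 1)).pow_abs, mul_div_assoc', le_div_iff₀ (by linarith)]
    have h2 : |t| ≤ |t| ^ (k + 2) := le_self_pow₀ (by linarith) (by omega)
    have h3 : |t| ^ (2 * (k + 1)) = |t| ^ k * |t| ^ (k + 2) := by rw [← pow_add]; congr 1; ring
    rw [h3]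
    have h4 : 0 ≤ |t| ^ k := by positivity
    nlinarith [mul_le_mul_of_nonneg_left (h.le.trans h2) h4]

/-- A pointwise limit of moment sequences is a moment sequence. -/
theorem exists_measure_of_tendsto_moments {ν : ℕ → Measure ℝ} [∀ n, IsProbabilityMeasure (ν n)]
    (hint : ∀ n k, Integrable (fun t : ℝ => t ^ k) (ν n)) {M : ℕ → ℝ}
    (hM : ∀ k, Tendsto (fun n => ∫ t, t ^ k ∂ν n) atTop (𝓝 (M k))) :
    ∃ μ : Measure ℝ, IsProbabilityMeasure μ ∧ (∀ k, Integrable (fun t : ℝ => t ^ k) μ) ∧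
      ∀ k, ∫ t, t ^ k ∂μ = M k := by
  have hbd : ∀ k, ∃ C : ℝ, 0 ≤ C ∧ ∀ n, ∫ t, t ^ k ∂ν n ≤ C := fun k => by
    obtain ⟨C, hC⟩ := (hM k).bddAbove_range
    exact ⟨max C 0, le_max_right _ _, fun n => (hC ⟨n, rfl⟩).trans (le_max_left _ _)⟩
  choose C hC0 hC using hbd
  let P : ℕ → ProbabilityMeasure ℝ := fun n => ⟨ν n, inferInstance⟩
  have htight : IsTightMeasureSet {((μ : ProbabilityMeasure ℝ) : Measure ℝ) | μ ∈ Set.range P} := by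
    rw [isTightMeasureSet_iff_exists_isCompact_measure_compl_le]
    intro ε hε
    obtain ⟨δ, hδ, hδε⟩ : ∃ δ : ℝ, 0 < δ ∧ ENNReal.ofReal δ ≤ ε := by
      rcases eq_or_ne ε ⊤ with rfl | h
      · exact ⟨1, one_pos, le_top⟩
      · exact ⟨ε.toReal, ENNReal.toReal_pos hε.ne' h, (ENNReal.ofReal_toReal h).le⟩
    -- With this radius `C 2 = δ (R - 1) ≤ δ R ^ 2`, so Chebyshev's bound `C 2 / R ^ 2` is at most
    -- `δ`.
    set R := C 2 / δ + 1
    have hR : 1 ≤ R := by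
      have := div_nonneg (hC0 2) hδ.le
      linarith
    refine ⟨Metric.closedBall 0 R, isCompact_closedBall _ _, ?_⟩
    rintro _ ⟨_, ⟨n, rfl⟩, rfl⟩
    refine le_trans ?_ hδε
    have h1 := mul_meas_ge_le_integral_of_nonneg (μ := ν n) (f := fun t => t ^ 2)
      (Eventually.of_forall fun t => sq_nonneg t) (hint n 2) (R ^ 2)
    have h2 : (ν n).real {t | R ^ 2 ≤ t ^ 2} ≤ δ := by
      have h3 := h1.trans (hC 2 n)
      have h4 : C 2 ≤ δ * R ^ 2 := by
        have h5 : C 2 = δ * (R - 1) := by simp only [R]; field_simp; ring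
        rw [h5]
        exact mul_le_mul_of_nonneg_left (by nlinarith) hδ.le
      have h6 : R ^ 2 * (ν n).real {t | R ^ 2 ≤ t ^ 2} ≤ R ^ 2 * δ := by linarith
      exact le_of_mul_le_mul_left h6 (by positivity)
    calc ν n (Metric.closedBall 0 R)ᶜ ≤ ν n {t | R ^ 2 ≤ t ^ 2} := measure_mono fun t ht => by
          have h3 : R < |t| := by simpa using ht
          change R ^ 2 ≤ t ^ 2
          rw [← sq_abs t]
          gcongr
      _ = ENNReal.ofReal ((ν n).real {t | R ^ 2 ≤ t ^ 2}) := (ofReal_measureReal).symm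
      _ ≤ _ := ENNReal.ofReal_le_ofReal h2
  obtain ⟨μ, -, φ, hφ, hlim⟩ := (isCompact_closure_of_isTightMeasureSet htight).tendsto_subseq
    (x := P) fun n => subset_closure ⟨n, rfl⟩
  -- Even moments are integrals of non-negative continuous functions and hence lower semicontinuous
  -- under weak convergence, so the limit inherits the bounds.
  have heven : ∀ j, Integrable (fun t : ℝ => t ^ (2 * j)) (μ : Measure ℝ) ∧
      ∫ t, t ^ (2 * j) ∂(μ : Measure ℝ) ≤ C (2 * j) := fun j => by
    have hnn : ∀ t : ℝ, 0 ≤ t ^ (2 * j) := fun t => (even_two_mul j).pow_nonneg t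
    have h1 := lintegral_le_liminf_lintegral_of_forall_isOpen_measure_le_liminf_measure
      (μ := (μ : Measure ℝ)) (μs := fun i => ν (φ i)) (f := fun t => t ^ (2 * j)) (by fun_prop) hnn
      fun G hG => ProbabilityMeasure.le_liminf_measure_open_of_tendsto hlim hG
    have h2 : ∫⁻ t, ENNReal.ofReal (t ^ (2 * j)) ∂(μ : Measure ℝ) ≤ ENNReal.ofReal (C (2 * j)) := by
      refine h1.trans (liminf_le_of_le (by isBoundedDefault) fun b hb => ?_)
      obtain ⟨n, hn⟩ := hb.exists
      refine hn.trans ?_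
      rw [← ofReal_integral_eq_lintegral_ofReal (hint _ _) (Eventually.of_forall hnn)]
      exact ENNReal.ofReal_le_ofReal (hC _ _)
    have h3 : Integrable (fun t : ℝ => t ^ (2 * j)) (μ : Measure ℝ) := by
      refine ⟨by fun_prop, ?_⟩
      rw [hasFiniteIntegral_iff_ofReal (Eventually.of_forall hnn)]
      exact h2.trans_lt ENNReal.ofReal_lt_top
    refine ⟨h3, ?_⟩
    rw [← ofReal_integral_eq_lintegral_ofReal h3 (Eventually.of_forall hnn)] at h2
    exact (ENNReal.ofReal_le_ofReal_iff (hC0 _)).1 h2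
  have hμint : ∀ k, Integrable (fun t : ℝ => t ^ k) (μ : Measure ℝ) := fun k =>
    ((integrable_const 1).add (heven k).1).mono' (by fun_prop)
      (Eventually.of_forall fun t => abs_pow_le_one_add k t)
  refine ⟨μ, inferInstance, hμint, fun k => ?_⟩
  have happ : ∀ (σ : Measure ℝ) [IsProbabilityMeasure σ] (R : ℝ), 1 ≤ R →
      (∀ k, Integrable (fun t : ℝ => t ^ k) σ) → ∫ t, t ^ (2 * (k + 1)) ∂σ ≤ C (2 * (k + 1)) →
      |∫ t, t ^ k ∂σ - ∫ t, clipPow R k t ∂σ| ≤ C (2 * (k + 1)) * (2 / R) := by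
    intro σ _ R hR hσ hσC
    rw [← integral_sub (hσ k) ((clipPow R k).integrable σ)]
    have hb := norm_integral_le_of_norm_le (f := fun t => t ^ k - clipPow R k t)
      ((hσ (2 * (k + 1))).mul_const (2 / R)) (Eventually.of_forall fun t => abs_sub_clipPow_le hR k t)
    refine hb.trans ?_
    rw [integral_mul_const]
    gcongr
  have hmain : ∀ R : ℝ, 1 ≤ R → |∫ t, t ^ k ∂(μ : Measure ℝ) - M k| ≤ 2 * (C (2 * (k + 1)) * (2 / R)) := by
    intro R hR
    have h1 := (ProbabilityMeasure.tendsto_iff_forall_integral_tendsto.1 hlim) (clipPow R k)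
    have h2 := (hM k).comp hφ.tendsto_atTop
    have h3 : Tendsto (fun i => |∫ t, t ^ k ∂(μ : Measure ℝ) - ∫ t, t ^ k ∂ν (φ i)|) atTop
        (𝓝 |∫ t, t ^ k ∂(μ : Measure ℝ) - M k|) := (tendsto_const_nhds.sub h2).abs
    have h4 : Tendsto (fun i => 2 * (C (2 * (k + 1)) * (2 / R)) +
        |∫ t, clipPow R k t ∂(μ : Measure ℝ) - ∫ t, clipPow R k t ∂ν (φ i)|) atTop
        (𝓝 (2 * (C (2 * (k + 1)) * (2 / R)) + |∫ t, clipPow R k t ∂(μ : Measure ℝ) -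
          ∫ t, clipPow R k t ∂(μ : Measure ℝ)|)) :=
      ((tendsto_const_nhds.sub h1).abs).const_add _
    rw [sub_self, abs_zero, add_zero] at h4
    refine le_of_tendsto_of_tendsto' h3 h4 fun i => ?_
    have h5 := abs_le.1 (happ μ R hR hμint (heven (k + 1)).2)
    have h6 := abs_le.1 (happ (ν (φ i)) R hR (hint _) (hC _ _))
    have h7 := neg_abs_le (∫ t, clipPow R k t ∂(μ : Measure ℝ) - ∫ t, clipPow R k t ∂ν (φ i))
    have h8 := le_abs_self (∫ t, clipPow R k t ∂(μ : Measure ℝ) - ∫ t, clipPow R k t ∂ν (φ i))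
    rw [abs_le]
    constructor <;> linarith [h5.1, h5.2, h6.1, h6.2]
  have hzero : Tendsto (fun R : ℝ => 2 * (C (2 * (k + 1)) * (2 / R))) atTop (𝓝 0) := by
    have := ((tendsto_const_nhds (x := (2 : ℝ))).div_atTop tendsto_id).const_mul (C (2 * (k + 1)))
    simpa using this.const_mul 2
  have hle : |∫ t, t ^ k ∂(μ : Measure ℝ) - M k| ≤ 0 :=
    ge_of_tendsto hzero ((eventually_ge_atTop 1).mono hmain)
  exact sub_eq_zero.1 (abs_nonpos_iff.1 hle)

end MomentProblem

/-! ### From convergence of moments to a limiting probability measure. -/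

section PerelomovPopov

open PSeries

variable {N : ℕ}

lemma ppMeasure_eq (q : ℝ) (lam : Signature N) : ppMeasure q lam = ∑ i : Fin N,
    ENNReal.ofReal ((N : ℝ)⁻¹ * stepWeight (q / N) (scaled (exponents lam)) i) •
      Measure.dirac (scaled (exponents lam) i) := by
  rw [ppMeasure]
  refine Finset.sum_congr rfl fun i _ => ?_
  rw [stepWeight_scaled, one_div]
  have h1 : ∀ j, ((exponents lam j : ℤ) : ℝ) = (lam.1 j : ℝ) + N - 1 - (j : ℕ) := fun j => by
    simp [exponents]
  have h2 : ∀ j, ((lam.1 i : ℝ) - (i : ℕ)) - ((lam.1 j : ℝ) - (j : ℕ)) =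
      (exponents lam i : ℝ) - exponents lam j := fun j => by rw [h1, h1]; ring
  simp only [h2]
  rw [scaled, h1]

variable {q : ℝ} (hq : q ∈ Set.Icc (-1 : ℝ) 1) (lam : Signature N)

lemma integrable_ppMeasure (f : ℝ → ℝ) : Integrable f (ppMeasure q lam) := by
  rw [ppMeasure_eq, integrable_finsetSum_measure]
  intro i _
  exact (integrable_dirac (by simp)).smul_measure ENNReal.ofReal_ne_top

include hq

lemma integral_ppMeasure (k : ℕ) : ∫ t, t ^ k ∂ppMeasure q lam = ppMoment q (exponents lam) k := by
  rw [ppMeasure_eq, integral_finsetSum_measure fun i _ =>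
    (integrable_dirac (by simp)).smul_measure ENNReal.ofReal_ne_top, ppMoment, Finset.mul_sum]
  refine Finset.sum_congr rfl fun i _ => ?_
  rw [integral_smul_measure, integral_dirac, ENNReal.toReal_ofReal, smul_eq_mul, mul_assoc]
  exact mul_nonneg (by positivity) (stepWeight_nonneg (exponents_strictAnti lam).injective hq i)

lemma isProbabilityMeasure_ppMeasure (hN : 0 < N) : IsProbabilityMeasure (ppMeasure q lam) := by
  have hl := (exponents_strictAnti lam).injective
  have h0 : ppMoment q (exponents lam) 0 = 1 := by
    rcases eq_or_ne q 0 with rfl | h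
    · have : (N : ℝ) ≠ 0 := by exact_mod_cast hN.ne'
      rw [ppMoment_zero_left hl, powerMean]
      simp [this]
    · exact ppMoment_zero hN hl h
  refine ⟨?_⟩
  rw [ppMeasure_eq, Measure.finsetSum_apply]
  simp only [Measure.smul_apply, measure_univ, smul_eq_mul, mul_one]
  rw [← ENNReal.ofReal_sum_of_nonneg fun i _ => mul_nonneg (by positivity) (stepWeight_nonneg hl hq i),
    ← Finset.mul_sum]
  simp only [ppMoment, pow_zero, mul_one] at h0
  rw [h0, ENNReal.ofReal_one]

variable {ϱ : ∀ N : ℕ, PMF (Signature N)} {M : ℕ → ℝ}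

omit hq in
-- The event that one of the first `n + 1` moments is off has probability below one for large `N`,
-- so some signature avoids it. Deterministic measures with moments converging to `M` result, and
-- the moment problem is solved along them.
lemma exists_signature_close (h : ∀ k, ConvProb ϱ (fun _ lam => ppMoment q (exponents lam) k) (M k))
    (n : ℕ) : ∃ N, 0 < N ∧ ∃ lam : Signature N, ∀ k ≤ n,
      |ppMoment q (exponents lam) k - M k| ≤ 1 / ((n : ℝ) + 1) := by
  have h1 : ConvProb ϱ (fun _ lam => ∑ k ∈ Finset.range (n + 1), |ppMoment q (exponents lam) k - M k|)
      (∑ k ∈ Finset.range (n + 1), |M k - M k|) :=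
    ConvProb.sum _ fun k _ => (h k).map₂ (ConvProb.const (M k)) (f := fun z => |z.1 - z.2|) (by fun_prop)
  simp only [sub_self, abs_zero, Finset.sum_const_zero] at h1
  have h2 := (h1 (1 / ((n : ℝ) + 1)) (by positivity)).eventually (gt_mem_nhds one_pos)
  obtain ⟨N, hN, hN0⟩ := (h2.and (eventually_gt_atTop 0)).exists
  refine ⟨N, hN0, ?_⟩
  by_contra! hcon
  refine absurd hN (not_lt.2 ?_)
  have h3 : {lam : Signature N | 1 / ((n : ℝ) + 1) ≤
      |∑ k ∈ Finset.range (n + 1), |ppMoment q (exponents lam) k - M k| - 0|} = Set.univ := by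
    refine Set.eq_univ_of_forall fun lam => ?_
    obtain ⟨k, hk, hk'⟩ := hcon lam
    rw [Set.mem_ofPred_eq, sub_zero, abs_of_nonneg (Finset.sum_nonneg fun _ _ => abs_nonneg _)]
    exact hk'.le.trans (Finset.single_le_sum (f := fun k => |ppMoment q (exponents lam) k - M k|)
      (fun _ _ => abs_nonneg _) (Finset.mem_range.2 (by omega)))
  rw [h3, PMF.toOuterMeasure_apply, Set.indicator_univ, PMF.tsum_coe]

theorem exists_measure_of_convProb
    (h : ∀ k, ConvProb ϱ (fun _ lam => ppMoment q (exponents lam) k) (M k)) :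
    ∃ μ : Measure ℝ, IsProbabilityMeasure μ ∧ (∀ k, Integrable (fun t : ℝ => t ^ k) μ) ∧
      (∀ k, ∫ t, t ^ k ∂μ = M k) ∧ ConvInProbMoments ϱ (fun _ lam => ppMeasure q lam) μ := by
  choose N hN lam hlam using exists_signature_close h
  have hp := fun n => isProbabilityMeasure_ppMeasure hq (lam n) (hN n)
  obtain ⟨μ, h1, h2, h3⟩ := exists_measure_of_tendsto_moments (ν := fun n => ppMeasure q (lam n))
    (fun n k => integrable_ppMeasure (lam n) _) (M := M) fun k => by
      rw [tendsto_iff_norm_sub_tendsto_zero]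
      refine squeeze_zero' (Eventually.of_forall fun _ => norm_nonneg _) ?_
        tendsto_one_div_add_atTop_nhds_zero_nat
      filter_upwards [eventually_ge_atTop k] with n hn
      rw [integral_ppMeasure hq]
      exact hlam n k hn
  refine ⟨μ, h1, h2, h3, fun k ε hε => ?_⟩
  have h4 := h k ε hε
  simpa only [integral_ppMeasure hq, h3] using h4

end PerelomovPopov

/-! ### Binomial series, Lagrange inversion and the coefficient formula. -/

section FormalSeries

open PowerSeries

variable {K : Type*} [Field K] [CharZero K]

/-- The generalised binomial coefficients. -/
noncomputable def binomCoeff (s : K) : ℕ → K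
  | 0 => 1
  | n + 1 => (s - n) / (n + 1) * binomCoeff s n

/-- The binomial series `(1 + X)^s`. -/
noncomputable def powSeries (s : K) : PowerSeries K := PowerSeries.mk (binomCoeff s)

omit [CharZero K] in
lemma constantCoeff_powSeries (s : K) : constantCoeff (powSeries s) = 1 := by
  rw [← coeff_zero_eq_constantCoeff_apply, powSeries, coeff_mk, binomCoeff]

lemma coeff_one_add_X_mul_derivative (F : PowerSeries K) (n : ℕ) :
    coeff n ((1 + X) * d⁄dX K F) = (n + 1) * coeff (n + 1) F + n * coeff n F := by
  rw [add_mul, one_mul, map_add, coeff_derivative]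
  rcases n with _ | n
  · simp [mul_comm]
  · rw [mul_comm X, coeff_succ_mul_X, coeff_derivative]
    push_cast
    ring

lemma one_add_X_mul_derivative_powSeries (s : K) :
    (1 + X) * d⁄dX K (powSeries s) = C s * powSeries s := by
  ext n
  have : (n : K) + 1 ≠ 0 := by exact_mod_cast Nat.succ_ne_zero n
  rw [coeff_one_add_X_mul_derivative, coeff_C_mul, powSeries, coeff_mk, coeff_mk, binomCoeff]
  field_simp
  ring

/-- The differential equation is a first-order recursion for the coefficients, so the binomial
series is its only solution with constant term one. -/
lemma eq_powSeries {F : PowerSeries K} {s : K} (h0 : constantCoeff F = 1)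
    (h : (1 + X) * d⁄dX K F = C s * F) : F = powSeries s := by
  ext n
  rw [powSeries, coeff_mk]
  induction n with
  | zero => rw [coeff_zero_eq_constantCoeff_apply, h0, binomCoeff]
  | succ n ih =>
    have hn : (n : K) + 1 ≠ 0 := by exact_mod_cast Nat.succ_ne_zero n
    have h1 := congrArg (coeff n) h
    rw [coeff_one_add_X_mul_derivative, coeff_C_mul] at h1
    rw [binomCoeff, ← ih, div_mul_eq_mul_div, eq_div_iff hn]
    linear_combination h1

lemma one_add_X_mul_powSeries (s : K) : (1 + X) * powSeries s = powSeries (s + 1) := by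
  apply eq_powSeries
  · rw [map_mul, constantCoeff_powSeries]; simp
  · have h := one_add_X_mul_derivative_powSeries s
    rw [Derivation.leibniz, map_add, Derivation.map_one_eq_zero, derivative_X, smul_eq_mul,
      smul_eq_mul, h, map_add, map_one]
    ring

lemma one_add_X_pow_mul_powSeries (s : K) (k : ℕ) : (1 + X) ^ k * powSeries s = powSeries (s + k) := by
  induction k with
  | zero => simp
  | succ k ih =>
    rw [pow_succ', mul_assoc, ih, one_add_X_mul_powSeries]
    congr 1
    push_cast
    ring

section Lagrange

variable {φ : PowerSeries K} (hφ : constantCoeff φ ≠ 0)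

omit [CharZero K] in
lemma hasSubst_X_mul_inv (φ : PowerSeries K) : HasSubst (X * φ⁻¹) :=
  HasSubst.of_constantCoeff_zero' (by simp)

omit [CharZero K] in
-- Modulo `X ^ (n + 1)` a composition with `X * φ⁻¹` is a polynomial in it, so each coefficient is a
-- finite computation.
lemma exists_substAlgHom_eq (φ G : PowerSeries K) (n : ℕ) :
    ∃ Q, (substAlgHom (hasSubst_X_mul_inv φ)) G = X ^ (n + 1) * Q +
      ∑ m ∈ Finset.range (n + 1), C (coeff m G) * (X * φ⁻¹) ^ m := by
  refine ⟨φ⁻¹ ^ (n + 1) *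
    (substAlgHom (hasSubst_X_mul_inv φ)) (PowerSeries.mk fun i => coeff (i + (n + 1)) G), ?_⟩
  conv_lhs => rw [eq_X_pow_mul_shift_add_trunc (n + 1) G]
  rw [map_add, map_mul, map_pow, substAlgHom_X, substAlgHom_coe, mul_pow, mul_assoc,
    Polynomial.aeval_eq_sum_range' (natDegree_trunc_lt G n)]
  congr 1
  refine Finset.sum_congr rfl fun m hm => ?_
  rw [coeff_trunc, if_pos (Finset.mem_range.1 hm), smul_eq_C_mul]

omit [CharZero K] in
lemma coeff_derivative_X_pow_mul (n : ℕ) (Q P : PowerSeries K) :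
    coeff n (d⁄dX K (X ^ (n + 2) * Q) * P) = 0 := by
  have h : X ^ (n + 1) ∣ d⁄dX K (X ^ (n + 2) * Q) * P := by
    apply Dvd.dvd.mul_right
    rw [Derivation.leibniz, Derivation.leibniz_pow, derivative_X, smul_eq_mul]
    refine dvd_add ?_ ?_
    · exact (Dvd.intro_left X (by rw [← pow_succ'])).mul_right _
    · rw [smul_eq_mul]
      apply Dvd.dvd.mul_left
      simp
  exact X_pow_dvd_iff.1 h n (Nat.lt_succ_self n)

include hφ in
-- With `τ = X φ⁻¹` the coefficient is the residue of `(τ ^ m)' τ ^ (-n - 1)`. For `m ≠ n + 1` this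
-- is an exact derivative, and for `m = n + 1` it is `n + 1` times the residue of `τ' / τ`.
lemma coeff_derivative_inversion_pow {n m : ℕ} (hm : m ≤ n + 1) :
    coeff n (d⁄dX K ((X * φ⁻¹) ^ m) * φ ^ (n + 1)) = if m = n + 1 then (n : K) + 1 else 0 := by
  rcases m with _ | m
  · simp
  obtain ⟨p, rfl⟩ : ∃ p, n = m + p := ⟨n - m, by omega⟩
  set η := φ⁻¹ with hη
  have h1 : η * φ = 1 := PowerSeries.inv_mul_cancel φ hφ
  have h1m : ∀ k, η ^ k * φ ^ k = 1 := fun k => by rw [← mul_pow, h1, one_pow]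
  have h2 : d⁄dX K η * φ = -(η * d⁄dX K φ) := by
    have := congrArg (d⁄dX K) h1
    rw [Derivation.leibniz, Derivation.map_one_eq_zero, smul_eq_mul, smul_eq_mul] at this
    linear_combination this
  have h3 : d⁄dX K ((X * η) ^ (m + 1)) * φ ^ (m + p + 1) =
      X ^ m * (((m + 1 : ℕ) : PowerSeries K) * (φ ^ p - X * (η * d⁄dX K φ) * φ ^ p)) := by
    rw [Derivation.leibniz_pow, Derivation.leibniz, derivative_X, smul_eq_mul, smul_eq_mul, smul_eq_mul,
      nsmul_eq_mul, Nat.add_sub_cancel, mul_pow, pow_succ φ, pow_add φ]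
    linear_combination ((m + 1 : ℕ) : PowerSeries K) * X ^ m * φ ^ p *
      ((X * (d⁄dX K η * φ) + η * φ) * h1m m + h1 + X * h2)
  rw [h3, add_comm m p, coeff_X_pow_mul, ← nsmul_eq_mul, map_nsmul, nsmul_eq_mul]
  rcases p with _ | p
  · simp
  · have h4 : X * (η * d⁄dX K φ) * φ ^ (p + 1) = φ ^ p * d⁄dX K φ * X := by
      rw [pow_succ]
      linear_combination X * d⁄dX K φ * φ ^ p * h1
    have h5 := congrArg (coeff p) (Derivation.leibniz_pow (d⁄dX K) φ (p + 1))
    have hp : (p : K) + 1 ≠ 0 := by exact_mod_cast Nat.succ_ne_zero p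
    rw [coeff_derivative, map_nsmul, Nat.add_sub_cancel, smul_eq_mul, nsmul_eq_mul] at h5
    push_cast at h5
    rw [h4, map_sub, coeff_succ_mul_X, if_neg (by omega)]
    have h6 : coeff (p + 1) (φ ^ (p + 1)) = coeff p (φ ^ p * d⁄dX K φ) :=
      mul_right_cancel₀ hp (h5.trans (mul_comm _ _))
    rw [h6, sub_self, mul_zero]

include hφ in
/-- The Lagrange inversion formula. -/
theorem coeff_derivative_subst_mul_pow (G : PowerSeries K) (n : ℕ) :
    coeff n (d⁄dX K ((substAlgHom (hasSubst_X_mul_inv φ)) G) * φ ^ (n + 1)) =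
      (n + 1) * coeff (n + 1) G := by
  obtain ⟨Q, hQ⟩ := exists_substAlgHom_eq φ G (n + 1)
  rw [hQ, map_add, add_mul, map_add, coeff_derivative_X_pow_mul, zero_add, map_sum, Finset.sum_mul,
    map_sum]
  have h1 : ∀ m ∈ Finset.range (n + 2), coeff n (d⁄dX K (C (coeff m G) * (X * φ⁻¹) ^ m) * φ ^ (n + 1)) =
      if m = n + 1 then (n + 1) * coeff (n + 1) G else 0 := by
    intro m hm
    rw [← smul_eq_C_mul, Derivation.map_smul, smul_mul_assoc, map_smul,
      coeff_derivative_inversion_pow hφ (by have := Finset.mem_range.1 hm; omega), smul_eq_mul]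
    split_ifs with h
    · subst h; ring
    · ring
  rw [Finset.sum_congr rfl h1, Finset.sum_ite_eq' , if_pos (Finset.mem_range.2 (by omega))]

include hφ in
omit [CharZero K] in
-- Multiplying the recursion by `τ ^ (k + 1)` and using `τ φ = X`, with `τ = X φ⁻¹`, makes the sum
-- telescope. The remainder `X τ ^ n r_n` is divisible by `X ^ (n + 1)`, so it does not affect low
-- coefficients.
theorem substAlgHom_resolvent {r : ℕ → PowerSeries K} {μ : ℕ → K} (h0 : r 0 = 1)
    (hr : ∀ k, X * r (k + 1) = φ * r k - C (μ k) * (1 + X)) :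
    (substAlgHom (hasSubst_X_mul_inv φ)) (X * PowerSeries.mk μ) * (1 + X) = X := by
  set τ := X * φ⁻¹ with hτ
  have hτφ : τ * φ = X := by rw [hτ, mul_assoc, PowerSeries.inv_mul_cancel φ hφ, mul_one]
  have htel : ∀ n, (τ * ∑ k ∈ Finset.range n, C (μ k) * τ ^ k) * (1 + X) = X - X * (τ ^ n * r n) := by
    intro n
    induction n with
    | zero => simp [h0]
    | succ n ih =>
      rw [Finset.sum_range_succ]
      linear_combination ih + τ ^ (n + 1) * hr n + τ ^ n * r n * hτφ
  have hdvd : ∀ n, coeff n ((substAlgHom (hasSubst_X_mul_inv φ)) (X * PowerSeries.mk μ) * (1 + X) - X) = 0 := by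
    intro n
    obtain ⟨Q, hQ⟩ := exists_substAlgHom_eq φ (PowerSeries.mk μ) n
    simp only [coeff_mk] at hQ
    have h2 : (substAlgHom (hasSubst_X_mul_inv φ)) (X * PowerSeries.mk μ) * (1 + X) - X =
        X ^ (n + 1) * (τ * Q * (1 + X) - X * (φ⁻¹ ^ (n + 1) * r (n + 1))) := by
      have h3 := htel (n + 1)
      have h4 : τ ^ (n + 1) = X ^ (n + 1) * φ⁻¹ ^ (n + 1) := by rw [hτ, mul_pow]
      rw [h4] at h3
      rw [map_mul, substAlgHom_X, hQ, ← hτ]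
      linear_combination h3
    rw [h2]
    exact X_pow_dvd_iff.1 (Dvd.intro _ rfl) n (Nat.lt_succ_self n)
  refine sub_eq_zero.1 (PowerSeries.ext fun n => ?_)
  rw [hdvd, map_zero]

end Lagrange

omit [CharZero K] in
lemma one_add_X_ne_zero : (1 + X : PowerSeries K) ≠ 0 := fun h => by
  have := congrArg constantCoeff h
  simp at this

/-- In the variable `u = 1 + X` the composed series are explicit: `1 - H_1(τ) = u⁻¹`, `H_0(τ) = log
u` and `1 - q H_q(τ) = u ^ (-q)`, where `τ = X φ⁻¹`. Lagrange inversion applied to `H_q(τ)` gives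
the coefficients, and `q = 0` needs no separate treatment because only derivatives enter. -/
theorem coeff_moment_formula {ψ : PowerSeries K} {r : ℕ → PowerSeries K} {μ P M : ℕ → K} {q : K}
    (h0 : r 0 = 1)
    (hr : ∀ k, X * r (k + 1) = ((1 + X) * (1 + X * ψ)) * r k - C (μ k) * (1 + X))
    (h1 : d⁄dX K (X * PowerSeries.mk μ) =
      (1 - X * PowerSeries.mk μ) * d⁄dX K (X * PowerSeries.mk P))
    (hq : d⁄dX K (X * PowerSeries.mk M) =
      (1 - C q * (X * PowerSeries.mk M)) * d⁄dX K (X * PowerSeries.mk P)) (k : ℕ) :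
    ((k : K) + 1) * M k = coeff k (powSeries (-1 - q) * ((1 + X) * (1 + X * ψ)) ^ (k + 1)) := by
  set φ := (1 + X) * (1 + X * ψ) with hφdef
  have hφ : constantCoeff φ ≠ 0 := by simp [hφdef]
  set S : PowerSeries K →ₐ[K] PowerSeries K := substAlgHom (hasSubst_X_mul_inv φ) with hS
  set τ := X * φ⁻¹ with hτ
  have hres := substAlgHom_resolvent hφ h0 hr
  rw [← hS] at hres
  have hder : ∀ G : PowerSeries K, d⁄dX K (S G) = S (d⁄dX K G) * d⁄dX K τ := fun G => by
    rw [hS, coe_substAlgHom]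
    exact derivative_subst (hasSubst_X_mul_inv φ)
  set H1 := S (X * PowerSeries.mk μ) with hH1
  set H0 := S (X * PowerSeries.mk P) with hH0
  set Hq := S (X * PowerSeries.mk M) with hHq
  have e1 : d⁄dX K H1 = (1 - H1) * d⁄dX K H0 := by
    rw [hH1, hder, h1, map_mul, map_sub, map_one, mul_assoc, ← hder]
  have e2 : d⁄dX K Hq = (1 - C q * Hq) * d⁄dX K H0 := by
    rw [hHq, hder, hq, map_mul, map_sub, map_one, mul_assoc, ← hder, map_mul S (C q)]
    have : S (C q) = C q := S.commutes q
    rw [this]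
  have e3 : (1 - H1) * (1 + X) = 1 := by linear_combination -hres
  -- The formal statement `H_0(τ) = log (1 + X)`, obtained by differentiating `H_1(τ) (1 + X) = X`.
  have e4 : d⁄dX K H0 * (1 + X) = 1 := by
    have h2 := congrArg (d⁄dX K) hres
    rw [Derivation.leibniz, map_add, Derivation.map_one_eq_zero, derivative_X, smul_eq_mul,
      smul_eq_mul] at h2
    linear_combination (1 + X) * (h2 - (1 + X) * e1 - d⁄dX K H0 * e3) + e3
  have e5 : 1 - C q * Hq = powSeries (-q) := by
    apply eq_powSeries
    · have : constantCoeff Hq = 0 := by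
        rw [hHq, map_mul, hS, substAlgHom_X]
        simp
      simp [this]
    · rw [map_sub, Derivation.map_one_eq_zero, ← smul_eq_C_mul, Derivation.map_smul, smul_eq_C_mul, smul_eq_C_mul,
        e2, map_neg]
      linear_combination -(C q) * (1 - C q * Hq) * e4
  have e6 : d⁄dX K Hq = powSeries (-1 - q) := by
    apply mul_left_cancel₀ (one_add_X_ne_zero (K := K))
    rw [one_add_X_mul_powSeries, show -1 - q + 1 = -q by ring, ← e5, e2]
    linear_combination (1 - C q * Hq) * e4
  have h3 := coeff_derivative_subst_mul_pow hφ (X * PowerSeries.mk M) k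
  rw [← hS, ← hHq, e6, mul_comm X, coeff_succ_mul_X, coeff_mk] at h3
  exact h3.symm

/-- Binomial expansion of `(1 + X ψ) ^ (k + 1)`: its last term has no coefficient at `X ^ k`, and
the others are matched by `(k + 1) C(k, m) = (m + 1) C(k + 1, m + 1)`. -/
lemma coeff_powSeries_mul_pow (ψ : PowerSeries K) (q : K) (k : ℕ) :
    coeff k (powSeries (-1 - q) * ((1 + X) * (1 + X * ψ)) ^ (k + 1)) =
      ((k : K) + 1) * ∑ m ∈ Finset.range (k + 1), (k.choose m : K) / (m + 1) *
        coeff m (powSeries (k - q) * ψ ^ (k - m)) := by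
  have h1 : powSeries (-1 - q) * ((1 + X) * (1 + X * ψ)) ^ (k + 1) =
      powSeries (k - q) * (1 + X * ψ) ^ (k + 1) := by
    rw [mul_pow, ← mul_assoc, mul_comm (powSeries _), one_add_X_pow_mul_powSeries]
    congr 2
    push_cast
    ring
  rw [h1, add_comm (1 : PowerSeries K), add_pow, Finset.mul_sum, map_sum, Finset.sum_range_succ,
    Finset.mul_sum]
  have h2 : ∀ j, powSeries ((k : K) - q) * ((X * ψ) ^ j * 1 ^ (k + 1 - j) * ((k + 1).choose j : PowerSeries K)) =
      ((k + 1).choose j) • (X ^ j * (powSeries ((k : K) - q) * ψ ^ j)) := fun j => by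
    rw [one_pow, nsmul_eq_mul, mul_pow]
    ring
  have h3 : coeff k (powSeries ((k : K) - q) *
      ((X * ψ) ^ (k + 1) * 1 ^ (k + 1 - (k + 1)) * ((k + 1).choose (k + 1) : PowerSeries K))) = 0 := by
    rw [h2, map_nsmul, coeff_X_pow_mul', if_neg (by omega), smul_zero]
  rw [h3, add_zero, ← Finset.sum_range_reflect]
  refine Finset.sum_congr rfl fun m hm => ?_
  have hm' : m ≤ k := Nat.lt_succ_iff.1 (Finset.mem_range.1 hm)
  rw [h2, map_nsmul, nsmul_eq_mul, coeff_X_pow_mul', if_pos (by omega),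
    show k + 1 - 1 - m = k - m by omega, show k - (k - m) = m by omega,
    ← Nat.choose_symm (show k - m ≤ k + 1 by omega), show k + 1 - (k - m) = m + 1 by omega]
  have h4 : ((k + 1 : ℕ) : K) * (k.choose m : K) = ((k + 1).choose (m + 1) : K) * ((m + 1 : ℕ) : K) := by
    exact_mod_cast Nat.add_one_mul_choose_eq k m
  push_cast at h4
  have h5 : (m : K) + 1 ≠ 0 := by exact_mod_cast Nat.succ_ne_zero m
  rw [← mul_assoc, mul_div_assoc', h4, mul_div_cancel_right₀ _ h5]

end FormalSeries

/-! ### The limit moments in closed form. -/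

section MomentFormula

open PowerSeries

/-- The recursion is the coefficientwise form of `H_q' = (1 - q H_q) H_0'`, which the closed formula
and the comparison of different `q` both use. -/
lemma derivative_X_mul_mk_eq {K : Type*} [Field K] {M P : ℕ → K} {q : K}
    (h : ∀ k : ℕ, ((k : K) + 1) * M k = ((k : K) + 1) * P k -
      q * ∑ b ∈ Finset.range k, M b * (((k - b : ℕ) : K) * P (k - b - 1))) :
    d⁄dX K (X * PowerSeries.mk M) =
      (1 - C q * (X * PowerSeries.mk M)) * d⁄dX K (X * PowerSeries.mk P) := by
  have hc : ∀ (F : ℕ → K) n, coeff n (d⁄dX K (X * PowerSeries.mk F)) = F n * (n + 1) := fun F n => by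
    rw [coeff_derivative, mul_comm X, coeff_succ_mul_X, coeff_mk]
  ext k
  rw [hc, sub_mul, one_mul, map_sub, hc, mul_assoc, coeff_C_mul, mul_assoc, mul_comm X]
  rcases k with _ | k
  · have := h 0
    simpa using this
  · have hk := h (k + 1)
    rw [coeff_succ_mul_X, coeff_mul, Finset.Nat.sum_antidiagonal_eq_sum_range_succ_mk]
    have h1 : ∀ b ∈ Finset.range (k + 1), M b * (((k + 1 - b : ℕ) : K) * P (k + 1 - b - 1)) =
        coeff b (PowerSeries.mk M) * coeff (k - b) (d⁄dX K (X * PowerSeries.mk P)) := by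
      intro b hb
      have hb' := Finset.mem_range.1 hb
      rw [hc, coeff_mk, show k + 1 - b - 1 = k - b by omega, show k + 1 - b = (k - b) + 1 by omega]
      push_cast
      ring
    rw [Finset.sum_congr rfl h1] at hk
    linear_combination hk

/-- The Taylor expansion at `1` of `Ψ'`, with real coefficients. -/
noncomputable def realDerivSeries (a : ℕ → ℝ) : PowerSeries ℝ :=
  PowerSeries.mk fun n => a (n + 1) / (n.factorial : ℝ)

/-- The operator `f ↦ u (ψ f + (f - f(1)) / (u - 1))`. -/
noncomputable def baseOp (ψ f : PowerSeries ℝ) : PowerSeries ℝ :=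
  (1 + X) * (ψ * f + PowerSeries.mk fun n => coeff (n + 1) f)

lemma map_baseOp_iterate (a : ℕ → ℝ) (k : ℕ) :
    PowerSeries.map Complex.ofRealHom ((baseOp (realDerivSeries a))^[k] 1) =
      (PSeries.limOp (PSeries.derivSeries a))^[k] 1 := by
  induction k with
  | zero => simp
  | succ k ih =>
    rw [Function.iterate_succ_apply', Function.iterate_succ_apply', ← ih, baseOp, PSeries.limOp]
    have h1 : PowerSeries.map Complex.ofRealHom (realDerivSeries a) = PSeries.derivSeries a := by
      ext n
      simp [realDerivSeries, PSeries.derivSeries]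
    rw [map_mul, map_add, map_add, map_one, PowerSeries.map_X, map_mul, h1]
    congr 2

lemma baseMoment_eq (a : ℕ → ℝ) (k : ℕ) :
    PSeries.baseMoment a k = constantCoeff ((baseOp (realDerivSeries a))^[k] 1) := by
  rw [PSeries.baseMoment, ← map_baseOp_iterate, ← coeff_zero_eq_constantCoeff_apply, coeff_map,
    coeff_zero_eq_constantCoeff_apply]
  rfl

/-- Multiplying the limit operator by `X` clears the difference quotient; the subtracted constant
term is the moment, which gives the recursion required by `substAlgHom_resolvent`. -/
lemma X_mul_baseOp_iterate (a : ℕ → ℝ) (k : ℕ) : X * (baseOp (realDerivSeries a))^[k + 1] 1 =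
    ((1 + X) * (1 + X * realDerivSeries a)) * (baseOp (realDerivSeries a))^[k] 1 -
      C (PSeries.baseMoment a k) * (1 + X) := by
  rw [Function.iterate_succ_apply', baseMoment_eq]
  set r := (baseOp (realDerivSeries a))^[k] 1
  have h := sub_const_eq_X_mul_shift r
  rw [baseOp]
  linear_combination -(1 + X) * h

/-- The limit moments of the `q`-deformed measures. -/
noncomputable def qMoment (a : ℕ → ℝ) (q : ℝ) : ℕ → ℝ :=
  momentLimit q (powerLimit (PSeries.baseMoment a))

theorem qMoment_eq_coeff (a : ℕ → ℝ) (q : ℝ) (k : ℕ) : ((k : ℝ) + 1) * qMoment a q k =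
    coeff k (powSeries (-1 - q) * ((1 + X) * (1 + X * realDerivSeries a)) ^ (k + 1)) := by
  refine coeff_moment_formula (r := fun k => (baseOp (realDerivSeries a))^[k] 1)
    (μ := PSeries.baseMoment a) (P := powerLimit (PSeries.baseMoment a)) rfl
    (X_mul_baseOp_iterate a) ?_ (derivative_X_mul_mk_eq (momentLimit_eq q _)) k
  have h := derivative_X_mul_mk_eq (M := PSeries.baseMoment a) (P := powerLimit (PSeries.baseMoment a))
    (q := 1) fun k => by
      rw [powerLimit_eq]
      ring
  rwa [map_one, one_mul] at h

theorem qMoment_eq_sum (a : ℕ → ℝ) (q : ℝ) (k : ℕ) : qMoment a q k =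
    ∑ m ∈ Finset.range (k + 1), (k.choose m : ℝ) / (m + 1) *
        coeff m (powSeries (k - q) * realDerivSeries a ^ (k - m)) := by
  have hk : (k : ℝ) + 1 ≠ 0 := by positivity
  apply mul_left_cancel₀ hk
  rw [qMoment_eq_coeff, coeff_powSeries_mul_pow]

end MomentFormula

/-! ### Taylor series of analytic functions of one variable. -/

section Taylor

open PowerSeries

variable {𝕜 : Type*} [RCLike 𝕜] {f g : 𝕜 → 𝕜} {x : 𝕜}

/-- The Taylor expansion of a function of one variable. -/
noncomputable def taylorAt (f : 𝕜 → 𝕜) (x : 𝕜) : PowerSeries 𝕜 :=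
  PowerSeries.mk fun n => iteratedDeriv n f x / (n.factorial : 𝕜)

lemma taylorAt_congr (h : f =ᶠ[𝓝 x] g) : taylorAt f x = taylorAt g x := by
  ext n
  rw [taylorAt, taylorAt, coeff_mk, coeff_mk, h.iteratedDeriv_eq n]

lemma constantCoeff_taylorAt (f : 𝕜 → 𝕜) (x : 𝕜) : constantCoeff (taylorAt f x) = f x := by
  rw [← coeff_zero_eq_constantCoeff_apply, taylorAt, coeff_mk]
  simp

lemma taylorAt_deriv (f : 𝕜 → 𝕜) (x : 𝕜) : taylorAt (deriv f) x = d⁄dX 𝕜 (taylorAt f x) := by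
  ext n
  rw [coeff_derivative, taylorAt, taylorAt, coeff_mk, coeff_mk, iteratedDeriv_succ', Nat.factorial_succ]
  have h1 : (n : 𝕜) + 1 ≠ 0 := by exact_mod_cast Nat.succ_ne_zero n
  have h2 : (n.factorial : 𝕜) ≠ 0 := by exact_mod_cast Nat.factorial_ne_zero n
  push_cast
  field_simp

lemma coeff_succ_eq_of_derivative {F G : PowerSeries 𝕜} {n : ℕ}
    (h : coeff n (d⁄dX 𝕜 F) = coeff n (d⁄dX 𝕜 G)) : coeff (n + 1) F = coeff (n + 1) G := by
  rw [coeff_derivative, coeff_derivative] at h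
  have h1 : (n : 𝕜) + 1 ≠ 0 := by exact_mod_cast Nat.succ_ne_zero n
  exact mul_right_cancel₀ h1 h

lemma AnalyticAt.eventually_differentiableAt (hf : AnalyticAt 𝕜 f x) :
    ∀ᶠ y in 𝓝 x, DifferentiableAt 𝕜 f y :=
  hf.eventually_analyticAt.mono fun _ h => h.differentiableAt

lemma taylorAt_add (hf : AnalyticAt 𝕜 f x) (hg : AnalyticAt 𝕜 g x) :
    taylorAt (fun y => f y + g y) x = taylorAt f x + taylorAt g x := by
  ext n
  induction n generalizing f g with
  | zero => simp [constantCoeff_taylorAt]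
  | succ n ih =>
    apply coeff_succ_eq_of_derivative
    have h : deriv (fun y => f y + g y) =ᶠ[𝓝 x] fun y => deriv f y + deriv g y := by
      filter_upwards [hf.eventually_differentiableAt, hg.eventually_differentiableAt] with y h1 h2
      exact deriv_fun_add h1 h2
    rw [← taylorAt_deriv, taylorAt_congr h, ih hf.deriv hg.deriv, map_add (d⁄dX 𝕜), taylorAt_deriv,
      taylorAt_deriv]

lemma taylorAt_mul (hf : AnalyticAt 𝕜 f x) (hg : AnalyticAt 𝕜 g x) :
    taylorAt (fun y => f y * g y) x = taylorAt f x * taylorAt g x := by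
  ext n
  induction n generalizing f g with
  | zero => simp [constantCoeff_taylorAt]
  | succ n ih =>
    apply coeff_succ_eq_of_derivative
    have h : deriv (fun y => f y * g y) =ᶠ[𝓝 x] fun y => deriv f y * g y + f y * deriv g y := by
      filter_upwards [hf.eventually_differentiableAt, hg.eventually_differentiableAt] with y h1 h2
      exact deriv_fun_mul h1 h2
    rw [← taylorAt_deriv, taylorAt_congr h, taylorAt_add (hf.deriv.fun_mul hg) (hf.fun_mul hg.deriv),
      map_add, ih hf.deriv hg, ih hf hg.deriv, Derivation.leibniz, map_add, taylorAt_deriv, taylorAt_deriv,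
      smul_eq_mul, smul_eq_mul, add_comm, mul_comm (d⁄dX 𝕜 _)]

lemma taylorAt_const (c : 𝕜) : taylorAt (fun _ => c) x = C c := by
  ext n
  rw [taylorAt, coeff_mk, coeff_C]
  rcases n with _ | n
  · simp
  · simp [iteratedDeriv_const]

lemma taylorAt_id : taylorAt (fun y => y) x = C x + X := by
  ext n
  rcases n with _ | n
  · simp [constantCoeff_taylorAt]
  · apply coeff_succ_eq_of_derivative
    rw [← taylorAt_deriv, show deriv (fun y : 𝕜 => y) = fun _ => 1 from deriv_id'', taylorAt_const, map_add,
      derivative_C, derivative_X, zero_add, map_one]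

lemma taylorAt_pow (hf : AnalyticAt 𝕜 f x) (n : ℕ) :
    taylorAt (fun y => f y ^ n) x = taylorAt f x ^ n := by
  induction n with
  | zero => simpa using taylorAt_const (x := x) 1
  | succ n ih =>
    simp only [pow_succ]
    rw [taylorAt_mul (hf.fun_pow n) hf, ih]

lemma eventuallyEq_of_taylorAt_eq (hf : AnalyticAt 𝕜 f x) (hg : AnalyticAt 𝕜 g x)
    (h : taylorAt f x = taylorAt g x) : f =ᶠ[𝓝 x] g := by
  have h1 := hf.hasFPowerSeriesAt
  have h2 := hg.hasFPowerSeriesAt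
  have h3 : (fun n => iteratedDeriv n f x / (n.factorial : 𝕜)) =
      fun n => iteratedDeriv n g x / (n.factorial : 𝕜) := by
    funext n
    have := congrArg (coeff n) h
    rwa [taylorAt, taylorAt, coeff_mk, coeff_mk] at this
  rw [h3] at h1
  have h4 := h1.sub h2
  rw [sub_self] at h4
  filter_upwards [h4.eventually_eq_zero] with y hy
  exact sub_eq_zero.1 hy

lemma analyticAt_and_taylorAt_of_hasSum {c : ℕ → 𝕜}
    (h : ∀ᶠ z in 𝓝 0, HasSum (fun n => z ^ n • c n) (f (x + z))) :
    AnalyticAt 𝕜 f x ∧ taylorAt f x = PowerSeries.mk c := by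
  have h1 : HasFPowerSeriesAt f (FormalMultilinearSeries.ofScalars 𝕜 c) x := by
    rw [hasFPowerSeriesAt_iff]
    simpa only [FormalMultilinearSeries.coeff_ofScalars] using h
  refine ⟨⟨_, h1⟩, ?_⟩
  have h2 := (AnalyticAt.hasFPowerSeriesAt ⟨_, h1⟩).eq_formalMultilinearSeries h1
  ext n
  have h3 := congrArg (fun p => FormalMultilinearSeries.coeff p n) h2
  simpa only [FormalMultilinearSeries.coeff_ofScalars, taylorAt, coeff_mk] using h3

end Taylor

/-! ### Identification with the iterated-derivative formula. -/

section LimitFormula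

open PowerSeries

/-- The function satisfies `u f' = s f` with `f 1 = 1`, the equation characterising the binomial
series. -/
lemma taylorAt_rpow (s : ℝ) : AnalyticAt ℝ (fun u : ℝ => u ^ s) 1 ∧
    taylorAt (fun u : ℝ => u ^ s) 1 = powSeries s := by
  have ha : AnalyticAt ℝ (fun u : ℝ => u ^ s) 1 := by
    have h0 : AnalyticAt ℝ (fun u : ℝ => Real.exp (Real.log u * s)) 1 :=
      analyticAt_rexp.comp ((analyticAt_log one_pos).fun_mul analyticAt_const)
    refine h0.congr ?_
    filter_upwards [eventually_gt_nhds (zero_lt_one (α := ℝ))] with u hu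
    rw [Real.rpow_def_of_pos hu]
  refine ⟨ha, ?_⟩
  apply eq_powSeries
  · rw [constantCoeff_taylorAt, Real.one_rpow]
  · have h1 : (fun u : ℝ => u * deriv (fun u : ℝ => u ^ s) u) =ᶠ[𝓝 1] fun u => s * u ^ s := by
      filter_upwards [eventually_gt_nhds (zero_lt_one (α := ℝ))] with u hu
      rw [Real.deriv_rpow_const, Real.rpow_sub_one hu.ne']
      field_simp
    have h2 := taylorAt_congr h1
    rw [taylorAt_mul (f := fun u : ℝ => u) analyticAt_id ha.deriv, taylorAt_id,
      taylorAt_mul (f := fun _ : ℝ => s) analyticAt_const ha, taylorAt_const,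
      taylorAt_deriv] at h2
    simpa using h2

variable {a : ℕ → ℝ} (hΨ : ∀ᶠ z in 𝓝 (1 : ℝ), Summable fun k : ℕ => a k * (z - 1) ^ k / (k.factorial : ℝ))

include hΨ

lemma analyticAt_psiSeries : AnalyticAt ℝ (psiSeries a) 1 ∧
    taylorAt (psiSeries a) 1 = PowerSeries.mk fun k => a k / (k.factorial : ℝ) := by
  apply analyticAt_and_taylorAt_of_hasSum
  have h1 : Tendsto (fun z : ℝ => 1 + z) (𝓝 0) (𝓝 1) := by
    have : Continuous fun z : ℝ => 1 + z := by fun_prop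
    simpa using this.tendsto 0
  filter_upwards [h1.eventually hΨ] with z hz
  have h2 := hz.hasSum
  simp only [add_sub_cancel_left] at h2
  rw [psiSeries]
  simp only [add_sub_cancel_left]
  refine h2.congr_fun fun n => ?_
  rw [smul_eq_mul]
  ring

theorem limitMoment_eq (q : ℝ) (k : ℕ) : limitMoment (psiSeries a) q k = qMoment a q k := by
  obtain ⟨h1, h2⟩ := analyticAt_psiSeries hΨ
  have h3 : taylorAt (deriv (psiSeries a)) 1 = realDerivSeries a := by
    rw [taylorAt_deriv, h2]
    ext n
    rw [coeff_derivative, coeff_mk, realDerivSeries, coeff_mk, Nat.factorial_succ]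
    have := Nat.factorial_ne_zero n
    push_cast
    field_simp
  rw [limitMoment, qMoment_eq_sum]
  refine Finset.sum_congr rfl fun m _ => ?_
  obtain ⟨h4, h5⟩ := taylorAt_rpow ((k : ℝ) - q)
  have h6 := taylorAt_mul h4 (h1.deriv.fun_pow (k - m))
  rw [h5, taylorAt_pow h1.deriv, h3] at h6
  rw [← h6, taylorAt, coeff_mk, Nat.factorial_succ]
  have := Nat.factorial_ne_zero m
  push_cast
  field_simp

end LimitFormula

/-! ### Geometric growth of the limit moments. -/

section Growth

open PowerSeries

/-- The coefficients grow at most geometrically. -/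
def GeomGrowth (f : PowerSeries ℝ) : Prop :=
  ∃ A D : ℝ, 0 < A ∧ 0 < D ∧ ∀ n, |coeff n f| ≤ A * D ^ n

/-- The weighted `ℓ¹` norm of the first `K + 1` coefficients. -/
noncomputable def truncNorm (r : ℝ) (K : ℕ) (f : PowerSeries ℝ) : ℝ :=
  ∑ n ∈ Finset.range (K + 1), |coeff n f| * r ^ n

lemma truncNorm_nonneg {r : ℝ} (hr : 0 ≤ r) (K : ℕ) (f : PowerSeries ℝ) : 0 ≤ truncNorm r K f :=
  Finset.sum_nonneg fun _ _ => by positivity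

lemma abs_coeff_le_truncNorm {r : ℝ} (hr : 0 ≤ r) (K : ℕ) (f : PowerSeries ℝ) :
    |coeff K f| * r ^ K ≤ truncNorm r K f :=
  Finset.single_le_sum (f := fun n => |coeff n f| * r ^ n) (fun _ _ => by positivity)
    (Finset.mem_range.2 (Nat.lt_succ_self K))

/-- Coefficients of a product up to order `K` involve only coefficients of the factors up to order
`K`, so the truncated weighted norm is submultiplicative without any convergence requirement. -/
lemma truncNorm_mul_le {r : ℝ} (hr : 0 ≤ r) (K : ℕ) (f g : PowerSeries ℝ) :
    truncNorm r K (f * g) ≤ truncNorm r K f * truncNorm r K g := by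
  have h1 : truncNorm r K (f * g) ≤ ∑ n ∈ Finset.range (K + 1),
      ∑ p ∈ Finset.HasAntidiagonal.antidiagonal n, (|coeff p.1 f| * r ^ p.1) * (|coeff p.2 g| * r ^ p.2) := by
    refine Finset.sum_le_sum fun n _ => ?_
    rw [coeff_mul]
    calc _ ≤ (∑ p ∈ Finset.HasAntidiagonal.antidiagonal n, |coeff p.1 f * coeff p.2 g|) * r ^ n := by
          gcongr
          exact Finset.abs_sum_le_sum_abs _ _
      _ = _ := by
          rw [Finset.sum_mul]
          refine Finset.sum_congr rfl fun p hp => ?_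
          rw [abs_mul, ← Finset.HasAntidiagonal.mem_antidiagonal.1 hp, pow_add]
          ring
  refine h1.trans ?_
  rw [truncNorm, truncNorm, Finset.sum_mul_sum, ← Finset.sum_product', ← Finset.sum_biUnion]
  · refine Finset.sum_le_sum_of_subset_of_nonneg (fun p hp => ?_) fun _ _ _ => by positivity
    obtain ⟨n, hn, hpn⟩ := Finset.mem_biUnion.1 hp
    have h2 := Finset.HasAntidiagonal.mem_antidiagonal.1 hpn
    have h3 := Finset.mem_range.1 hn
    exact Finset.mem_product.2 ⟨Finset.mem_range.2 (by omega), Finset.mem_range.2 (by omega)⟩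
  · intro n _ n' _ hnn
    refine Finset.disjoint_left.2 fun p hp hp' => hnn ?_
    rw [← Finset.HasAntidiagonal.mem_antidiagonal.1 hp, Finset.HasAntidiagonal.mem_antidiagonal.1 hp']

lemma truncNorm_le {f : PowerSeries ℝ} {A D r : ℝ} (hA : 0 ≤ A) (hr : 0 ≤ r) (hD : 0 ≤ D) (hrD : r * D ≤ 1 / 2)
    (h : ∀ n, |coeff n f| ≤ A * D ^ n) (K : ℕ) : truncNorm r K f ≤ A * 2 := by
  calc truncNorm r K f ≤ ∑ n ∈ Finset.range (K + 1), A * (1 / 2 : ℝ) ^ n := by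
        refine Finset.sum_le_sum fun n _ => ?_
        calc _ ≤ (A * D ^ n) * r ^ n := by gcongr; exact h n
          _ = A * (r * D) ^ n := by rw [mul_pow]; ring
          _ ≤ _ := by gcongr
    _ ≤ A * 2 := by
        rw [← Finset.mul_sum]
        gcongr
        exact sum_geometric_two_le _

lemma truncNorm_pow_le {r : ℝ} (hr : 0 ≤ r) (K : ℕ) (f : PowerSeries ℝ) (n : ℕ) :
    truncNorm r K (f ^ (n + 1)) ≤ truncNorm r K f ^ (n + 1) := by
  induction n with
  | zero => simp
  | succ n ih =>
    rw [pow_succ, pow_succ _ (n + 1)]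
    exact (truncNorm_mul_le hr K _ _).trans (mul_le_mul_of_nonneg_right ih (truncNorm_nonneg hr K f))

lemma GeomGrowth.mul {f g : PowerSeries ℝ} (hf : GeomGrowth f) (hg : GeomGrowth g) :
    GeomGrowth (f * g) := by
  obtain ⟨A, D, hA, hD, h⟩ := hf
  obtain ⟨A', D', hA', hD', h'⟩ := hg
  have hr : 0 < 1 / (2 * (D + D')) := by positivity
  refine ⟨(A * 2) * (A' * 2), 2 * (D + D'), by positivity, by positivity, fun n => ?_⟩
  have h1 := (abs_coeff_le_truncNorm hr.le n (f * g)).trans (truncNorm_mul_le hr.le n f g)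
  have h2 : truncNorm (1 / (2 * (D + D'))) n f ≤ A * 2 := truncNorm_le hA.le hr.le hD.le (by
    rw [div_mul_eq_mul_div, div_le_div_iff₀ (by positivity) (by positivity)]
    linarith) h n
  have h3 : truncNorm (1 / (2 * (D + D'))) n g ≤ A' * 2 := truncNorm_le hA'.le hr.le hD'.le (by
    rw [div_mul_eq_mul_div, div_le_div_iff₀ (by positivity) (by positivity)]
    linarith) h' n
  have h4 := h1.trans (mul_le_mul h2 h3 (truncNorm_nonneg hr.le n g) (by positivity))
  rwa [one_div, inv_pow, ← div_eq_mul_inv, div_le_iff₀ (by positivity)] at h4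

lemma GeomGrowth.add {f g : PowerSeries ℝ} (hf : GeomGrowth f) (hg : GeomGrowth g) :
    GeomGrowth (f + g) := by
  obtain ⟨A, D, hA, hD, h⟩ := hf
  obtain ⟨A', D', hA', hD', h'⟩ := hg
  refine ⟨A + A', D + D', by positivity, by positivity, fun n => ?_⟩
  rw [map_add]
  calc _ ≤ |coeff n f| + |coeff n g| := abs_add_le _ _
    _ ≤ A * (D + D') ^ n + A' * (D + D') ^ n := by
        refine add_le_add ((h n).trans ?_) ((h' n).trans ?_)
        · gcongr; linarith
        · gcongr; linarith
    _ = _ := by ring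

lemma geomGrowth_one : GeomGrowth 1 := ⟨1, 1, one_pos, one_pos, fun n => by
  rw [coeff_one]; split_ifs <;> simp⟩

lemma geomGrowth_X : GeomGrowth X := ⟨1, 1, one_pos, one_pos, fun n => by
  rw [coeff_X]; split_ifs <;> simp⟩

lemma geomGrowth_powSeries (s : ℝ) : GeomGrowth (powSeries s) := by
  refine ⟨1, |s| + 1, one_pos, by positivity, fun n => ?_⟩
  rw [powSeries, coeff_mk, one_mul]
  induction n with
  | zero => simp [binomCoeff]
  | succ n ih =>
    rw [binomCoeff, abs_mul, pow_succ', abs_div, abs_of_pos (by positivity : (0 : ℝ) < n + 1)]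
    gcongr
    rw [div_le_iff₀ (by positivity)]
    calc |s - n| ≤ |s| + |(n : ℝ)| := abs_sub _ _
      _ = |s| + n := by rw [Nat.abs_cast]
      _ ≤ _ := by nlinarith [abs_nonneg s, (Nat.cast_nonneg n : (0 : ℝ) ≤ n)]

lemma geomGrowth_realDerivSeries {a : ℕ → ℝ}
    (hΨ : ∀ᶠ z in 𝓝 (1 : ℝ), Summable fun k : ℕ => a k * (z - 1) ^ k / (k.factorial : ℝ)) :
    GeomGrowth (realDerivSeries a) := by
  obtain ⟨ε, hε, h⟩ := Metric.eventually_nhds_iff.1 hΨ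
  obtain ⟨ρ, hρ0, hρ⟩ := exists_between hε
  have h1 : Summable fun k : ℕ => a k * ρ ^ k / (k.factorial : ℝ) := by
    have := h (y := 1 + ρ) (by simpa [abs_of_pos hρ0] using hρ)
    simpa using this
  obtain ⟨B, hB⟩ := (h1.tendsto_atTop_zero.abs.bddAbove_range : BddAbove _)
  have hB0 : 0 ≤ B := (abs_nonneg _).trans (hB ⟨0, rfl⟩)
  refine ⟨(B + 1) / ρ, 2 / ρ, by positivity, by positivity, fun n => ?_⟩
  rw [realDerivSeries, coeff_mk]
  have h2 : |a (n + 1) * ρ ^ (n + 1) / ((n + 1).factorial : ℝ)| ≤ B := hB ⟨n + 1, rfl⟩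
  have hf : (0 : ℝ) < n.factorial := by exact_mod_cast Nat.factorial_pos n
  rw [Nat.factorial_succ, abs_div, abs_mul, abs_of_pos (pow_pos hρ0 _), div_le_iff₀ (by positivity)] at h2
  push_cast at h2
  rw [abs_of_pos (by positivity : (0 : ℝ) < (n + 1) * n.factorial)] at h2
  rw [abs_div, abs_of_pos hf, div_le_iff₀ hf, div_pow, div_mul_div_comm, ← pow_succ', div_mul_eq_mul_div,
    le_div_iff₀ (by positivity)]
  refine h2.trans ?_
  -- Differentiation costs a factor `n + 1`, absorbed by doubling the growth rate; hence `2 / ρ`.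
  have h3 : (n : ℝ) + 1 ≤ 2 ^ n := by exact_mod_cast Nat.lt_two_pow_self (n := n)
  calc B * ((n + 1) * n.factorial) ≤ (B + 1) * (2 ^ n * n.factorial) := by gcongr; linarith
    _ = _ := by ring

/-- By the coefficient formula the moment is, up to `1 / (n + 1)`, a coefficient of a fixed series
times `φ ^ (n + 1)`. Submultiplicativity bounds the truncated norm of that power geometrically. -/
theorem geomGrowth_qMoment {a : ℕ → ℝ}
    (hΨ : ∀ᶠ z in 𝓝 (1 : ℝ), Summable fun k : ℕ => a k * (z - 1) ^ k / (k.factorial : ℝ)) (q : ℝ) :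
    GeomGrowth (PowerSeries.mk (qMoment a q)) := by
  have hφ : GeomGrowth ((1 + X) * (1 + X * realDerivSeries a)) :=
    (geomGrowth_one.add geomGrowth_X).mul
      (geomGrowth_one.add (geomGrowth_X.mul (geomGrowth_realDerivSeries hΨ)))
  obtain ⟨A, D, hA, hD, h⟩ := hφ
  obtain ⟨A', D', hA', hD', h'⟩ := geomGrowth_powSeries (-1 - q)
  have hr : 0 < 1 / (2 * (D + D')) := by positivity
  refine ⟨(A' * 2) * (A * 2), (A * 2) * (2 * (D + D')), by positivity, by positivity, fun n => ?_⟩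
  set φ := (1 + X) * (1 + X * realDerivSeries a)
  have h1 := (abs_coeff_le_truncNorm hr.le n (powSeries (-1 - q) * φ ^ (n + 1))).trans
    (truncNorm_mul_le hr.le n _ _)
  have h2 : truncNorm (1 / (2 * (D + D'))) n φ ≤ A * 2 := truncNorm_le hA.le hr.le hD.le (by
    rw [div_mul_eq_mul_div, div_le_div_iff₀ (by positivity) (by positivity)]
    linarith) h n
  have h3 : truncNorm (1 / (2 * (D + D'))) n (powSeries (-1 - q)) ≤ A' * 2 :=
    truncNorm_le hA'.le hr.le hD'.le (by
      rw [div_mul_eq_mul_div, div_le_div_iff₀ (by positivity) (by positivity)]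
      linarith) h' n
  have h4 := (truncNorm_pow_le hr.le n φ n).trans
    (pow_le_pow_left₀ (truncNorm_nonneg hr.le n φ) h2 (n + 1))
  have h5 := h1.trans (mul_le_mul h3 h4 (truncNorm_nonneg hr.le n _) (by positivity))
  rw [one_div, inv_pow, ← div_eq_mul_inv, div_le_iff₀ (by positivity), ← qMoment_eq_coeff, abs_mul,
    abs_of_pos (by positivity : (0 : ℝ) < n + 1)] at h5
  rw [coeff_mk]
  calc |qMoment a q n| ≤ (n + 1) * |qMoment a q n| :=
        le_mul_of_one_le_left (abs_nonneg _) (by linarith [(Nat.cast_nonneg n : (0 : ℝ) ≤ n)])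
    _ ≤ _ := h5
    _ = _ := by rw [mul_pow (A * 2) (2 * (D + D')) n]; ring

end Growth

/-! ### Equality of the transforms for different `q`. -/

section Transform

open PowerSeries

lemma momentSeries_props {c : ℕ → ℝ} (hc : GeomGrowth (PowerSeries.mk c)) :
    (∀ᶠ z in 𝓝 (0 : ℂ), Summable fun k : ℕ => (c k : ℂ) * z ^ (k + 1)) ∧
    AnalyticAt ℂ (fun z : ℂ => ∑' k : ℕ, (c k : ℂ) * z ^ (k + 1)) 0 ∧
    taylorAt (fun z : ℂ => ∑' k : ℕ, (c k : ℂ) * z ^ (k + 1)) 0 =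
      X * PowerSeries.mk fun k => (c k : ℂ) := by
  obtain ⟨A, D, hA, hD, h⟩ := hc
  have hs : ∀ᶠ z in 𝓝 (0 : ℂ), Summable fun k : ℕ => (c k : ℂ) * z ^ (k + 1) := by
    filter_upwards [Metric.ball_mem_nhds (0 : ℂ) (inv_pos.2 hD)] with z hz
    rw [mem_ball_zero_iff, ← one_div, lt_div_iff₀ hD] at hz
    refine Summable.of_norm_bounded (g := fun k => A * ‖z‖ * (‖z‖ * D) ^ k)
      ((summable_geometric_of_lt_one (by positivity) hz).mul_left _) fun k => ?_
    rw [norm_mul, norm_pow, Complex.norm_real, Real.norm_eq_abs]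
    have := h k
    rw [coeff_mk] at this
    calc _ ≤ (A * D ^ k) * ‖z‖ ^ (k + 1) := by gcongr
      _ = _ := by rw [mul_pow]; ring
  have h1 : X * PowerSeries.mk (fun k => (c k : ℂ)) =
      PowerSeries.mk fun n => Nat.casesOn n 0 fun k => (c k : ℂ) := by
    ext n
    rcases n with _ | n
    · simp
    · rw [mul_comm, coeff_succ_mul_X, coeff_mk, coeff_mk]
  rw [h1]
  refine ⟨hs, analyticAt_and_taylorAt_of_hasSum ?_⟩
  filter_upwards [hs] with z hz
  rw [zero_add, ← hasSum_nat_add_iff' 1]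
  simpa [mul_comm] using hz.hasSum

/-- The product `(1 - q F) exp (q G)` has derivative zero near `0` and the value one there. -/
lemma one_sub_mul_eventuallyEq_exp {F G : ℂ → ℂ} {q : ℂ} (hF : AnalyticAt ℂ F 0)
    (hG : AnalyticAt ℂ G 0) (hF0 : F 0 = 0) (hG0 : G 0 = 0)
    (h : deriv F =ᶠ[𝓝 0] fun z => (1 - q * F z) * deriv G z) :
    ∀ᶠ z in 𝓝 0, 1 - q * F z = Complex.exp (-(q * G z)) := by
  have hH : AnalyticAt ℂ (fun z => (1 - q * F z) * Complex.exp (q * G z)) 0 := by fun_prop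
  have h1 : deriv (fun z => (1 - q * F z) * Complex.exp (q * G z)) =ᶠ[𝓝 0] fun _ => 0 := by
    filter_upwards [h, hF.eventually_differentiableAt, hG.eventually_differentiableAt] with z hz hFz hGz
    have h2 := ((hFz.hasDerivAt.const_mul q).const_sub 1).fun_mul (hGz.hasDerivAt.const_mul q).cexp
    rw [h2.deriv, hz]
    ring
  have h2 : taylorAt (fun z => (1 - q * F z) * Complex.exp (q * G z)) 0 = taylorAt (fun _ => 1) 0 := by
    ext n
    rcases n with _ | n
    · simp [constantCoeff_taylorAt, hF0, hG0]
    · apply coeff_succ_eq_of_derivative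
      rw [← taylorAt_deriv, taylorAt_congr h1, taylorAt_const, taylorAt_const, derivative_C, map_zero]
  filter_upwards [eventuallyEq_of_taylorAt_eq hH analyticAt_const h2] with z hz
  rw [Complex.exp_neg]
  exact eq_inv_of_mul_eq_one_left hz

lemma qTransform_eventuallyEq {a : ℕ → ℝ}
    (hΨ : ∀ᶠ z in 𝓝 (1 : ℝ), Summable fun k : ℕ => a k * (z - 1) ^ k / (k.factorial : ℝ)) (q : ℝ) :
    ∀ᶠ z in 𝓝 (0 : ℂ), (Summable fun k : ℕ => (qMoment a q k : ℂ) * z ^ (k + 1)) ∧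
      qTransform q (qMoment a q) z = qTransform 0 (qMoment a 0) z := by
  obtain ⟨hs, hF, hFT⟩ := momentSeries_props (geomGrowth_qMoment hΨ q)
  obtain ⟨-, hG, hGT⟩ := momentSeries_props (geomGrowth_qMoment hΨ 0)
  by_cases hq : q = 0
  · subst hq
    exact hs.mono fun z hz => ⟨hz, rfl⟩
  set F : ℂ → ℂ := fun z => ∑' k : ℕ, (qMoment a q k : ℂ) * z ^ (k + 1) with hFdef
  set G : ℂ → ℂ := fun z => ∑' k : ℕ, (qMoment a 0 k : ℂ) * z ^ (k + 1) with hGdef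
  have hF0 : F 0 = 0 := by simp [hFdef]
  have hG0 : G 0 = 0 := by simp [hGdef]
  have hd : d⁄dX ℂ (taylorAt F 0) = (1 - C (q : ℂ) * taylorAt F 0) * d⁄dX ℂ (taylorAt G 0) := by
    rw [hFT, hGT]
    refine derivative_X_mul_mk_eq fun k => ?_
    have h1 := momentLimit_eq q (qMoment a 0) k
    have h2 : momentLimit q (qMoment a 0) = qMoment a q := by
      rw [qMoment, momentLimit_zero_left, qMoment]
    rw [h2] at h1
    exact_mod_cast h1
  have hdF : deriv F =ᶠ[𝓝 0] fun z => (1 - q * F z) * deriv G z := by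
    refine eventuallyEq_of_taylorAt_eq hF.deriv 
      ((analyticAt_const.fun_sub (analyticAt_const.fun_mul hF)).fun_mul hG.deriv) ?_
    have h1 : taylorAt (fun z => 1 - q * F z) 0 = 1 - C (q : ℂ) * taylorAt F 0 := by
      have h2 := taylorAt_add (f := fun _ : ℂ => (1 : ℂ)) (g := fun z => -(q : ℂ) * F z) (x := 0)
        analyticAt_const (by fun_prop)
      rw [taylorAt_mul (f := fun _ : ℂ => -(q : ℂ)) analyticAt_const hF, taylorAt_const, taylorAt_const] at h2
      simp only [neg_mul, ← sub_eq_add_neg, map_neg, map_one] at h2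
      exact h2
    rw [taylorAt_mul (f := fun z => 1 - q * F z) (by fun_prop) hG.deriv, h1, taylorAt_deriv, taylorAt_deriv, hd]
  -- Near `0` the imaginary part of `-q G` lies in `(-π, π)`, so the principal logarithm inverts the
  -- exponential and the power `1 / q` is the expected branch.
  have hlim : Tendsto (fun z => (-(q * G z)).im) (𝓝 0) (𝓝 0) := by
    have : ContinuousAt (fun z => (-(q * G z)).im) 0 :=
      Complex.continuous_im.continuousAt.comp (continuousAt_const.mul hG.continuousAt).neg
    simpa [ContinuousAt, hG0] using this
  filter_upwards [hs, one_sub_mul_eventuallyEq_exp hF hG hF0 hG0 hdF,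
    hlim.eventually (gt_mem_nhds Real.pi_pos),
    hlim.eventually (lt_mem_nhds (neg_lt_zero.2 Real.pi_pos))] with z h1 h2 h3 h4
  refine ⟨h1, ?_⟩
  have hqc : (q : ℂ) ≠ 0 := by exact_mod_cast hq
  rw [qTransform, qTransform, if_neg hq, if_pos rfl]
  change (1 - (q : ℂ) * F z) ^ (1 / (q : ℂ)) = Complex.exp (-G z)
  rw [h2, Complex.cpow_def_of_ne_zero (Complex.exp_ne_zero _), Complex.log_exp h4 h3.le]
  congr 1
  field_simp

end Transform


/-! ### The theorem. -/

theorem theorem1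
    (ϱ : ∀ N : ℕ, PMF (Signature N))
    (hS : ∀ N : ℕ, ∃ U ∈ 𝓝 (1 : Fin N → ℂ), SummableUniformlyOn (schurTerm (ϱ N)) U)
    (a : ℕ → ℝ)
    (ha : ∀ i k : ℕ, 1 ≤ k →
      Tendsto (fun N : ℕ => iterPartialD (List.replicate k i) (logSchurGen (ϱ N)) 1)
        atTop (𝓝 (a k : ℂ)))
    (hmix : ∀ is : List ℕ, 2 ≤ is.toFinset.card →
      Tendsto (fun N : ℕ => iterPartialD is (logSchurGen (ϱ N)) 1) atTop (𝓝 0))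
    (hΨ : ∀ᶠ z in 𝓝 (1 : ℝ),
      Summable fun k : ℕ => a k * (z - 1) ^ k / (k.factorial : ℝ)) :
    ∃ μ : ℝ → Measure ℝ,
      (∀ q ∈ Set.Icc (-1 : ℝ) 1,
        IsProbabilityMeasure (μ q) ∧
        (∀ k : ℕ, Integrable (fun t : ℝ => t ^ k) (μ q)) ∧
        (∀ k : ℕ, ∫ t, t ^ k ∂(μ q) = limitMoment (psiSeries a) q k) ∧
        ConvInProbMoments ϱ (fun _ lam => ppMeasure q lam) (μ q)) ∧
      (∀ q ∈ Set.Icc (-1 : ℝ) 1, ∀ q' ∈ Set.Icc (-1 : ℝ) 1, ∀ᶠ z in 𝓝 (0 : ℂ),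
        (Summable fun k : ℕ => ((∫ t, t ^ k ∂(μ q) : ℝ) : ℂ) * z ^ (k + 1)) ∧
        (Summable fun k : ℕ => ((∫ t, t ^ k ∂(μ q') : ℝ) : ℂ) * z ^ (k + 1)) ∧
        qTransform q (fun k => ∫ t, t ^ k ∂(μ q)) z =
          qTransform q' (fun k => ∫ t, t ^ k ∂(μ q')) z) := by
  have hex : ∀ q ∈ Set.Icc (-1 : ℝ) 1, ∃ ν : Measure ℝ, IsProbabilityMeasure ν ∧
      (∀ k : ℕ, Integrable (fun t : ℝ => t ^ k) ν) ∧ (∀ k : ℕ, ∫ t, t ^ k ∂ν = qMoment a q k) ∧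
      ConvInProbMoments ϱ (fun _ lam => ppMeasure q lam) ν := fun q hq =>
    exists_measure_of_convProb hq (PSeries.convProb_moment hS ha hmix q)
  -- Outside `[-1, 1]` the weights need not be non-negative; there `μ` takes arbitrary values, on
  -- which nothing is claimed.
  choose! μ hμ using hex
  refine ⟨μ, fun q hq => ?_, fun q hq q' hq' => ?_⟩
  · obtain ⟨h1, h2, h3, h4⟩ := hμ q hq
    exact ⟨h1, h2, fun k => (h3 k).trans (limitMoment_eq hΨ q k).symm, h4⟩
  · simp only [(hμ q hq).2.2.1, (hμ q' hq').2.2.1]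
    filter_upwards [qTransform_eventuallyEq hΨ q, qTransform_eventuallyEq hΨ q'] with z hz hz'
    exact ⟨hz.1, hz'.1, hz.2.trans hz'.2.symm⟩
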